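/- **Setting.** For $\mathbf A=(A_1,\dots,A_6)\in\mathbb R^6$ let $$\Psi_{\mathbf A}(t,s)=(t,s,A_1t^2+2A_2ts+A_3s^2,A_4t^2+2A_5ts+A_6s^2),$$ $c_1=A_1A_5-A_2A_4$, $c_2=A_1A_6-A_3A_4$, $c_3=A_6A_2-A_5A_3$. For $L>0$ let $\mathcal L_L$ be the set of all $\mathbf A$ with $|A_i|\le L$ for every $i$ and $\max\{|c_1|,|c_2|,|c_3|\}\ge 1/L$. Write $e(u)=e^{2\pi iu}$, and for $S\subset[0,1]^2$ let $E_Sg(x)=\int_S g(t,s)\,e(x\cdot\Psi_{\mathbf A}(t,s))\,dt\,ds$, $x\in\mathbb R^4$. For a ball $B$ with center $c$ and radius $r$ let $w_B(x)=(1+|x-c|/r)^{-100}$ and $\|f\|_{L^p(w_B)}^p=\int|f|^pw_B$. Squares are axis-parallel. Two sets $S_1,S_2\subset[0,1]^2$ are $\nu$-transverse if $$|c_1(t_1-t_2)^2+c_2(t_1-t_2)(s_1-s_2)+c_3(s_1-s_2)^2|\ge\nu\quad\text{for all }(t_i,s_i)\in S_i .$$ Sums over $l(R)=1/K$ and over $l(\Delta)=N^{-1/2}$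 run over the dyadic squares of that side length in $[0,1]^2$; here $K=2^m$ and $N=4^n$ with integers $m,n\ge0$. Finally, $D_{multi}(N,p,\nu)\ge 0$ is the smallest constant $D$ such that $$\big\||E_{R_1}g_1E_{R_2}g_2|^{1/2}\big\|_{L^p(w_{B_N})}\le D\Big(\prod_{i=1}^2\sum_{l(\Delta)=N^{-1/2}}\|E_\Delta g_i\|_{L^p(w_{B_N})}^p\Big)^{\frac1{2p}}$$ for all $\nu$-transverse squares $R_1,R_2\subset[0,1]^2$ of arbitrary positive side lengths, all integrable $g_i:R_i\to\mathbb C$ (extended by $0$) and all balls $B_N\subset\mathbb R^4$ of radius $N$. **Proposition.** Let $2\le p<\infty$. (i) For every $L>0$ there is a constant $C$ depending only on $p$ and $L$ such that for every $\mathbf A\in\mathcal L_L$, all $K=2^m\ge1$ and $N=4^n\ge1$, every integrable $g:[0,1]^2\to\mathbb C$ and every ball $B_N\subset\mathbb R^4$ of radius $N$, $$\|E_{[0,1]^2}g\|_{L^p(w_{B_N})}^p\le C\Big(K^{p-2}\sum_{l(R)=1/K}\|E_Rg\|_{L^p(w_{B_N})}^p+K^{4p}D_{multi}(N,p,K^{-2})^p\sum_{l(\Delta)=N^{-1/2}}\|E_\Delta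 g\|_{L^p(w_{B_N})}^p\Big).$$ (ii) The factor $K^{p-2}$ is sharp for the contribution of non-transverse squares, in the following sense. For the surface $(t,s,t^2,ts)$ there is $\kappa>0$, depending only on $p$, such that for all $K=2^m\ge1$, all real $N\ge K$ and every ball $B_N$ of radius $N$ there are a collection of dyadic squares of side length $1/K$ no two of which are $K^{-2}$-transverse, and an integrable $g$ vanishing outside their union, with $$\|E_{[0,1]^2}g\|_{L^p(w_{B_N})}^p\ge\kappa K^{p-2}\sum_{l(R)=1/K}\|E_Rg\|_{L^p(w_{B_N})}^p>0 .$$ -/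

import Mathlib

open MeasureTheory
open scoped ENNReal NNReal

noncomputable section

namespace Decoupling

/-- Coefficients `(A₁, …, A₆)` of a pair of quadratic forms in two variables. -/
structure Coeffs where
  A1 : ℝ
  A2 : ℝ
  A3 : ℝ
  A4 : ℝ
  A5 : ℝ
  A6 : ℝ

/-- The first minor `A₁A₅ - A₂A₄`. -/
def Coeffs.c1 (A : Coeffs) : ℝ := A.A1 * A.A5 - A.A2 * A.A4

/-- The second minor `A₁A₆ - A₃A₄`. -/
def Coeffs.c2 (A : Coeffs) : ℝ := A.A1 * A.A6 - A.A3 * A.A4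

/-- The third minor `A₆A₂ - A₅A₃`. -/
def Coeffs.c3 (A : Coeffs) : ℝ := A.A6 * A.A2 - A.A5 * A.A3

/-- The class of coefficients bounded by `L` that are nondegenerate with
lower bound `1 / L` for the largest of the three `2 × 2` minors. -/
def Coeffs.Nondegenerate (L : ℝ) (A : Coeffs) : Prop :=
  |A.A1| ≤ L ∧ |A.A2| ≤ L ∧ |A.A3| ≤ L ∧ |A.A4| ≤ L ∧ |A.A5| ≤ L ∧ |A.A6| ≤ L ∧
    L⁻¹ ≤ max |A.c1| (max |A.c2| |A.c3|)

/-- The quadratic surface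
`(t, s, A₁t² + 2A₂ts + A₃s², A₄t² + 2A₅ts + A₆s²)` in `ℝ⁴`. -/
def surface (A : Coeffs) (z : ℝ × ℝ) : EuclideanSpace ℝ (Fin 4) :=
  !₂[z.1, z.2,
    A.A1 * z.1 ^ 2 + 2 * A.A2 * z.1 * z.2 + A.A3 * z.2 ^ 2,
    A.A4 * z.1 ^ 2 + 2 * A.A5 * z.1 * z.2 + A.A6 * z.2 ^ 2]

/-- The character `e(u) = exp(2πiu)`. -/
def e (u : ℝ) : ℂ := Complex.exp (2 * Real.pi * Complex.I * u)

/-- The extension operator `E_S g(x) = ∫_S g(t,s) e(x · Ψ_A(t,s)) dt ds`. -/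
def extension (A : Coeffs) (S : Set (ℝ × ℝ)) (g : ℝ × ℝ → ℂ)
    (x : EuclideanSpace ℝ (Fin 4)) : ℂ :=
  ∫ z in S, g z * e (inner ℝ x (surface A z))

/-- The weight `w_B(x) = (1 + |x - c| / R)^{-100}` of the ball `B` with center `c`
and radius `R`. -/
def ballWeight (c : EuclideanSpace ℝ (Fin 4)) (R : ℝ) (x : EuclideanSpace ℝ (Fin 4)) : ℝ :=
  1 / (1 + ‖x - c‖ / R) ^ 100

/-- The norm `‖f‖_{L^p(w_B)} = (∫ |f|^p w_B)^{1/p}` for the ball `B` with center `c`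
and radius `R` (only used for `0 < p < ∞`). -/
def wNorm {F : Type*} [NormedAddCommGroup F] (p : ℝ) (c : EuclideanSpace ℝ (Fin 4)) (R : ℝ)
    (f : EuclideanSpace ℝ (Fin 4) → F) : ℝ≥0∞ :=
  eLpNorm f (ENNReal.ofReal p)
    (volume.withDensity fun x => ENNReal.ofReal (ballWeight c R x))

/-- The closed axis-parallel square with lower left corner `(a, b)` and side length `l`. -/
def square (a b l : ℝ) : Set (ℝ × ℝ) := Set.Icc a (a + l) ×ˢ Set.Icc b (b + l)

/-- The unit square `[0,1]²`. -/
def unitSquare : Set (ℝ × ℝ) := square 0 0 1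

/-- The dyadic squares of side length `2⁻ⁿ` in `[0,1]²`, indexed by their `4ⁿ` positions. -/
def dyadicSquare (n : ℕ) (q : Fin (2 ^ n) × Fin (2 ^ n)) : Set (ℝ × ℝ) :=
  square ((q.1 : ℕ) / 2 ^ n) ((q.2 : ℕ) / 2 ^ n) (1 / 2 ^ n)

/-- `ν`-transversality of two sets with respect to the quadratic surface. -/
def Transverse (A : Coeffs) (ν : ℝ) (S₁ S₂ : Set (ℝ × ℝ)) : Prop :=
  ∀ z₁ ∈ S₁, ∀ z₂ ∈ S₂,
    ν ≤ |A.c1 * (z₁.1 - z₂.1) ^ 2 + A.c2 * (z₁.1 - z₂.1) * (z₁.2 - z₂.2)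
      + A.c3 * (z₁.2 - z₂.2) ^ 2|

/-- The sum `∑_{l(Δ) = 2⁻ⁿ} ‖E_Δ g‖_{L^p(w_B)}^p` over all dyadic squares of side `2⁻ⁿ`, where
`B` is the ball with center `c` and radius `R`. -/
def pieceSum (A : Coeffs) (p : ℝ) (n : ℕ) (c : EuclideanSpace ℝ (Fin 4)) (R : ℝ)
    (g : ℝ × ℝ → ℂ) : ℝ≥0∞ :=
  ∑ q : Fin (2 ^ n) × Fin (2 ^ n), wNorm p c R (extension A (dyadicSquare n q) g) ^ p

/-- `D` is an admissible constant for the bilinear decoupling inequality at scale `N = 4ⁿ`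
(so that the squares `Δ` have side length `N^{-1/2} = 2⁻ⁿ`). A function on a square `Rᵢ` is
regarded as a function on the plane that vanishes outside `Rᵢ`. -/
def IsBilinearConstant (A : Coeffs) (n : ℕ) (p ν : ℝ) (D : ℝ≥0∞) : Prop :=
  ∀ (a₁ b₁ l₁ a₂ b₂ l₂ : ℝ), 0 < l₁ → 0 < l₂ →
    square a₁ b₁ l₁ ⊆ unitSquare → square a₂ b₂ l₂ ⊆ unitSquare →
    Transverse A ν (square a₁ b₁ l₁) (square a₂ b₂ l₂) →
    ∀ (g₁ g₂ : ℝ × ℝ → ℂ), Integrable g₁ → Integrable g₂ →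
      Function.support g₁ ⊆ square a₁ b₁ l₁ → Function.support g₂ ⊆ square a₂ b₂ l₂ →
      ∀ c : EuclideanSpace ℝ (Fin 4),
        wNorm p c (4 ^ n) (fun x => ‖extension A (square a₁ b₁ l₁) g₁ x *
            extension A (square a₂ b₂ l₂) g₂ x‖ ^ (1 / 2 : ℝ)) ≤
          D * (pieceSum A p n c (4 ^ n) g₁ * pieceSum A p n c (4 ^ n) g₂) ^ (1 / (2 * p))

/-- The bilinear decoupling constant `D_multi(N, p, ν)` for `N = 4ⁿ`: the smallest admissible
constant. -/
def Dmulti (A : Coeffs) (n : ℕ) (p ν : ℝ) : ℝ≥0∞ :=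
  sInf {D : ℝ≥0∞ | IsBilinearConstant A n p ν D}

/-- The coefficients of the surface `(t, s, t², ts)`. -/
def twisted : Coeffs := ⟨1, 0, 0, 0, 1 / 2, 0⟩

end Decoupling

end

noncomputable section

namespace Decoupling

/-! The inequality is a broad-narrow argument. Fix `x`, let f_q be the value at `x` of the extension
from the square R_q of side 1/K, and let |f_q| be maximal. If some R_r outside a suitable
neighbourhood of R_q has |f_r| ≥ K^{-2}|f_q|, the K² terms sum to at most K²|f_q| ≤ K³|f_q
f_r|^{1/2}; otherwise the terms outside the neighbourhood add up to at most |f_q|. When the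
neighbourhood contains every square not transverse to R_q, the first case is governed by `Dmulti`,
and summing over all pairs costs K^{3p+2} ≤ K^{4p}.

The narrow case rests on `exists_strips`. Non-transversality says that the quadratic form with
coefficients c₁, c₂, c₃ is less than 1 in modulus at some K(z - w). A nondegenerate form, definite
or not, dominates a product of two linear forms whose coefficients are bounded and not both small
(`exists_linear_factors`). One of the two linear forms is then O(1), so two strips of O(K) squares
serve as the neighbourhood. Inclusion-exclusion leaves sums over single strips and over an
intersection. Since q depends on `x`, one sums over all strips, and each square lies in boundedly
many of them.

For p-th powers, any family of M squares of side 1/K decouples with constant O(M^{p-2}) over balls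
of radius at least K, whatever the surface (`exists_flat_decoupling`); M = O(K) gives the factor
K^{p-2}. Curvature plays no role: moving `x` by Ku in its first two coordinates turns each piece
into a planar wave in u with frequencies in a unit square. Almost orthogonality in L², together with
pointwise control of each wave by its average B_q, leads to (∑ B_q)^{p-2} ∑ B_q² ≤ M^{p-2} ∑ B_q^p
(`exists_plane_decoupling`).

The bilinear step needs the squares Δ to nest in the squares R, that is K ≤ N^{1/2}. For larger K
the trivial decoupling suffices: either K is bounded in terms of L, or a transverse pair exists and
`Dmulti` is at least 1/4 (`le_Dmulti`).

For sharpness, the form of (t, s, t², ts) is (t₁ - t₂)²/2, so squares of one column are never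
transverse. On a strip of width δ ~ 1/N the phase over B_N is essentially linear in s. The whole
strip has extension of size δ on a slab of thickness about 1, whereas a piece of height 1/K has size
about δ/K on a slab of thickness about K. The K pieces together carry K · K^{-p} · K = K^{2-p} of
the p-th power of the whole. -/

/-! ### The character e(u). -/

theorem e_eq_fourierChar (u : ℝ) : e u = (Real.fourierChar u : ℂ) := by
  rw [e, Real.fourierChar_apply]
  congr 1
  push_cast
  ring

theorem norm_e (u : ℝ) : ‖e u‖ = 1 := by
  rw [e_eq_fourierChar]
  exact Circle.norm_coe _

theorem e_add (u v : ℝ) : e (u + v) = e u * e v := by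
  simp only [e, ← Complex.exp_add]
  congr 1
  push_cast
  ring

theorem e_zero : e 0 = 1 := by simp [e]

theorem conj_e (u : ℝ) : (starRingEnd ℂ) (e u) = e (-u) := by
  simp only [e, ← Complex.exp_conj]
  congr 1
  simp [map_ofNat]

@[fun_prop]
theorem continuous_e : Continuous e := by
  unfold e
  fun_prop

/-! ### Kernels on the line with prescribed Fourier transform. -/

/-- A rapidly decreasing kernel whose Fourier transform equals one on `[-1, 1]`. -/
theorem exists_reproducing_kernel :
    ∃ κ : ℝ → ℂ, Continuous κ ∧ (∀ k : ℕ, ∃ C : ℝ, 0 < C ∧ ∀ x, ‖κ x‖ ≤ C / (1 + |x|) ^ k) ∧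
      ∀ ξ : ℝ, |ξ| ≤ 1 → ∫ v, κ v * e (v * ξ) = 1 := by
  -- The kernel is the Fourier transform of a bump equal to one on [-1, 1]; Fourier inversion then
  -- returns the value one there.
  let b : ContDiffBump (0 : ℝ) := ⟨1, 2, one_pos, one_lt_two⟩
  have hcs : HasCompactSupport (fun x => ((b x : ℝ) : ℂ)) :=
    b.hasCompactSupport.comp_left (g := fun r : ℝ => (r : ℂ)) (by simp)
  have hsm : ContDiff ℝ (⊤ : ℕ∞) (fun x => ((b x : ℝ) : ℂ)) :=
    Complex.ofRealCLM.contDiff.comp b.contDiff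
  let ψ : SchwartzMap ℝ ℂ := hcs.toSchwartzMap hsm
  refine ⟨fun x => (FourierTransform.fourier ψ : SchwartzMap ℝ ℂ) x,
    (FourierTransform.fourier ψ : SchwartzMap ℝ ℂ).continuous, fun k => ?_, fun ξ hξ => ?_⟩
  · refine ⟨2 ^ k * ((Finset.Iic (k, 0)).sup fun m => SchwartzMap.seminorm ℝ m.1 m.2)
      (FourierTransform.fourier ψ : SchwartzMap ℝ ℂ) + 1, by positivity, fun x => ?_⟩
    have h := SchwartzMap.one_add_le_sup_seminorm_apply (𝕜 := ℝ) (m := (k, 0)) (k := k) (n := 0)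
      le_rfl le_rfl (FourierTransform.fourier ψ : SchwartzMap ℝ ℂ) x
    rw [norm_iteratedFDeriv_zero, Real.norm_eq_abs] at h
    rw [le_div_iff₀ (by positivity), mul_comm]
    simp only at h
    linarith
  · have h : (FourierTransformInv.fourierInv (FourierTransform.fourier ψ : SchwartzMap ℝ ℂ) :
        SchwartzMap ℝ ℂ) ξ = ψ ξ := by simp
    rw [SchwartzMap.fourierInv_coe, Real.fourierInv_eq] at h
    have h1 : ψ ξ = 1 := by
      change ((b ξ : ℝ) : ℂ) = 1
      rw [b.one_of_mem_closedBall (by simpa using hξ)]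
      simp
    rw [← h1, ← h]
    refine integral_congr_ae (Filter.Eventually.of_forall fun v => ?_)
    simp only [Circle.smul_def, smul_eq_mul, e_eq_fourierChar]
    rw [mul_comm]
    simp [mul_comm]

/-- A nonnegative rapidly decreasing kernel whose Fourier transform is supported in `(-1, 1)`. -/
theorem exists_bandlimited_kernel :
    ∃ θ : ℝ → ℝ, Continuous θ ∧ (∀ x, 0 ≤ θ x) ∧ 0 < θ 0 ∧
      (∀ k : ℕ, ∃ C : ℝ, 0 < C ∧ ∀ x, θ x ≤ C / (1 + |x|) ^ k) ∧
      ∀ ξ : ℝ, 1 ≤ |ξ| → ∫ v, (θ v : ℂ) * e (v * ξ) = 0 := by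
  -- The kernel is |û|² for a bump u vanishing outside (-1/2, 1/2). Its Fourier transform is an
  -- autocorrelation of u, which vanishes at shifts of modulus at least one.
  let b : ContDiffBump (0 : ℝ) := ⟨1 / 4, 1 / 2, by norm_num, by norm_num⟩
  have hcs (ξ : ℝ) : HasCompactSupport (fun x => ((b (x + ξ) : ℝ) : ℂ)) :=
    (b.hasCompactSupport.comp_homeomorph (Homeomorph.addRight ξ)).comp_left
      (g := fun r : ℝ => (r : ℂ)) (by simp)
  have hsm (ξ : ℝ) : ContDiff ℝ (⊤ : ℕ∞) (fun x => ((b (x + ξ) : ℝ) : ℂ)) :=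
    Complex.ofRealCLM.contDiff.comp (b.contDiff.comp (contDiff_id.add contDiff_const))
  let ψ (ξ : ℝ) : SchwartzMap ℝ ℂ := (hcs ξ).toSchwartzMap (hsm ξ)
  have hψ (ξ x : ℝ) : ψ ξ x = ((b (x + ξ) : ℝ) : ℂ) := rfl
  let u (ξ : ℝ) : SchwartzMap ℝ ℂ := FourierTransform.fourier (ψ ξ)
  -- Translating the bump modulates its Fourier transform.
  have hu (ξ x : ℝ) : u ξ x = u 0 x * e (x * ξ) := by
    simp only [u, SchwartzMap.fourier_coe, Real.fourier_real_eq, Circle.smul_def, smul_eq_mul,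
      ← e_eq_fourierChar, hψ]
    rw [← integral_mul_const, ← integral_sub_right_eq_self _ ξ]
    refine integral_congr_ae (Filter.Eventually.of_forall fun v => ?_)
    simp only [sub_add_cancel, add_zero]
    rw [show -((v - ξ) * x) = -(v * x) + x * ξ by ring, e_add]
    ring
  refine ⟨fun x => ‖u 0 x‖ ^ 2, (u 0).continuous.norm.pow 2, fun x => by positivity, ?_,
    fun k => ?_, fun ξ hξ => ?_⟩
  · have h0 : u 0 0 = ((∫ x, b x : ℝ) : ℂ) := by
      simp only [u, SchwartzMap.fourier_coe, Real.fourier_real_eq, Circle.smul_def, smul_eq_mul,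
        ← e_eq_fourierChar, hψ]
      simp [e_zero, integral_complex_ofReal]
    have := b.integral_pos (μ := volume)
    simp only
    rw [h0, Complex.norm_real]
    exact pow_pos (norm_pos_iff.2 this.ne') 2
  · refine ⟨(2 ^ k * ((Finset.Iic (k, 0)).sup fun m => SchwartzMap.seminorm ℝ m.1 m.2)
      (u 0) + 1) ^ 2, by positivity, fun x => ?_⟩
    have h := SchwartzMap.one_add_le_sup_seminorm_apply (𝕜 := ℝ) (m := (k, 0)) (k := k) (n := 0)
      le_rfl le_rfl (u 0) x
    rw [norm_iteratedFDeriv_zero, Real.norm_eq_abs] at h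
    have h1 : 1 ≤ (1 + |x|) ^ k := one_le_pow₀ (by linarith [abs_nonneg x])
    rw [le_div_iff₀ (by positivity)]
    simp only at h
    calc ‖u 0 x‖ ^ 2 * (1 + |x|) ^ k ≤ ‖u 0 x‖ ^ 2 * ((1 + |x|) ^ k) ^ 2 := by
          gcongr
          nlinarith
      _ = ((1 + |x|) ^ k * ‖u 0 x‖) ^ 2 := by ring
      _ ≤ _ := by
          gcongr
          linarith
  -- Plancherel turns the integral of θ against a character into the inner product of the bump with
  -- its translate by ξ.
  · have h := SchwartzMap.integral_inner_fourier_fourier (ψ 0) (ψ ξ)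
    have h2 : ∫ x, inner ℂ (ψ 0 x) (ψ ξ x) = 0 := by
      rw [← integral_zero ℝ ℂ]
      congr 1
      ext x
      rw [hψ, hψ, add_zero]
      by_cases hx : 1 / 2 ≤ |x|
      · rw [b.zero_of_le_dist (x := x) (by simpa [b] using hx)]
        simp
      · rw [b.zero_of_le_dist (x := x + ξ) ?_]
        · simp
        · have := abs_sub_abs_le_abs_sub ξ (-x)
          rw [abs_neg] at this
          simp only [b, dist_zero_right, Real.norm_eq_abs]
          rw [show x + ξ = ξ - -x by ring]
          linarith
    rw [h2] at h
    rw [← h]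
    congr 1
    ext x
    change _ = inner ℂ (u 0 x) (u ξ x)
    rw [hu ξ x, RCLike.inner_apply, mul_right_comm, Complex.mul_conj, Complex.normSq_eq_norm_sq]

/-! ### A submultiplicative polynomial weight on the plane. -/

/-- The weight `(1 + |u₁|)(1 + |u₂|)` on the plane. -/
def planeWeight (u : ℝ × ℝ) : ℝ := (1 + |u.1|) * (1 + |u.2|)

theorem one_le_planeWeight (u : ℝ × ℝ) : 1 ≤ planeWeight u := by
  unfold planeWeight
  nlinarith [abs_nonneg u.1, abs_nonneg u.2, mul_nonneg (abs_nonneg u.1) (abs_nonneg u.2)]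

theorem planeWeight_pos (u : ℝ × ℝ) : 0 < planeWeight u :=
  zero_lt_one.trans_le (one_le_planeWeight u)

theorem one_add_abs_add_le (x y : ℝ) : 1 + |x + y| ≤ (1 + |x|) * (1 + |y|) := by
  nlinarith [abs_add_le x y, mul_nonneg (abs_nonneg x) (abs_nonneg y)]

theorem planeWeight_add_le (u v : ℝ × ℝ) :
    planeWeight (u + v) ≤ planeWeight u * planeWeight v := by
  unfold planeWeight
  calc (1 + |u.1 + v.1|) * (1 + |u.2 + v.2|)
      ≤ ((1 + |u.1|) * (1 + |v.1|)) * ((1 + |u.2|) * (1 + |v.2|)) := by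
        gcongr <;> exact one_add_abs_add_le _ _
    _ = _ := by ring

theorem planeWeight_neg (u : ℝ × ℝ) : planeWeight (-u) = planeWeight u := by
  simp [planeWeight]

@[fun_prop]
theorem continuous_planeWeight : Continuous planeWeight := by
  unfold planeWeight
  fun_prop

theorem integrable_inv_one_add_abs_pow {k : ℕ} (hk : 2 ≤ k) :
    Integrable fun x : ℝ => 1 / (1 + |x|) ^ k := by
  have h := integrable_one_add_norm (E := ℝ) (μ := volume) (r := k)
    (by simp only [Module.finrank_self, Nat.cast_one]; exact_mod_cast hk)
  refine h.congr (Filter.Eventually.of_forall fun x => ?_)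
  simp only [Real.norm_eq_abs]
  rw [Real.rpow_neg (by positivity), Real.rpow_natCast, one_div]

theorem integrable_inv_planeWeight_pow {k : ℕ} (hk : 2 ≤ k) :
    Integrable fun u : ℝ × ℝ => 1 / planeWeight u ^ k := by
  have h := (integrable_inv_one_add_abs_pow hk).mul_prod (integrable_inv_one_add_abs_pow hk)
  refine h.congr (Filter.Eventually.of_forall fun u => ?_)
  simp only [planeWeight]
  rw [mul_pow]
  field_simp

/-- A continuous function dominated by `(1 + |x|)^{-2}` is integrable. -/
theorem integrable_of_le_div_one_add_abs_sq {E : Type*} [NormedAddCommGroup E]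
    {f : ℝ → E} (hf : Continuous f) {C : ℝ} (h : ∀ x, ‖f x‖ ≤ C / (1 + |x|) ^ 2) :
    Integrable f := by
  refine ((integrable_inv_one_add_abs_pow le_rfl).const_mul C).mono'
    hf.aestronglyMeasurable (Filter.Eventually.of_forall fun x => ?_)
  rw [mul_one_div]
  exact h x

/-! ### Planar waves: reproduction and orthogonality. -/

/-- The Fourier transform of a function on `D`, at frequency `K u`. -/
def planeWave (K : ℝ) (D : Set (ℝ × ℝ)) (G : ℝ × ℝ → ℂ) (u : ℝ × ℝ) : ℂ :=
  ∫ z in D, G z * e (u.1 * (K * z.1) + u.2 * (K * z.2))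

section planeWave

variable {K : ℝ} {D : Set (ℝ × ℝ)} {G : ℝ × ℝ → ℂ}

theorem norm_planeWave_le (u : ℝ × ℝ) : ‖planeWave K D G u‖ ≤ ∫ z in D, ‖G z‖ := by
  refine (norm_integral_le_integral_norm _).trans_eq ?_
  simp [norm_e]

theorem Integrable.mul_of_norm_one {α : Type*} [MeasurableSpace α] {μ : Measure α} {f g : α → ℂ}
    (hf : Integrable f μ) (hg : AEStronglyMeasurable g μ) (h : ∀ x, ‖g x‖ = 1) :
    Integrable (fun x => f x * g x) μ := by
  refine hf.mul_bdd hg (c := 1) (Filter.Eventually.of_forall fun x => (h x).le)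

theorem continuous_planeWave (hG : IntegrableOn G D) : Continuous (planeWave K D G) := by
  refine continuous_of_dominated (bound := fun z => ‖G z‖) (fun u => ?_) (fun u => ?_) hG.norm ?_
  · exact hG.aestronglyMeasurable.mul (by fun_prop : Continuous _).aestronglyMeasurable
  · exact Filter.Eventually.of_forall fun z => by simp [norm_e]
  · exact Filter.Eventually.of_forall fun z => by fun_prop

/-- Frequency localised waves reproduce under convolution with a fixed kernel. -/
theorem planeWave_eq_convolution {κ : ℝ → ℂ} (hκ : Continuous κ) (hi : Integrable κ)
    (hκ1 : ∀ ξ : ℝ, |ξ| ≤ 1 → ∫ v, κ v * e (v * ξ) = 1)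
    (hD : MeasurableSet D) (hG : IntegrableOn G D) {a b : ℝ}
    (ha : ∀ z ∈ D, |a - K * z.1| ≤ 1) (hb : ∀ z ∈ D, |b - K * z.2| ≤ 1) (u : ℝ × ℝ) :
    planeWave K D G u = ∫ v : ℝ × ℝ, (κ (u - v).1 * e ((u - v).1 * a)) *
      (κ (u - v).2 * e ((u - v).2 * b)) * planeWave K D G v := by
  -- The reproducing kernel is modulated to the frequency (a, b), so that its Fourier transform
  -- equals one at every frequency Kz with z in D.
  set k : ℝ × ℝ → ℂ := fun w => (κ w.1 * e (w.1 * a)) * (κ w.2 * e (w.2 * b)) with hk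
  have hkc : Continuous k := by fun_prop
  have hmod (c : ℝ) : Integrable (fun x => κ x * e (x * c)) :=
    Integrable.mul_of_norm_one hi
      (by fun_prop : Continuous fun x : ℝ => e (x * c)).aestronglyMeasurable (fun _ => norm_e _)
  have hki : Integrable k := (hmod a).mul_prod (hmod b)
  have hinner (z : ℝ × ℝ) (hz : z ∈ D) :
      ∫ v : ℝ × ℝ, k (u - v) * e (v.1 * (K * z.1) + v.2 * (K * z.2)) =
        e (u.1 * (K * z.1) + u.2 * (K * z.2)) := by
    rw [← integral_sub_left_eq_self _ volume u]
    have h1 : ∀ v : ℝ × ℝ, k (u - (u - v)) *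
        e ((u - v).1 * (K * z.1) + (u - v).2 * (K * z.2)) =
        e (u.1 * (K * z.1) + u.2 * (K * z.2)) *
          ((κ v.1 * e (v.1 * (a - K * z.1))) * (κ v.2 * e (v.2 * (b - K * z.2)))) := by
      intro v
      rw [sub_sub_cancel, hk]
      simp only [Prod.fst_sub, Prod.snd_sub]
      have h1 : e ((u.1 - v.1) * (K * z.1) + (u.2 - v.2) * (K * z.2)) =
          e (u.1 * (K * z.1) + u.2 * (K * z.2)) * (e (-(v.1 * (K * z.1))) *
            e (-(v.2 * (K * z.2)))) := by
        rw [← e_add, ← e_add]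
        congr 1
        ring
      have h2 (x y w : ℝ) : e (x * (y - w)) = e (x * y) * e (-(x * w)) := by
        rw [← e_add]
        congr 1
        ring
      rw [h1, h2, h2]
      ring
    simp_rw [h1]
    rw [integral_const_mul]
    have h2 := integral_prod_mul (μ := (volume : Measure ℝ)) (ν := (volume : Measure ℝ))
      (fun x => κ x * e (x * (a - K * z.1))) (fun y => κ y * e (y * (b - K * z.2)))
    rw [hκ1 _ (ha z hz), hκ1 _ (hb z hz)] at h2
    rw [Measure.volume_eq_prod, h2]
    ring
  have hswap : ∫ v : ℝ × ℝ, (∫ z in D, k (u - v) * (G z *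
        e (v.1 * (K * z.1) + v.2 * (K * z.2)))) =
      ∫ z in D, ∫ v : ℝ × ℝ, k (u - v) * (G z * e (v.1 * (K * z.1) + v.2 * (K * z.2))) := by
    refine integral_integral_swap ?_
    have h1 : Integrable (fun w : (ℝ × ℝ) × (ℝ × ℝ) => k (u - w.1) * G w.2)
        (volume.prod (volume.restrict D)) := (hki.comp_sub_left u).mul_prod hG
    have h2 := Integrable.mul_of_norm_one h1
      (g := fun w => e (w.1.1 * (K * w.2.1) + w.1.2 * (K * w.2.2)))
      (by fun_prop : Continuous _).aestronglyMeasurable (fun _ => norm_e _)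
    refine h2.congr (Filter.Eventually.of_forall fun w => ?_)
    simp only [Function.uncurry]
    ring
  change _ = ∫ v : ℝ × ℝ, k (u - v) * planeWave K D G v
  simp only [planeWave]
  simp_rw [← integral_const_mul]
  rw [hswap]
  refine setIntegral_congr_fun hD fun z hz => ?_
  rw [← hinner z hz, ← integral_const_mul]
  refine integral_congr_ae (Filter.Eventually.of_forall fun v => ?_)
  simp only
  ring

/-- Waves with well separated frequencies are orthogonal with respect to a band-limited weight. -/
theorem integral_planeWave_mul_conj_eq_zero {θ : ℝ → ℝ} (hi : Integrable θ)
    (hθ1 : ∀ ξ : ℝ, 1 ≤ |ξ| → ∫ v, (θ v : ℂ) * e (v * ξ) = 0)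
    {D' : Set (ℝ × ℝ)} (hD : MeasurableSet D) (hD' : MeasurableSet D')
    (hG : IntegrableOn G D) (hG' : IntegrableOn G D')
    (hsep : ∀ z ∈ D, ∀ w ∈ D', 1 ≤ |K * z.1 - K * w.1| ∨ 1 ≤ |K * z.2 - K * w.2|) :
    ∫ u : ℝ × ℝ, planeWave K D G u * (starRingEnd ℂ) (planeWave K D' G u) *
      ((θ u.1 * θ u.2 : ℝ) : ℂ) = 0 := by
  set H : (ℝ × ℝ) × (ℝ × ℝ) → ℂ := fun y => G y.1 * (starRingEnd ℂ) (G y.2) with hH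
  set μ := (volume.restrict D).prod (volume.restrict D') with hμ
  have hHi : Integrable H μ := by
    refine Integrable.mul_prod (f := G) (g := fun z => (starRingEnd ℂ) (G z)) hG ?_
    exact (integrable_norm_iff
      (Complex.continuous_conj.comp_aestronglyMeasurable hG'.aestronglyMeasurable)).1
      (by simpa using hG'.norm)
  have hprod (u : ℝ × ℝ) : planeWave K D G u * (starRingEnd ℂ) (planeWave K D' G u) *
      ((θ u.1 * θ u.2 : ℝ) : ℂ) = ∫ y, ((θ u.1 * θ u.2 : ℝ) : ℂ) * (H y *
        e (u.1 * (K * y.1.1 - K * y.2.1) + u.2 * (K * y.1.2 - K * y.2.2))) ∂μ := by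
    rw [integral_const_mul, mul_comm]
    congr 1
    rw [planeWave, planeWave, ← integral_conj, ← integral_prod_mul]
    refine integral_congr_ae (Filter.Eventually.of_forall fun y => ?_)
    simp only [map_mul, conj_e, hH]
    have he : e (u.1 * (K * y.1.1 - K * y.2.1) + u.2 * (K * y.1.2 - K * y.2.2)) =
        e (u.1 * (K * y.1.1) + u.2 * (K * y.1.2)) *
          e (-(u.1 * (K * y.2.1) + u.2 * (K * y.2.2))) := by
      rw [← e_add]
      congr 1
      ring
    rw [he]
    ring
  simp_rw [hprod]
  have hθi : Integrable (fun u : ℝ × ℝ => ((θ u.1 * θ u.2 : ℝ) : ℂ)) :=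
    (hi.mul_prod hi).ofReal
  rw [integral_integral_swap]
  · have : ∀ᵐ y ∂μ, ∫ u : ℝ × ℝ, ((θ u.1 * θ u.2 : ℝ) : ℂ) * (H y *
        e (u.1 * (K * y.1.1 - K * y.2.1) + u.2 * (K * y.1.2 - K * y.2.2))) = 0 := by
      rw [hμ, Measure.prod_restrict]
      filter_upwards [ae_restrict_mem (hD.prod hD')] with y hy
      have h2 := integral_prod_mul (μ := (volume : Measure ℝ)) (ν := (volume : Measure ℝ))
        (fun x => (θ x : ℂ) * e (x * (K * y.1.1 - K * y.2.1)))
        (fun x => (θ x : ℂ) * e (x * (K * y.1.2 - K * y.2.2)))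
      have h3 : (∫ x, (θ x : ℂ) * e (x * (K * y.1.1 - K * y.2.1))) *
          (∫ x, (θ x : ℂ) * e (x * (K * y.1.2 - K * y.2.2))) = 0 := by
        -- The weight is a product, so separation in one coordinate already makes the double
        -- integral vanish.
        rcases hsep _ hy.1 _ hy.2 with h | h
        · rw [hθ1 _ h, zero_mul]
        · rw [hθ1 _ h, mul_zero]
      rw [h3] at h2
      have h4 := congrArg (fun c => H y * c) h2
      simp only [mul_zero] at h4
      rw [← integral_const_mul] at h4
      rw [← h4, Measure.volume_eq_prod]
      refine integral_congr_ae (Filter.Eventually.of_forall fun u => ?_)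
      simp only [e_add]
      push_cast
      ring
    rw [integral_congr_ae this]
    simp
  · have h1 : Integrable (fun w : (ℝ × ℝ) × ((ℝ × ℝ) × (ℝ × ℝ)) =>
        ((θ w.1.1 * θ w.1.2 : ℝ) : ℂ) * H w.2) (volume.prod μ) := hθi.mul_prod hHi
    have h2 := Integrable.mul_of_norm_one h1
      (g := fun w => e (w.1.1 * (K * w.2.1.1 - K * w.2.2.1) + w.1.2 * (K * w.2.1.2 - K * w.2.2.2)))
      (by fun_prop : Continuous _).aestronglyMeasurable (fun _ => norm_e _)
    refine h2.congr (Filter.Eventually.of_forall fun w => ?_)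
    simp only [Function.uncurry]
    ring

end planeWave

/-! ### Power mean and Jensen inequalities. -/

/-- A consequence of the power mean inequality. -/
theorem rpow_sum_mul_sum_sq_le {ι : Type*} (S : Finset ι) {B : ι → ℝ} (hB : ∀ i, 0 ≤ B i)
    {p : ℝ} (hp : 2 ≤ p) :
    (∑ i ∈ S, B i) ^ (p - 2) * ∑ i ∈ S, B i ^ 2 ≤ (S.card : ℝ) ^ (p - 2) * ∑ i ∈ S, B i ^ p := by
  rcases S.eq_empty_or_nonempty with rfl | hS
  · simp
  have hM : (0 : ℝ) < S.card := by exact_mod_cast hS.card_pos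
  have hp0 : 0 < p := by linarith
  set P := ∑ i ∈ S, B i ^ p with hP
  have hP0 : 0 ≤ P := Finset.sum_nonneg fun i _ => Real.rpow_nonneg (hB i) _
  have hX0 : 0 ≤ ∑ i ∈ S, B i := Finset.sum_nonneg fun i _ => hB i
  have hY0 : 0 ≤ ∑ i ∈ S, B i ^ 2 := Finset.sum_nonneg fun i _ => by positivity
  have hX : (∑ i ∈ S, B i) ^ p ≤ (S.card : ℝ) ^ (p - 1) * P :=
    Real.rpow_sum_le_const_mul_sum_rpow_of_nonneg S (by linarith) fun i _ => hB i
  -- Both sums are compared with the sum of p-th powers. Raised to the powers (p-2)/p and 2/p, the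
  -- two bounds multiply so that this sum appears to the power one and the cardinality to the power
  -- (p-1)(p-2)/p + (p-2)/p = p-2.
  have hY : (∑ i ∈ S, B i ^ 2) ^ (p / 2) ≤ (S.card : ℝ) ^ (p / 2 - 1) * P := by
    refine (Real.rpow_sum_le_const_mul_sum_rpow_of_nonneg S (by linarith)
      fun i _ => by positivity).trans_eq ?_
    congr 1
    refine Finset.sum_congr rfl fun i _ => ?_
    rw [← Real.rpow_natCast, ← Real.rpow_mul (hB i)]
    congr 1
    push_cast
    ring
  have hX' : (∑ i ∈ S, B i) ^ (p - 2) ≤ ((S.card : ℝ) ^ (p - 1) * P) ^ ((p - 2) / p) := by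
    calc _ = ((∑ i ∈ S, B i) ^ p) ^ ((p - 2) / p) := by
          rw [← Real.rpow_mul hX0]
          congr 1
          field_simp
      _ ≤ _ := Real.rpow_le_rpow (Real.rpow_nonneg hX0 _) hX
          (div_nonneg (by linarith) hp0.le)
  have hY' : (∑ i ∈ S, B i ^ 2) ≤ ((S.card : ℝ) ^ (p / 2 - 1) * P) ^ (2 / p) := by
    calc _ = ((∑ i ∈ S, B i ^ 2) ^ (p / 2)) ^ (2 / p) := by
          rw [← Real.rpow_mul hY0]
          rw [show p / 2 * (2 / p) = 1 by field_simp, Real.rpow_one]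
      _ ≤ _ := Real.rpow_le_rpow (Real.rpow_nonneg hY0 _) hY (by positivity)
  calc _ ≤ ((S.card : ℝ) ^ (p - 1) * P) ^ ((p - 2) / p) *
        ((S.card : ℝ) ^ (p / 2 - 1) * P) ^ (2 / p) :=
        mul_le_mul hX' hY' hY0 (Real.rpow_nonneg (by positivity) _)
    _ = ((S.card : ℝ) ^ ((p - 1) * ((p - 2) / p)) * (S.card : ℝ) ^ ((p / 2 - 1) * (2 / p))) *
        (P ^ ((p - 2) / p) * P ^ (2 / p)) := by
        rw [Real.mul_rpow (by positivity) hP0, Real.mul_rpow (by positivity) hP0,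
          ← Real.rpow_mul hM.le, ← Real.rpow_mul hM.le]
        ring
    _ = _ := by
        rw [← Real.rpow_add hM, ← Real.rpow_add_of_nonneg hP0
          (div_nonneg (by linarith) hp0.le) (by positivity)]
        rw [show (p - 2) / p + 2 / p = 1 by field_simp; ring, Real.rpow_one]
        congr 2
        field_simp
        ring

/-- Jensen's inequality for a weighted integral. -/
theorem rpow_lintegral_mul_le {α : Type*} [MeasurableSpace α] (μ : Measure α) {f w : α → ℝ≥0∞}
    (hf : Measurable f) (hw : Measurable w) {p : ℝ} (hp : 1 < p) :
    (∫⁻ x, f x * w x ∂μ) ^ p ≤ (∫⁻ x, w x ∂μ) ^ (p - 1) * ∫⁻ x, f x ^ p * w x ∂μ := by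
  have hp0 : 0 < p := by linarith
  have h := ENNReal.lintegral_mul_le_Lp_mul_Lq (μ.withDensity w)
    (Real.HolderConjugate.conjExponent hp) hf.aemeasurable (aemeasurable_const (b := (1 : ℝ≥0∞)))
  have h1 (F : α → ℝ≥0∞) (hF : Measurable F) : ∫⁻ x, F x ∂(μ.withDensity w) =
      ∫⁻ x, F x * w x ∂μ := by
    rw [lintegral_withDensity_eq_lintegral_mul _ hw hF]
    simp [mul_comm]
  have h2 : (∫⁻ x, f x * w x ∂μ) ≤ (∫⁻ x, f x ^ p * w x ∂μ) ^ (1 / p) *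
      (∫⁻ x, w x ∂μ) ^ (1 / p.conjExponent) := by
    rw [← h1 f hf, ← h1 (fun x => f x ^ p) (hf.pow_const p)]
    simpa using h
  calc (∫⁻ x, f x * w x ∂μ) ^ p ≤ ((∫⁻ x, f x ^ p * w x ∂μ) ^ (1 / p) *
      (∫⁻ x, w x ∂μ) ^ (1 / p.conjExponent)) ^ p := ENNReal.rpow_le_rpow h2 hp0.le
    _ = _ := by
      rw [ENNReal.mul_rpow_of_nonneg _ _ hp0.le, ← ENNReal.rpow_mul, ← ENNReal.rpow_mul, mul_comm]
      rw [one_div_mul_cancel hp0.ne', ENNReal.rpow_one]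
      congr 2
      rw [Real.conjExponent]
      have : p - 1 ≠ 0 := by linarith
      field_simp

/-! ### Dyadic squares and adjacency. -/

theorem measurableSet_square (a b l : ℝ) : MeasurableSet (square a b l) :=
  measurableSet_Icc.prod measurableSet_Icc

theorem measurableSet_dyadicSquare (m : ℕ) (q : Fin (2 ^ m) × Fin (2 ^ m)) :
    MeasurableSet (dyadicSquare m q) := measurableSet_square _ _ _

theorem mem_dyadicSquare_iff {m : ℕ} {q : Fin (2 ^ m) × Fin (2 ^ m)} {z : ℝ × ℝ} :
    z ∈ dyadicSquare m q ↔ ((q.1 : ℕ) : ℝ) ≤ 2 ^ m * z.1 ∧ 2 ^ m * z.1 ≤ (q.1 : ℕ) + 1 ∧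
      ((q.2 : ℕ) : ℝ) ≤ 2 ^ m * z.2 ∧ 2 ^ m * z.2 ≤ (q.2 : ℕ) + 1 := by
  have h : (0 : ℝ) < 2 ^ m := by positivity
  simp only [dyadicSquare, square, Set.mem_prod, Set.mem_Icc]
  rw [← add_div, ← add_div, div_le_iff₀ h, div_le_iff₀ h, le_div_iff₀ h, le_div_iff₀ h]
  simp only [mul_comm _ ((2 : ℝ) ^ m), and_assoc]

theorem dyadicSquare_subset_unitSquare (m : ℕ) (q : Fin (2 ^ m) × Fin (2 ^ m)) :
    dyadicSquare m q ⊆ unitSquare := by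
  intro z hz
  rw [mem_dyadicSquare_iff] at hz
  obtain ⟨h1, h2, h3, h4⟩ := hz
  have h : (0 : ℝ) < 2 ^ m := by positivity
  have hb (i : Fin (2 ^ m)) : ((i : ℕ) : ℝ) + 1 ≤ 2 ^ m := by
    exact_mod_cast i.2
  have hn (i : Fin (2 ^ m)) : (0 : ℝ) ≤ ((i : ℕ) : ℝ) := by positivity
  simp only [unitSquare, square, Set.mem_prod, Set.mem_Icc]
  refine ⟨⟨?_, ?_⟩, ⟨?_, ?_⟩⟩
  · exact nonneg_of_mul_nonneg_right ((hn q.1).trans h1) h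
  · nlinarith [hb q.1]
  · exact nonneg_of_mul_nonneg_right ((hn q.2).trans h3) h
  · nlinarith [hb q.2]

/-- Two dyadic squares of the same size are adjacent if they touch (or coincide). -/
def Adjacent {m : ℕ} (q r : Fin (2 ^ m) × Fin (2 ^ m)) : Prop :=
  |((r.1 : ℕ) : ℤ) - (q.1 : ℕ)| ≤ 1 ∧ |((r.2 : ℕ) : ℤ) - (q.2 : ℕ)| ≤ 1

theorem Adjacent.symm {m : ℕ} {q r : Fin (2 ^ m) × Fin (2 ^ m)} (h : Adjacent q r) :
    Adjacent r q := by
  unfold Adjacent at h ⊢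
  rwa [abs_sub_comm, abs_sub_comm ((q.2 : ℕ) : ℤ)]

open Classical in
theorem card_adjacent_le {m : ℕ} (S : Finset (Fin (2 ^ m) × Fin (2 ^ m)))
    (q : Fin (2 ^ m) × Fin (2 ^ m)) : (S.filter fun r => Adjacent q r).card ≤ 9 := by
  have h : (S.filter fun r => Adjacent q r).card ≤
      (Finset.Icc (-1 : ℤ) 1 ×ˢ Finset.Icc (-1 : ℤ) 1).card := by
    refine Finset.card_le_card_of_injOn
      (fun r => (((r.1 : ℕ) : ℤ) - (q.1 : ℕ), ((r.2 : ℕ) : ℤ) - (q.2 : ℕ))) ?_ ?_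
    · intro r hr
      have := (Finset.mem_filter.1 hr).2
      simp only [Adjacent, abs_le] at this
      simp only [Finset.coe_product, Finset.coe_Icc, Set.mem_prod, Set.mem_Icc]
      exact this
    · intro r _ r' _ h
      simp only [Prod.mk.injEq, sub_left_inj, Nat.cast_inj, Fin.val_inj] at h
      exact Prod.ext h.1 h.2
  exact h.trans (by simp)

/-- Indices that differ by at least two leave a full square between the intervals, hence a unit gap
after rescaling by 2^m. This is the separation at which the band-limited weight makes waves
orthogonal. -/
theorem separated_of_not_adjacent {m : ℕ} {q r : Fin (2 ^ m) × Fin (2 ^ m)}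
    (h : ¬ Adjacent q r) : ∀ z ∈ dyadicSquare m q, ∀ w ∈ dyadicSquare m r,
      1 ≤ |(2 : ℝ) ^ m * z.1 - 2 ^ m * w.1| ∨ 1 ≤ |(2 : ℝ) ^ m * z.2 - 2 ^ m * w.2| := by
  intro z hz w hw
  rw [mem_dyadicSquare_iff] at hz hw
  obtain ⟨h1, h2, h3, h4⟩ := hz
  obtain ⟨k1, k2, k3, k4⟩ := hw
  have key (i j : ℕ) (x y : ℝ) (hij : ¬ |(j : ℤ) - i| ≤ 1) (hx : (i : ℝ) ≤ x)
      (hx' : x ≤ i + 1) (hy : (j : ℝ) ≤ y) (hy' : y ≤ j + 1) : 1 ≤ |x - y| := by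
    rw [not_le, lt_abs] at hij
    rw [le_abs]
    rcases hij with hij | hij
    · right
      have : ((i : ℤ) : ℝ) + 2 ≤ ((j : ℤ) : ℝ) := by exact_mod_cast (by omega)
      push_cast at this
      linarith
    · left
      have : ((j : ℤ) : ℝ) + 2 ≤ ((i : ℤ) : ℝ) := by exact_mod_cast (by omega)
      push_cast at this
      linarith
  rw [Adjacent, not_and_or] at h
  rcases h with h | h
  · exact Or.inl (key _ _ _ _ h h1 h2 k1 k2)
  · exact Or.inr (key _ _ _ _ h h3 h4 k3 k4)

/-! ### Uncertainty principle, almost orthogonality and decoupling in the plane. -/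

section waves

variable {m : ℕ} {G : ℝ × ℝ → ℂ}

/-- A wave attached to a dyadic square. -/
def dyadicWave (m : ℕ) (G : ℝ × ℝ → ℂ) (q : Fin (2 ^ m) × Fin (2 ^ m)) : ℝ × ℝ → ℂ :=
  planeWave (2 ^ m) (dyadicSquare m q) G

theorem continuous_dyadicWave (hG : IntegrableOn G unitSquare)
    (q : Fin (2 ^ m) × Fin (2 ^ m)) : Continuous (dyadicWave m G q) :=
  continuous_planeWave (hG.mono_set (dyadicSquare_subset_unitSquare m q))

theorem Integrable.mul_dyadicWave_rpow (hG : IntegrableOn G unitSquare)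
    (q : Fin (2 ^ m) × Fin (2 ^ m)) {w : ℝ × ℝ → ℝ} (hw : Integrable w) {s : ℝ} (hs : 0 ≤ s) :
    Integrable fun u => ‖dyadicWave m G q u‖ ^ s * w u := by
  refine hw.bdd_mul (c := (∫ z in dyadicSquare m q, ‖G z‖) ^ s) ?_
    (Filter.Eventually.of_forall fun u => ?_)
  · exact ((continuous_dyadicWave hG q).norm.rpow_const fun _ => Or.inr hs).aestronglyMeasurable
  · rw [Real.norm_of_nonneg (Real.rpow_nonneg (norm_nonneg _) _)]
    exact Real.rpow_le_rpow (norm_nonneg _) (norm_planeWave_le u) hs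

theorem Integrable.mul_dyadicWave_pow (hG : IntegrableOn G unitSquare)
    (q : Fin (2 ^ m) × Fin (2 ^ m)) {w : ℝ × ℝ → ℝ} (hw : Integrable w) (k : ℕ) :
    Integrable fun u => ‖dyadicWave m G q u‖ ^ k * w u := by
  simpa using Integrable.mul_dyadicWave_rpow hG q hw (s := k) (by positivity)

/-- The uncertainty principle: a frequency localised wave is controlled pointwise by its
averages. -/
theorem exists_norm_dyadicWave_le (b : ℕ) (hb : 2 ≤ b) : ∃ C : ℝ, 0 ≤ C ∧
    ∀ (m : ℕ) (G : ℝ × ℝ → ℂ), IntegrableOn G unitSquare →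
    ∀ (q : Fin (2 ^ m) × Fin (2 ^ m)) (u : ℝ × ℝ),
    ‖dyadicWave m G q u‖ ≤
      C * planeWeight u ^ b * ∫ v, ‖dyadicWave m G q v‖ * (1 / planeWeight v ^ b) := by
  obtain ⟨κ, hκ, hdec, hκ1⟩ := exists_reproducing_kernel
  obtain ⟨C2, hC2, hdec2⟩ := hdec 2
  obtain ⟨C, hC, hdecb⟩ := hdec b
  have hi : Integrable κ := integrable_of_le_div_one_add_abs_sq hκ hdec2
  refine ⟨C * C, by positivity, fun m G hG q u => ?_⟩
  have hrep := planeWave_eq_convolution (K := 2 ^ m) (D := dyadicSquare m q) (G := G) hκ hi hκ1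
    (measurableSet_dyadicSquare m q) (hG.mono_set (dyadicSquare_subset_unitSquare m q))
    (a := (q.1 : ℕ)) (b := (q.2 : ℕ))
    (fun z hz => by
      rw [mem_dyadicSquare_iff] at hz
      rw [abs_le]
      constructor <;> linarith [hz.1, hz.2.1])
    (fun z hz => by
      rw [mem_dyadicSquare_iff] at hz
      rw [abs_le]
      constructor <;> linarith [hz.2.2.1, hz.2.2.2]) u
  rw [show dyadicWave m G q u = _ from hrep]
  refine (norm_integral_le_integral_norm _).trans ?_
  rw [← integral_const_mul]
  have hint : Integrable fun v => ‖dyadicWave m G q v‖ * (1 / planeWeight v ^ b) := by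
    simpa using Integrable.mul_dyadicWave_pow hG q (integrable_inv_planeWeight_pow hb) 1
  refine integral_mono_of_nonneg (Filter.Eventually.of_forall fun v => norm_nonneg _)
    (hint.const_mul _) (Filter.Eventually.of_forall fun v => ?_)
  simp only [norm_mul, norm_e, mul_one]
  change ‖κ (u - v).1‖ * ‖κ (u - v).2‖ * ‖dyadicWave m G q v‖ ≤ _
  -- Submultiplicativity trades the decay of the kernel in u - v for decay in v, at the price of
  -- growth in u.
  have hJ : planeWeight v ^ b ≤ planeWeight (u - v) ^ b * planeWeight u ^ b := by
    rw [← mul_pow]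
    refine pow_le_pow_left₀ (planeWeight_pos v).le ?_ b
    calc planeWeight v = planeWeight (-(u - v) + u) := by congr 1; abel
      _ ≤ planeWeight (-(u - v)) * planeWeight u := planeWeight_add_le _ _
      _ = _ := by rw [planeWeight_neg]
  have h1 : ‖κ (u - v).1‖ * ‖κ (u - v).2‖ ≤ C * C / planeWeight (u - v) ^ b := by
    calc _ ≤ (C / (1 + |(u - v).1|) ^ b) * (C / (1 + |(u - v).2|) ^ b) := by
          gcongr <;> exact hdecb _
      _ = _ := by
          rw [planeWeight, mul_pow]
          field_simp
  have hp1 := pow_pos (planeWeight_pos (u - v)) b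
  have hp2 := pow_pos (planeWeight_pos v) b
  have h2 : C * C / planeWeight (u - v) ^ b ≤
      C * C * planeWeight u ^ b * (1 / planeWeight v ^ b) := by
    rw [mul_one_div, div_le_div_iff₀ hp1 hp2]
    calc C * C * planeWeight v ^ b ≤ C * C * (planeWeight (u - v) ^ b * planeWeight u ^ b) := by
          gcongr
      _ = _ := by ring
  calc _ ≤ (C * C * planeWeight u ^ b * (1 / planeWeight v ^ b)) * ‖dyadicWave m G q v‖ :=
        mul_le_mul_of_nonneg_right (h1.trans h2) (norm_nonneg _)
    _ = _ := by ring

/-- Almost orthogonality of waves attached to distinct dyadic squares. -/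
theorem integral_norm_sum_dyadicWave_sq_le {θ : ℝ → ℝ} (hθ0 : ∀ x, 0 ≤ θ x) (hi : Integrable θ)
    (hθ1 : ∀ ξ : ℝ, 1 ≤ |ξ| → ∫ v, (θ v : ℂ) * e (v * ξ) = 0)
    (hG : IntegrableOn G unitSquare) (S : Finset (Fin (2 ^ m) × Fin (2 ^ m))) :
    ∫ u : ℝ × ℝ, ‖∑ q ∈ S, dyadicWave m G q u‖ ^ 2 * (θ u.1 * θ u.2) ≤
      9 * ∑ q ∈ S, ∫ u : ℝ × ℝ, ‖dyadicWave m G q u‖ ^ 2 * (θ u.1 * θ u.2) := by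
  classical
  set w : ℝ × ℝ → ℝ := fun u => θ u.1 * θ u.2 with hw
  have hw0 (u) : 0 ≤ w u := mul_nonneg (hθ0 _) (hθ0 _)
  have hwi : Integrable w := hi.mul_prod hi
  set I := fun q r => ∫ u : ℝ × ℝ, dyadicWave m G q u * (starRingEnd ℂ) (dyadicWave m G r u) *
    (w u : ℂ) with hI
  set N := fun q => ∫ u : ℝ × ℝ, ‖dyadicWave m G q u‖ ^ 2 * w u with hN
  have hint (q r) : Integrable fun u : ℝ × ℝ =>
      dyadicWave m G q u * (starRingEnd ℂ) (dyadicWave m G r u) * (w u : ℂ) := by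
    refine hwi.ofReal.bdd_mul (c := (∫ z in dyadicSquare m q, ‖G z‖) *
      (∫ z in dyadicSquare m r, ‖G z‖)) ?_ (Filter.Eventually.of_forall fun u => ?_)
    · exact ((continuous_dyadicWave hG q).mul (Complex.continuous_conj.comp
        (continuous_dyadicWave hG r))).aestronglyMeasurable
    · rw [norm_mul, RCLike.norm_conj]
      exact mul_le_mul (norm_planeWave_le u) (norm_planeWave_le u) (norm_nonneg _)
        (integral_nonneg fun _ => norm_nonneg _)
  have hzero (q r) (h : ¬ Adjacent q r) : I q r = 0 :=
    integral_planeWave_mul_conj_eq_zero hi hθ1 (measurableSet_dyadicSquare m q)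
      (measurableSet_dyadicSquare m r) (hG.mono_set (dyadicSquare_subset_unitSquare m q))
      (hG.mono_set (dyadicSquare_subset_unitSquare m r)) (separated_of_not_adjacent h)
  -- |φ_q φ_r| ≤ (|φ_q|² + |φ_r|²)/2 bounds the interaction of an adjacent pair by diagonal terms.
  have hle (q r) : ‖I q r‖ ≤ (N q + N r) / 2 := by
    refine (norm_integral_le_integral_norm _).trans ?_
    rw [hN, ← integral_add (Integrable.mul_dyadicWave_pow hG q hwi 2)
      (Integrable.mul_dyadicWave_pow hG r hwi 2), ← integral_div]
    refine integral_mono (hint q r).norm (((Integrable.mul_dyadicWave_pow hG q hwi 2).add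
      (Integrable.mul_dyadicWave_pow hG r hwi 2)).div_const 2) fun u => ?_
    simp only [norm_mul, RCLike.norm_conj, Complex.norm_real, Real.norm_of_nonneg (hw0 u)]
    nlinarith [mul_nonneg (sq_nonneg (‖dyadicWave m G q u‖ - ‖dyadicWave m G r u‖)) (hw0 u)]
  have hN0 (q) : 0 ≤ N q := integral_nonneg fun u => mul_nonneg (by positivity) (hw0 u)
  have hexp : ((∫ u : ℝ × ℝ, ‖∑ q ∈ S, dyadicWave m G q u‖ ^ 2 * w u : ℝ) : ℂ) =
      ∑ q ∈ S, ∑ r ∈ S, I q r := by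
    rw [← integral_complex_ofReal]
    simp only [hI]
    simp_rw [← integral_finsetSum S fun r _ => hint _ r]
    rw [← integral_finsetSum S fun q _ => integrable_finsetSum S fun r _ => hint q r]
    refine integral_congr_ae (Filter.Eventually.of_forall fun u => ?_)
    simp only
    rw [Complex.ofReal_mul, ← Complex.normSq_eq_norm_sq, ← Complex.mul_conj, map_sum,
      Finset.sum_mul_sum, Finset.sum_mul]
    simp_rw [Finset.sum_mul]
  have h1 : ∫ u : ℝ × ℝ, ‖∑ q ∈ S, dyadicWave m G q u‖ ^ 2 * w u ≤
      ∑ q ∈ S, ∑ r ∈ S, ‖I q r‖ := by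
    have h2 : ‖((∫ u : ℝ × ℝ, ‖∑ q ∈ S, dyadicWave m G q u‖ ^ 2 * w u : ℝ) : ℂ)‖ ≤
        ∑ q ∈ S, ∑ r ∈ S, ‖I q r‖ := by
      rw [hexp]
      exact (norm_sum_le _ _).trans (Finset.sum_le_sum fun q _ => norm_sum_le _ _)
    rw [Complex.norm_real] at h2
    exact (le_abs_self _).trans h2
  have hb (q r) : ‖I q r‖ ≤ (if Adjacent q r then N q else 0) / 2 +
      (if Adjacent r q then N r else 0) / 2 := by
    by_cases h : Adjacent q r
    · rw [if_pos h, if_pos h.symm]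
      linarith [hle q r]
    · rw [hzero q r h, if_neg h, if_neg fun h' => h h'.symm]
      simp
  -- Each square has at most nine neighbours, itself included; this is the source of the constant 9.
  have hcount : ∑ q ∈ S, ∑ r ∈ S, (if Adjacent q r then N q else 0) ≤ 9 * ∑ q ∈ S, N q := by
    rw [Finset.mul_sum]
    refine Finset.sum_le_sum fun q _ => ?_
    rw [← Finset.sum_filter, Finset.sum_const, nsmul_eq_mul]
    exact mul_le_mul_of_nonneg_right (by exact_mod_cast card_adjacent_le S q) (hN0 q)
  calc _ ≤ ∑ q ∈ S, ∑ r ∈ S, ‖I q r‖ := h1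
    _ ≤ ∑ q ∈ S, ∑ r ∈ S, ((if Adjacent q r then N q else 0) / 2 +
      (if Adjacent r q then N r else 0) / 2) :=
        Finset.sum_le_sum fun q _ => Finset.sum_le_sum fun r _ => hb q r
    _ = (∑ q ∈ S, ∑ r ∈ S, (if Adjacent q r then N q else 0)) / 2 +
        (∑ q ∈ S, ∑ r ∈ S, (if Adjacent q r then N q else 0)) / 2 := by
        simp_rw [Finset.sum_add_distrib, ← Finset.sum_div]
        congr 2
        exact Finset.sum_comm
    _ ≤ _ := by linarith

theorem ofReal_integral_rpow_dyadicWave (hG : IntegrableOn G unitSquare)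
    (q : Fin (2 ^ m) × Fin (2 ^ m)) {w : ℝ × ℝ → ℝ} (hw : Integrable w) (hw0 : ∀ u, 0 ≤ w u)
    {s : ℝ} (hs : 0 ≤ s) :
    ENNReal.ofReal (∫ u, ‖dyadicWave m G q u‖ ^ s * w u) =
      ∫⁻ u, ‖dyadicWave m G q u‖ₑ ^ s * ENNReal.ofReal (w u) := by
  rw [ofReal_integral_eq_lintegral_ofReal (Integrable.mul_dyadicWave_rpow hG q hw hs)
    (Filter.Eventually.of_forall fun u => mul_nonneg (Real.rpow_nonneg (norm_nonneg _) _) (hw0 u))]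
  refine lintegral_congr fun u => ?_
  rw [ENNReal.ofReal_mul (Real.rpow_nonneg (norm_nonneg _) _),
    ← ENNReal.ofReal_rpow_of_nonneg (norm_nonneg _) hs, ofReal_norm]

end waves

/-- Decoupling for waves attached to an arbitrary family of `M` dyadic squares, with the constant
`M^{1 - 2/p}`. -/
theorem exists_plane_decoupling {p : ℝ} (hp : 2 ≤ p) {b : ℕ} (hb : 2 ≤ b) :
    ∃ (C : ℝ≥0) (ϑ : ℝ × ℝ → ℝ),
    Continuous ϑ ∧ (∀ u, 0 ≤ ϑ u) ∧ 0 < ϑ 0 ∧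
    ∀ (m : ℕ) (G : ℝ × ℝ → ℂ), IntegrableOn G unitSquare →
      ∀ S : Finset (Fin (2 ^ m) × Fin (2 ^ m)),
      ∫⁻ u, ‖∑ q ∈ S, dyadicWave m G q u‖ₑ ^ p * ENNReal.ofReal (ϑ u) ≤
        C * (S.card : ℝ≥0∞) ^ (p - 2) * ∑ q ∈ S, ∫⁻ u, ‖dyadicWave m G q u‖ₑ ^ p *
          ENNReal.ofReal (1 / planeWeight u ^ b) := by
  obtain ⟨C₁, hC₁, hloc⟩ := exists_norm_dyadicWave_le b hb
  obtain ⟨θ, hθc, hθ0, hθpos, hdec, hθ1⟩ := exists_bandlimited_kernel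
  -- Decay of order 2b + 2 absorbs the square of the growth `planeWeight u ^ b` from the uncertainty
  -- principle and leaves an integrable factor.
  obtain ⟨C₂, hC₂, hdec2⟩ := hdec (2 * b + 2)
  have hp2 : 0 ≤ p - 2 := by linarith
  have hp0 : 0 < p := by linarith
  have hθi : Integrable θ := integrable_of_le_div_one_add_abs_sq hθc (C := C₂) fun x => by
    rw [Real.norm_of_nonneg (hθ0 x)]
    refine (hdec2 x).trans (div_le_div_of_nonneg_left hC₂.le (by positivity) ?_)
    exact pow_le_pow_right₀ (by linarith [abs_nonneg x]) (by lia)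
  have hJθ : Integrable fun u : ℝ × ℝ => planeWeight u ^ (2 * b) * (θ u.1 * θ u.2) := by
    have h1 : Integrable fun x : ℝ => (1 + |x|) ^ (2 * b) * θ x := by
      refine integrable_of_le_div_one_add_abs_sq (by fun_prop) (C := C₂) fun x => ?_
      have hx : 0 < 1 + |x| := by positivity
      rw [Real.norm_of_nonneg (mul_nonneg (by positivity) (hθ0 x)), le_div_iff₀ (by positivity)]
      have := hdec2 x
      rw [le_div_iff₀ (by positivity)] at this
      rwa [mul_right_comm, ← pow_add, mul_comm]
    refine (h1.mul_prod h1).congr (Filter.Eventually.of_forall fun u => ?_)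
    simp only [planeWeight]
    rw [mul_pow, mul_mul_mul_comm]
  set I₁ : ℝ := ∫ u : ℝ × ℝ, planeWeight u ^ (2 * b) * (θ u.1 * θ u.2) with hI₁
  set I₂ : ℝ := ∫ u : ℝ × ℝ, 1 / planeWeight u ^ b with hI₂
  have hρi : Integrable fun u : ℝ × ℝ => 1 / planeWeight u ^ b :=
    integrable_inv_planeWeight_pow hb
  have hρ0 (u : ℝ × ℝ) : 0 ≤ 1 / planeWeight u ^ b :=
    one_div_nonneg.2 (pow_nonneg (planeWeight_pos u).le _)
  have hI₁0 : 0 ≤ I₁ := integral_nonneg fun u =>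
    mul_nonneg (pow_nonneg (planeWeight_pos u).le _) (mul_nonneg (hθ0 _) (hθ0 _))
  have hI₂0 : 0 ≤ I₂ := integral_nonneg hρ0
  -- The negative power cancels the growth of the pointwise bound raised to p - 2; the band-limited
  -- factor is kept for the remaining square.
  let ϑ : ℝ × ℝ → ℝ := fun u => (planeWeight u ^ b) ^ (-(p - 2)) * (θ u.1 * θ u.2)
  refine ⟨Real.toNNReal (C₁ ^ (p - 2) * 9 * (C₁ ^ 2 * I₁) * I₂ ^ (p - 1)), ϑ, ?_, fun u => ?_, ?_,
    fun m G hG S => ?_⟩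
  · refine Continuous.mul (Continuous.rpow_const (by fun_prop) fun u =>
      Or.inl (pow_pos (planeWeight_pos u) _).ne') (by fun_prop)
  · exact mul_nonneg (Real.rpow_nonneg (pow_nonneg (planeWeight_pos u).le _) _)
      (mul_nonneg (hθ0 _) (hθ0 _))
  · exact mul_pos (Real.rpow_pos_of_pos (pow_pos (planeWeight_pos 0) _) _) (mul_pos hθpos hθpos)
  set φ := dyadicWave m G with hφ
  set B := fun q => ∫ v, ‖φ q v‖ * (1 / planeWeight v ^ b) with hB
  have hB0 (q) : 0 ≤ B q := integral_nonneg fun u => mul_nonneg (norm_nonneg _) (hρ0 u)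
  have hsumB : 0 ≤ ∑ q ∈ S, B q := Finset.sum_nonneg fun q _ => hB0 q
  have hw0 (u : ℝ × ℝ) : 0 ≤ θ u.1 * θ u.2 := mul_nonneg (hθ0 _) (hθ0 _)
  have hwi : Integrable fun u : ℝ × ℝ => θ u.1 * θ u.2 := hθi.mul_prod hθi
  have hFc : Continuous fun u => ∑ q ∈ S, φ q u :=
    continuous_finsetSum S fun q _ => continuous_dyadicWave hG q
  have hFle (u : ℝ × ℝ) : ‖∑ q ∈ S, φ q u‖ ≤ planeWeight u ^ b * (C₁ * ∑ q ∈ S, B q) := by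
    refine (norm_sum_le _ _).trans ?_
    rw [Finset.mul_sum, Finset.mul_sum]
    refine Finset.sum_le_sum fun q _ => (hloc m G hG q u).trans_eq ?_
    ring
  -- Split |F|^p = |F|^{p-2} |F|²: the first factor is bounded pointwise by the sum of the averages,
  -- the second is left for orthogonality.
  have hpt (u : ℝ × ℝ) : ‖∑ q ∈ S, φ q u‖ ^ p * ϑ u ≤
      (C₁ * ∑ q ∈ S, B q) ^ (p - 2) * (‖∑ q ∈ S, φ q u‖ ^ 2 * (θ u.1 * θ u.2)) := by
    have hJ : 0 < planeWeight u ^ b := pow_pos (planeWeight_pos u) _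
    have h1 : ‖∑ q ∈ S, φ q u‖ ^ p = ‖∑ q ∈ S, φ q u‖ ^ (p - 2) * ‖∑ q ∈ S, φ q u‖ ^ 2 := by
      rw [← Real.rpow_natCast, ← Real.rpow_add_of_nonneg (norm_nonneg _) hp2 (by norm_num)]
      congr 1
      push_cast
      ring
    have h2 : ‖∑ q ∈ S, φ q u‖ ^ (p - 2) * (planeWeight u ^ b) ^ (-(p - 2)) ≤
        (C₁ * ∑ q ∈ S, B q) ^ (p - 2) := by
      rw [Real.rpow_neg hJ.le, ← div_eq_mul_inv, div_le_iff₀ (Real.rpow_pos_of_pos hJ _),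
        ← Real.mul_rpow (by positivity) hJ.le, mul_comm]
      exact Real.rpow_le_rpow (norm_nonneg _) ((hFle u).trans_eq (by ring)) hp2
    calc _ = (‖∑ q ∈ S, φ q u‖ ^ (p - 2) * (planeWeight u ^ b) ^ (-(p - 2))) *
          (‖∑ q ∈ S, φ q u‖ ^ 2 * (θ u.1 * θ u.2)) := by
          rw [h1]
          ring
      _ ≤ _ := mul_le_mul_of_nonneg_right h2 (mul_nonneg (by positivity) (hw0 u))
  have hF2i : Integrable fun u : ℝ × ℝ => ‖∑ q ∈ S, φ q u‖ ^ 2 * (θ u.1 * θ u.2) := by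
    refine hwi.bdd_mul (c := (∑ q ∈ S, ∫ z in dyadicSquare m q, ‖G z‖) ^ 2)
      (hFc.norm.pow 2).aestronglyMeasurable (Filter.Eventually.of_forall fun u => ?_)
    rw [norm_pow, norm_norm]
    exact pow_le_pow_left₀ (norm_nonneg _) ((norm_sum_le _ _).trans
      (Finset.sum_le_sum fun q _ => norm_planeWave_le u)) 2
  -- The same pointwise bound turns each diagonal L² term back into the average B_q, so that only
  -- the numbers B_q remain.
  have hsq (q) : ∫ u : ℝ × ℝ, ‖φ q u‖ ^ 2 * (θ u.1 * θ u.2) ≤ C₁ ^ 2 * I₁ * B q ^ 2 := by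
    rw [hI₁, mul_right_comm, ← integral_const_mul]
    refine integral_mono_of_nonneg (Filter.Eventually.of_forall fun u =>
      mul_nonneg (by positivity) (hw0 u)) (hJθ.const_mul _)
      (Filter.Eventually.of_forall fun u => ?_)
    calc ‖φ q u‖ ^ 2 * (θ u.1 * θ u.2) ≤
        (C₁ * planeWeight u ^ b * B q) ^ 2 * (θ u.1 * θ u.2) := by
          refine mul_le_mul_of_nonneg_right ?_ (hw0 u)
          exact pow_le_pow_left₀ (norm_nonneg _) (hloc m G hG q u) 2
      _ = _ := by ring
  have hmain : ∫ u : ℝ × ℝ, (C₁ * ∑ q ∈ S, B q) ^ (p - 2) *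
      (‖∑ q ∈ S, φ q u‖ ^ 2 * (θ u.1 * θ u.2)) ≤
      C₁ ^ (p - 2) * 9 * (C₁ ^ 2 * I₁) * ((S.card : ℝ) ^ (p - 2) * ∑ q ∈ S, B q ^ p) := by
    rw [integral_const_mul]
    calc _ ≤ (C₁ * ∑ q ∈ S, B q) ^ (p - 2) * (9 * ∑ q ∈ S, C₁ ^ 2 * I₁ * B q ^ 2) := by
          refine mul_le_mul_of_nonneg_left ?_ (Real.rpow_nonneg (by positivity) _)
          refine (integral_norm_sum_dyadicWave_sq_le hθ0 hθi hθ1 hG S).trans ?_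
          exact mul_le_mul_of_nonneg_left (Finset.sum_le_sum fun q _ => hsq q) (by norm_num)
      _ = C₁ ^ (p - 2) * 9 * (C₁ ^ 2 * I₁) *
          ((∑ q ∈ S, B q) ^ (p - 2) * ∑ q ∈ S, B q ^ 2) := by
          rw [Real.mul_rpow hC₁ hsumB, ← Finset.mul_sum]
          ring
      _ ≤ _ := mul_le_mul_of_nonneg_left (rpow_sum_mul_sum_sq_le S hB0 hp) (by positivity)
  have hBp (q) : ENNReal.ofReal (B q ^ p) ≤ ENNReal.ofReal (I₂ ^ (p - 1)) *
      ∫⁻ u, ‖φ q u‖ₑ ^ p * ENNReal.ofReal (1 / planeWeight u ^ b) := by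
    have h1 : ENNReal.ofReal (B q) =
        ∫⁻ u, ‖φ q u‖ₑ * ENNReal.ofReal (1 / planeWeight u ^ b) := by
      have := ofReal_integral_rpow_dyadicWave hG q hρi hρ0 (s := 1) zero_le_one
      simpa only [Real.rpow_one, ENNReal.rpow_one] using this
    rw [← ENNReal.ofReal_rpow_of_nonneg (hB0 q) hp0.le, h1,
      ← ENNReal.ofReal_rpow_of_nonneg hI₂0 (by linarith), hI₂,
      ofReal_integral_eq_lintegral_ofReal hρi (Filter.Eventually.of_forall hρ0)]
    exact rpow_lintegral_mul_le volume (continuous_dyadicWave hG q).enorm.measurable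
      (measurable_const.div (continuous_planeWeight.measurable.pow_const _)).ennreal_ofReal
      (by linarith)
  calc ∫⁻ u, ‖∑ q ∈ S, φ q u‖ₑ ^ p * ENNReal.ofReal (ϑ u)
      ≤ ∫⁻ u : ℝ × ℝ, ENNReal.ofReal ((C₁ * ∑ q ∈ S, B q) ^ (p - 2) *
        (‖∑ q ∈ S, φ q u‖ ^ 2 * (θ u.1 * θ u.2))) := by
        refine lintegral_mono fun u => ?_
        rw [← ofReal_norm, ENNReal.ofReal_rpow_of_nonneg (norm_nonneg _) hp0.le,
          ← ENNReal.ofReal_mul (Real.rpow_nonneg (norm_nonneg _) _)]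
        exact ENNReal.ofReal_le_ofReal (hpt u)
    _ = ENNReal.ofReal (∫ u : ℝ × ℝ, (C₁ * ∑ q ∈ S, B q) ^ (p - 2) *
        (‖∑ q ∈ S, φ q u‖ ^ 2 * (θ u.1 * θ u.2))) := by
        rw [ofReal_integral_eq_lintegral_ofReal (hF2i.const_mul _)]
        exact Filter.Eventually.of_forall fun u => mul_nonneg (Real.rpow_nonneg (by positivity) _)
          (mul_nonneg (by positivity) (hw0 u))
    _ ≤ ENNReal.ofReal (C₁ ^ (p - 2) * 9 * (C₁ ^ 2 * I₁) *
        ((S.card : ℝ) ^ (p - 2) * ∑ q ∈ S, B q ^ p)) := ENNReal.ofReal_le_ofReal hmain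
    _ = ENNReal.ofReal (C₁ ^ (p - 2) * 9 * (C₁ ^ 2 * I₁)) * ((S.card : ℝ≥0∞) ^ (p - 2) *
        ∑ q ∈ S, ENNReal.ofReal (B q ^ p)) := by
        rw [ENNReal.ofReal_mul (show 0 ≤ C₁ ^ (p - 2) * 9 * (C₁ ^ 2 * I₁) by positivity),
          ENNReal.ofReal_mul (show 0 ≤ (S.card : ℝ) ^ (p - 2) by positivity),
          ENNReal.ofReal_sum_of_nonneg fun q _ => Real.rpow_nonneg (hB0 q) _,
          ← ENNReal.ofReal_rpow_of_nonneg (by positivity) hp2, ENNReal.ofReal_natCast]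
    _ ≤ ENNReal.ofReal (C₁ ^ (p - 2) * 9 * (C₁ ^ 2 * I₁)) * ((S.card : ℝ≥0∞) ^ (p - 2) *
        ∑ q ∈ S, ENNReal.ofReal (I₂ ^ (p - 1)) *
          ∫⁻ u, ‖φ q u‖ₑ ^ p * ENNReal.ofReal (1 / planeWeight u ^ b)) := by
        gcongr with q _
        exact hBp q
    _ = _ := by
        rw [← Finset.mul_sum]
        have : ((Real.toNNReal (C₁ ^ (p - 2) * 9 * (C₁ ^ 2 * I₁) * I₂ ^ (p - 1)) : ℝ≥0) : ℝ≥0∞) =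
            ENNReal.ofReal (C₁ ^ (p - 2) * 9 * (C₁ ^ 2 * I₁)) * ENNReal.ofReal (I₂ ^ (p - 1)) := by
          rw [← ENNReal.ofReal_mul (by positivity)]
          rfl
        rw [this]
        ring

/-! ### Basic properties of the extension operator and of the ball weights. -/

section basic

variable {A : Coeffs} {S : Set (ℝ × ℝ)} {g : ℝ × ℝ → ℂ}

@[fun_prop]
theorem continuous_surface (A : Coeffs) : Continuous (surface A) := by
  unfold surface
  refine (PiLp.continuous_toLp 2 _).comp (continuous_pi fun i => ?_)
  fin_cases i <;> simp <;> fun_prop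

theorem norm_extension_le (x : EuclideanSpace ℝ (Fin 4)) :
    ‖extension A S g x‖ ≤ ∫ z in S, ‖g z‖ := by
  refine (norm_integral_le_integral_norm _).trans_eq ?_
  simp [norm_e]

theorem integrableOn_mul_phase (hg : IntegrableOn g S) (x : EuclideanSpace ℝ (Fin 4)) :
    IntegrableOn (fun z => g z * e (inner ℝ x (surface A z))) S :=
  Integrable.mul_of_norm_one hg
    (by fun_prop : Continuous fun z => e (inner ℝ x (surface A z))).aestronglyMeasurable
    fun _ => norm_e _

theorem continuous_extension (hg : IntegrableOn g S) : Continuous (extension A S g) := by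
  refine continuous_of_dominated (bound := fun z => ‖g z‖) (fun x => ?_) (fun x => ?_) hg.norm ?_
  · exact (integrableOn_mul_phase hg x).aestronglyMeasurable
  · exact Filter.Eventually.of_forall fun z => by simp [norm_e]
  · exact Filter.Eventually.of_forall fun z => by fun_prop

theorem ballWeight_pos {R : ℝ} (hR : 0 < R) (c x : EuclideanSpace ℝ (Fin 4)) :
    0 < ballWeight c R x := by
  unfold ballWeight
  positivity

theorem continuous_ballWeight {R : ℝ} (hR : 0 < R) (c : EuclideanSpace ℝ (Fin 4)) :
    Continuous (ballWeight c R) := by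
  unfold ballWeight
  refine continuous_const.div (by fun_prop) fun x => ?_
  positivity

theorem measurable_ballWeight {R : ℝ} (hR : 0 < R) (c : EuclideanSpace ℝ (Fin 4)) :
    Measurable fun x => ENNReal.ofReal (ballWeight c R x) :=
  (continuous_ballWeight hR c).measurable.ennreal_ofReal

theorem wNorm_rpow {F : Type*} [NormedAddCommGroup F] {p : ℝ} (hp : 0 < p)
    (c : EuclideanSpace ℝ (Fin 4)) {R : ℝ} (hR : 0 < R) (f : EuclideanSpace ℝ (Fin 4) → F) :
    wNorm p c R f ^ p = ∫⁻ x, ‖f x‖ₑ ^ p * ENNReal.ofReal (ballWeight c R x) := by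
  have h0 : ENNReal.ofReal p ≠ 0 := by simpa using hp
  rw [wNorm, eLpNorm_eq_lintegral_rpow_enorm_toReal h0 ENNReal.ofReal_ne_top,
    ENNReal.toReal_ofReal hp.le, ← ENNReal.rpow_mul, one_div_mul_cancel hp.ne', ENNReal.rpow_one,
    lintegral_withDensity_eq_lintegral_mul_non_measurable _ (measurable_ballWeight hR c)
      (Filter.Eventually.of_forall fun x => ENNReal.ofReal_lt_top)]
  simp [mul_comm]

theorem lintegral_ballWeight_lt_top {R : ℝ} (hR : 0 < R) (c : EuclideanSpace ℝ (Fin 4)) :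
    ∫⁻ x, ENNReal.ofReal (ballWeight c R x) < ∞ := by
  have h := integrable_one_add_norm (E := EuclideanSpace ℝ (Fin 4)) (μ := volume) (r := 100)
    (by simp; norm_num)
  have h1 := (h.comp_smul (R := R⁻¹) (by positivity)).comp_sub_right c
  have h2 : Integrable (ballWeight c R) := by
    refine h1.congr (Filter.Eventually.of_forall fun x => ?_)
    simp only [ballWeight]
    rw [norm_smul, norm_inv, Real.norm_of_nonneg hR.le, Real.rpow_neg (by positivity), one_div,
      ← div_eq_inv_mul]
    congr 1
    exact_mod_cast Real.rpow_natCast _ 100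
  exact h2.lintegral_lt_top

end basic

/-! ### From planar waves to the surface: flat decoupling. -/

/-- The embedding of the plane as the first two coordinates. -/
def planeEmbed (u : ℝ × ℝ) : EuclideanSpace ℝ (Fin 4) := !₂[u.1, u.2, 0, 0]

@[fun_prop]
theorem continuous_planeEmbed : Continuous planeEmbed := by
  unfold planeEmbed
  refine (PiLp.continuous_toLp 2 _).comp (continuous_pi fun i => ?_)
  fin_cases i <;> simp <;> fun_prop

theorem norm_planeEmbed_le (u : ℝ × ℝ) : ‖planeEmbed u‖ ≤ |u.1| + |u.2| := by
  rw [EuclideanSpace.norm_eq, Real.sqrt_le_left (by positivity), Fin.sum_univ_four]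
  simp only [planeEmbed, Real.norm_eq_abs]
  simp
  nlinarith [mul_nonneg (abs_nonneg u.1) (abs_nonneg u.2), sq_abs u.1, sq_abs u.2]

theorem inner_planeEmbed_surface (A : Coeffs) (u z : ℝ × ℝ) :
    inner ℝ (planeEmbed u) (surface A z) = u.1 * z.1 + u.2 * z.2 := by
  simp only [planeEmbed, surface, PiLp.inner_apply, Fin.sum_univ_four]
  simp [mul_comm]

/-- A shift in the first two coordinates meets only the linear part of the surface. All the rest of
the phase depends on x alone and is absorbed into the amplitude, which is why the surface is
irrelevant here. -/
theorem extension_add_planeEmbed (A : Coeffs) (m : ℕ) (q : Fin (2 ^ m) × Fin (2 ^ m))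
    (g : ℝ × ℝ → ℂ) (x : EuclideanSpace ℝ (Fin 4)) (u : ℝ × ℝ) :
    extension A (dyadicSquare m q) g (x + planeEmbed ((2 : ℝ) ^ m • u)) =
      dyadicWave m (fun z => g z * e (inner ℝ x (surface A z))) q u := by
  rw [extension, dyadicWave, planeWave]
  congr 1
  ext z
  rw [inner_add_left, inner_planeEmbed_surface, e_add, ← mul_assoc]
  congr 2
  simp only [Prod.smul_fst, Prod.smul_snd, smul_eq_mul]
  ring

/-- Here the radius must be at least K: shifts of size K are then at most unit shifts on the scale
of the ball, and the ball weight changes by at most `planeWeight u ^ 100`. -/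
theorem one_add_norm_planeEmbed_le {K R : ℝ} (hK : 0 ≤ K) (hKR : K ≤ R) (hR : 0 < R)
    (u : ℝ × ℝ) : 1 + ‖planeEmbed (K • u)‖ / R ≤ planeWeight u := by
  have h1 : ‖planeEmbed (K • u)‖ / R ≤ |u.1| + |u.2| := by
    rw [div_le_iff₀ hR]
    refine (norm_planeEmbed_le _).trans ?_
    simp only [Prod.smul_fst, Prod.smul_snd, smul_eq_mul, abs_mul, abs_of_nonneg hK]
    nlinarith [abs_nonneg u.1, abs_nonneg u.2]
  unfold planeWeight
  nlinarith [mul_nonneg (abs_nonneg u.1) (abs_nonneg u.2)]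

/-- The weights of a ball vary slowly at the scale of its radius. -/
theorem ballWeight_le_mul {R : ℝ} (hR : 0 < R) (c x y : EuclideanSpace ℝ (Fin 4)) :
    ballWeight c R x ≤ ballWeight c R y * (1 + ‖x - y‖ / R) ^ 100 := by
  unfold ballWeight
  rw [one_div_mul_eq_div, div_le_div_iff₀ (by positivity) (by positivity), one_mul, ← mul_pow]
  refine pow_le_pow_left₀ (by positivity) ?_ _
  have h : ‖y - c‖ ≤ ‖x - y‖ + ‖x - c‖ := by
    calc ‖y - c‖ = ‖(x - c) - (x - y)‖ := by congr 1; abel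
      _ ≤ ‖x - c‖ + ‖x - y‖ := norm_sub_le _ _
      _ = _ := add_comm _ _
  calc 1 + ‖y - c‖ / R ≤ 1 + (‖x - y‖ + ‖x - c‖) / R := by gcongr
    _ ≤ (1 + ‖x - y‖ / R) * (1 + ‖x - c‖ / R) := by
      rw [add_div]
      nlinarith [mul_nonneg (div_nonneg (norm_nonneg (x - y)) hR.le)
        (div_nonneg (norm_nonneg (x - c)) hR.le)]

/-- By Tonelli and translation invariance, averaging a function over planar shifts amounts to moving
the shifts onto the weight. This converts a planar inequality, valid at every base point x, into one
on the ball. -/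
theorem lintegral_smear {h W : EuclideanSpace ℝ (Fin 4) → ℝ≥0∞} {k : ℝ × ℝ → ℝ≥0∞}
    (hh : Measurable h) (hW : Measurable W) (hk : Measurable k) (K : ℝ) :
    ∫⁻ x, (∫⁻ u, h (x + planeEmbed (K • u)) * k u) * W x =
      ∫⁻ u, k u * ∫⁻ x, h x * W (x - planeEmbed (K • u)) := by
  have hm : Measurable fun w : EuclideanSpace ℝ (Fin 4) × (ℝ × ℝ) =>
      h (w.1 + planeEmbed (K • w.2)) :=
    hh.comp (by fun_prop : Continuous fun w : EuclideanSpace ℝ (Fin 4) × (ℝ × ℝ) =>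
      w.1 + planeEmbed (K • w.2)).measurable
  calc ∫⁻ x, (∫⁻ u, h (x + planeEmbed (K • u)) * k u) * W x =
      ∫⁻ x, ∫⁻ u, h (x + planeEmbed (K • u)) * k u * W x := by
        refine lintegral_congr fun x => ?_
        rw [lintegral_mul_const]
        exact (hm.comp measurable_prodMk_left).mul hk
    _ = ∫⁻ u, ∫⁻ x, h (x + planeEmbed (K • u)) * k u * W x := by
        refine lintegral_lintegral_swap ?_
        exact ((hm.mul (hk.comp measurable_snd)).mul (hW.comp measurable_fst)).aemeasurable
    _ = _ := by
        refine lintegral_congr fun u => ?_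
        have hm' : Measurable fun x => h x * W (x - planeEmbed (K • u)) :=
          hh.mul (hW.comp (measurable_id.sub_const _))
        rw [← lintegral_const_mul _ hm', ← lintegral_add_right_eq_self
          (fun x => k u * (h x * W (x - planeEmbed (K • u)))) (planeEmbed (K • u))]
        refine lintegral_congr fun x => ?_
        rw [add_sub_cancel_right]
        ring

/-- Decoupling for an arbitrary family of `M` dyadic squares of side length `1 / K`, with the
constant `M^{1 - 2/p}`, over balls of radius at least `K`. -/
theorem exists_flat_decoupling {p : ℝ} (hp : 2 ≤ p) : ∃ C : ℝ≥0,
    ∀ (A : Coeffs) (m : ℕ) (R : ℝ), (2 : ℝ) ^ m ≤ R → ∀ g : ℝ × ℝ → ℂ, IntegrableOn g unitSquare →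
      ∀ (c : EuclideanSpace ℝ (Fin 4)) (S : Finset (Fin (2 ^ m) × Fin (2 ^ m))),
      wNorm p c R (fun x => ∑ q ∈ S, extension A (dyadicSquare m q) g x) ^ p ≤
        C * (S.card : ℝ≥0∞) ^ (p - 2) *
          ∑ q ∈ S, wNorm p c R (extension A (dyadicSquare m q) g) ^ p := by
  -- Of the exponent 102, a hundred pays for shifting the ball weight and two keep the remaining
  -- weight integrable.
  obtain ⟨C, ϑ, hϑc, hϑ0, hϑpos, hplane⟩ := exists_plane_decoupling hp (b := 102) (by norm_num)
  have hp0 : 0 < p := by linarith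
  have hJpos (u : ℝ × ℝ) : 0 < planeWeight u ^ 100 := pow_pos (planeWeight_pos u) _
  have hkc : Continuous fun u => ϑ u / planeWeight u ^ 100 :=
    hϑc.div (continuous_planeWeight.pow 100) fun u => (hJpos u).ne'
  set I₁ : ℝ≥0∞ := ∫⁻ u, ENNReal.ofReal (ϑ u / planeWeight u ^ 100) with hI₁
  set I₂ : ℝ≥0∞ := ∫⁻ u, ENNReal.ofReal (1 / planeWeight u ^ 2) with hI₂
  have hI₂top : I₂ ≠ ∞ := (integrable_inv_planeWeight_pow le_rfl).lintegral_lt_top.ne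
  have hI₁0 : 0 < I₁ := by
    rw [hI₁, lintegral_pos_iff_support hkc.measurable.ennreal_ofReal]
    have hopen : IsOpen (Function.support fun u => ENNReal.ofReal (ϑ u / planeWeight u ^ 100)) :=
      (ENNReal.continuous_ofReal.comp hkc).isOpen_support
    refine hopen.measure_pos volume ⟨0, ?_⟩
    simp only [Function.mem_support, ne_eq, ENNReal.ofReal_eq_zero, not_le]
    exact div_pos hϑpos (hJpos 0)
  -- Truncating at one gives an invertible finite constant without a finiteness proof for the
  -- integral itself.
  set c' := min I₁ 1 with hc'
  have hc'0 : c' ≠ 0 := (lt_min hI₁0 one_pos).ne'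
  have hc'top : c' ≠ ∞ := ((min_le_right _ _).trans_lt ENNReal.one_lt_top).ne
  refine ⟨(c'⁻¹ * (C * I₂)).toNNReal, fun A m R hR g hg c S => ?_⟩
  rw [ENNReal.coe_toNNReal (ENNReal.mul_ne_top (ENNReal.inv_ne_top.2 hc'0)
    (ENNReal.mul_ne_top ENNReal.coe_ne_top hI₂top))]
  have hK : (0 : ℝ) < 2 ^ m := by positivity
  have hR0 : 0 < R := hK.trans_le hR
  have hW := measurable_ballWeight hR0 c
  have hf (q) : Continuous (extension A (dyadicSquare m q) g) :=
    continuous_extension (hg.mono_set (dyadicSquare_subset_unitSquare m q))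
  have hF : Continuous fun x => ∑ q ∈ S, extension A (dyadicSquare m q) g x :=
    continuous_finsetSum S fun q _ => hf q
  have hρ : Measurable fun u : ℝ × ℝ => ENNReal.ofReal (1 / planeWeight u ^ 102) :=
    (measurable_const.div (continuous_planeWeight.measurable.pow_const _)).ennreal_ofReal
  have hρ2 : Measurable fun u : ℝ × ℝ => ENNReal.ofReal (1 / planeWeight u ^ 2) :=
    (measurable_const.div (continuous_planeWeight.measurable.pow_const _)).ennreal_ofReal
  have hmul (f : EuclideanSpace ℝ (Fin 4) → ℂ) (hf : Continuous f) :
      Measurable fun x => ‖f x‖ₑ ^ p * ENNReal.ofReal (ballWeight c R x) :=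
    (hf.enorm.measurable.pow_const p).mul hW
  have hmul' (f : EuclideanSpace ℝ (Fin 4) → ℂ) (hf : Continuous f) (v) :
      Measurable fun x => ‖f x‖ₑ ^ p * ENNReal.ofReal (ballWeight c R (x - v)) :=
    (hf.enorm.measurable.pow_const p).mul (hW.comp (measurable_id.sub_const v))
  simp_rw [wNorm_rpow hp0 c hR0]
  -- The smeared integral dominates the original one: the shifted weight is at least the unshifted
  -- one divided by `planeWeight u ^ 100`.
  have hlow : c' * ∫⁻ x, ‖∑ q ∈ S, extension A (dyadicSquare m q) g x‖ₑ ^ p *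
      ENNReal.ofReal (ballWeight c R x) ≤
      ∫⁻ x, (∫⁻ u, ‖∑ q ∈ S, extension A (dyadicSquare m q) g
        (x + planeEmbed ((2 : ℝ) ^ m • u))‖ₑ ^ p * ENNReal.ofReal (ϑ u)) *
        ENNReal.ofReal (ballWeight c R x) := by
    rw [lintegral_smear (hF.enorm.measurable.pow_const p) hW hϑc.measurable.ennreal_ofReal]
    refine (mul_le_mul_left (min_le_left _ _) _).trans ?_
    rw [hI₁, ← lintegral_mul_const _ hkc.measurable.ennreal_ofReal]
    refine lintegral_mono fun u => ?_
    rw [← lintegral_const_mul _ (hmul _ hF), ← lintegral_const_mul _ (hmul' _ hF _)]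
    refine lintegral_mono fun x => ?_
    have hw : ϑ u / planeWeight u ^ 100 * ballWeight c R x ≤
        ϑ u * ballWeight c R (x - planeEmbed ((2 : ℝ) ^ m • u)) := by
      rw [div_mul_eq_mul_div, div_le_iff₀ (hJpos u), mul_assoc]
      refine mul_le_mul_of_nonneg_left ((ballWeight_le_mul hR0 c x
        (x - planeEmbed ((2 : ℝ) ^ m • u))).trans ?_) (hϑ0 u)
      refine mul_le_mul_of_nonneg_left ?_ (ballWeight_pos hR0 c _).le
      refine pow_le_pow_left₀ (by positivity) ?_ _
      rw [sub_sub_cancel]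
      exact one_add_norm_planeEmbed_le hK.le hR hR0 u
    calc _ = ‖∑ q ∈ S, extension A (dyadicSquare m q) g x‖ₑ ^ p *
          ENNReal.ofReal (ϑ u / planeWeight u ^ 100 * ballWeight c R x) := by
          rw [ENNReal.ofReal_mul (div_nonneg (hϑ0 u) (hJpos u).le)]
          ring
      _ ≤ ‖∑ q ∈ S, extension A (dyadicSquare m q) g x‖ₑ ^ p *
          ENNReal.ofReal (ϑ u * ballWeight c R (x - planeEmbed ((2 : ℝ) ^ m • u))) := by
          gcongr
      _ = _ := by
          rw [ENNReal.ofReal_mul (hϑ0 u)]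
          ring
  -- Conversely the shifted weight is at most `planeWeight u ^ 100` times the unshifted one, which
  -- the power 102 outweighs.
  have hupp (q) : ∫⁻ x, (∫⁻ u, ‖extension A (dyadicSquare m q) g
        (x + planeEmbed ((2 : ℝ) ^ m • u))‖ₑ ^ p * ENNReal.ofReal (1 / planeWeight u ^ 102)) *
        ENNReal.ofReal (ballWeight c R x) ≤
      I₂ * ∫⁻ x, ‖extension A (dyadicSquare m q) g x‖ₑ ^ p *
        ENNReal.ofReal (ballWeight c R x) := by
    rw [lintegral_smear ((hf q).enorm.measurable.pow_const p) hW hρ, hI₂,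
      ← lintegral_mul_const _ hρ2]
    refine lintegral_mono fun u => ?_
    rw [← lintegral_const_mul _ (hmul _ (hf q)), ← lintegral_const_mul _ (hmul' _ (hf q) _)]
    refine lintegral_mono fun x => ?_
    have hw : 1 / planeWeight u ^ 102 * ballWeight c R (x - planeEmbed ((2 : ℝ) ^ m • u)) ≤
        1 / planeWeight u ^ 2 * ballWeight c R x := by
      have h2 : 0 < planeWeight u ^ 2 := pow_pos (planeWeight_pos u) _
      rw [show planeWeight u ^ 102 = planeWeight u ^ 2 * planeWeight u ^ 100 from pow_add _ 2 100,
        ← one_div_mul_one_div, mul_assoc]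
      refine mul_le_mul_of_nonneg_left ?_ (one_div_nonneg.2 h2.le)
      rw [one_div_mul_eq_div, div_le_iff₀ (hJpos u)]
      refine (ballWeight_le_mul hR0 c _ x).trans ?_
      refine mul_le_mul_of_nonneg_left ?_ (ballWeight_pos hR0 c _).le
      refine pow_le_pow_left₀ (by positivity) ?_ _
      rw [sub_sub_cancel_left, norm_neg]
      exact one_add_norm_planeEmbed_le hK.le hR hR0 u
    calc _ = ‖extension A (dyadicSquare m q) g x‖ₑ ^ p * ENNReal.ofReal
          (1 / planeWeight u ^ 102 * ballWeight c R (x - planeEmbed ((2 : ℝ) ^ m • u))) := by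
          rw [ENNReal.ofReal_mul (one_div_nonneg.2 (pow_pos (planeWeight_pos u) _).le)]
          ring
      _ ≤ ‖extension A (dyadicSquare m q) g x‖ₑ ^ p * ENNReal.ofReal
          (1 / planeWeight u ^ 2 * ballWeight c R x) := by
          gcongr
      _ = _ := by
          rw [ENNReal.ofReal_mul (one_div_nonneg.2 (pow_pos (planeWeight_pos u) _).le)]
          ring
  have hmeas (q) : Measurable fun x : EuclideanSpace ℝ (Fin 4) =>
      (∫⁻ u, ‖extension A (dyadicSquare m q) g (x + planeEmbed ((2 : ℝ) ^ m • u))‖ₑ ^ p *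
        ENNReal.ofReal (1 / planeWeight u ^ 102)) * ENNReal.ofReal (ballWeight c R x) := by
    refine Measurable.mul (Measurable.lintegral_prod_right' (f := fun w :
      EuclideanSpace ℝ (Fin 4) × (ℝ × ℝ) => ‖extension A (dyadicSquare m q) g
        (w.1 + planeEmbed ((2 : ℝ) ^ m • w.2))‖ₑ ^ p *
        ENNReal.ofReal (1 / planeWeight w.2 ^ 102)) ?_) hW
    refine Measurable.mul ?_ (hρ.comp measurable_snd)
    exact (((hf q).comp (by fun_prop : Continuous fun w : EuclideanSpace ℝ (Fin 4) × (ℝ × ℝ) =>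
      w.1 + planeEmbed ((2 : ℝ) ^ m • w.2))).enorm.measurable).pow_const p
  have hmain : c' * ∫⁻ x, ‖∑ q ∈ S, extension A (dyadicSquare m q) g x‖ₑ ^ p *
      ENNReal.ofReal (ballWeight c R x) ≤
      (C * I₂) * (S.card : ℝ≥0∞) ^ (p - 2) * ∑ q ∈ S, ∫⁻ x,
        ‖extension A (dyadicSquare m q) g x‖ₑ ^ p * ENNReal.ofReal (ballWeight c R x) := by
    refine hlow.trans ?_
    calc _ ≤ ∫⁻ x, (C * (S.card : ℝ≥0∞) ^ (p - 2)) * ∑ q ∈ S,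
          (∫⁻ u, ‖extension A (dyadicSquare m q) g (x + planeEmbed ((2 : ℝ) ^ m • u))‖ₑ ^ p *
            ENNReal.ofReal (1 / planeWeight u ^ 102)) * ENNReal.ofReal (ballWeight c R x) := by
          refine lintegral_mono fun x => ?_
          have := hplane m (fun z => g z * e (inner ℝ x (surface A z)))
            (integrableOn_mul_phase hg x) S
          simp_rw [← extension_add_planeEmbed] at this
          rw [← Finset.sum_mul, ← mul_assoc]
          exact mul_le_mul_left this _
      _ = (C * (S.card : ℝ≥0∞) ^ (p - 2)) * ∑ q ∈ S, ∫⁻ x,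
          (∫⁻ u, ‖extension A (dyadicSquare m q) g (x + planeEmbed ((2 : ℝ) ^ m • u))‖ₑ ^ p *
            ENNReal.ofReal (1 / planeWeight u ^ 102)) * ENNReal.ofReal (ballWeight c R x) := by
          rw [lintegral_const_mul _ (Finset.measurable_fun_sum S fun q _ => hmeas q),
            lintegral_finsetSum S fun q _ => hmeas q]
      _ ≤ (C * (S.card : ℝ≥0∞) ^ (p - 2)) * ∑ q ∈ S, I₂ * ∫⁻ x,
          ‖extension A (dyadicSquare m q) g x‖ₑ ^ p * ENNReal.ofReal (ballWeight c R x) := by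
          gcongr with q _
          exact hupp q
      _ = _ := by
          rw [← Finset.mul_sum]
          ring
  calc _ = c'⁻¹ * (c' * ∫⁻ x, ‖∑ q ∈ S, extension A (dyadicSquare m q) g x‖ₑ ^ p *
      ENNReal.ofReal (ballWeight c R x)) := by
        rw [← mul_assoc, ENNReal.inv_mul_cancel hc'0 hc'top, one_mul]
    _ ≤ c'⁻¹ * _ := mul_le_mul_right hmain _
    _ = _ := by ring

/-! ### Factoring the quadratic form; non-transverse squares lie in strips. -/

/-- A real binary quadratic form with a large outer coefficient dominates a product of two linear
forms. -/
theorem exists_linear_factors_of_outer {c κ c₁ c₂ c₃ : ℝ} (h₁ : |c₁| ≤ c) (h₂ : |c₂| ≤ c)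
    (h₃ : |c₃| ≤ c) (hκ : κ ≤ |c₁|) : ∃ α₁ β₁ α₂ β₂ : ℝ,
      |α₁| ≤ 3 * c ∧ |β₁| ≤ 3 * c ∧ |α₂| ≤ 3 * c ∧ |β₂| ≤ 3 * c ∧ κ ≤ |α₁| ∧ κ ≤ |α₂| ∧
      ∀ a b : ℝ, |(α₁ * a + β₁ * b) * (α₂ * a + β₂ * b)| ≤
        3 * c * |c₁ * a ^ 2 + c₂ * a * b + c₃ * b ^ 2| := by
  have hc : 0 ≤ c := (abs_nonneg _).trans h₁
  -- Completing the square gives c₁Q = (c₁a + c₂b/2)² - (c₂²/4 - c₁c₃)b². If the discriminant term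
  -- is negative it is replaced by zero: dropping it only decreases c₁Q, and the two linear factors
  -- coincide.
  set D := max (c₂ ^ 2 / 4 - c₁ * c₃) 0 with hD
  set s := √D with hs
  have hss : s ^ 2 = D := Real.sq_sqrt (le_max_right _ _)
  have h22 : c₂ ^ 2 ≤ c ^ 2 := sq_le_sq.2 (by rwa [abs_of_nonneg hc])
  have h13 : |c₁ * c₃| ≤ c ^ 2 := by
    rw [abs_mul, sq]
    exact mul_le_mul h₁ h₃ (abs_nonneg _) hc
  have hs0 : 0 ≤ s := Real.sqrt_nonneg _
  have hs2 : s ≤ 2 * c := by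
    refine Real.sqrt_le_iff.2 ⟨by linarith, max_le ?_ (by positivity)⟩
    nlinarith [(abs_le.1 h13).1]
  obtain ⟨h2l, h2r⟩ := abs_le.1 h₂
  refine ⟨c₁, c₂ / 2 + s, c₁, c₂ / 2 - s, by linarith, abs_le.2 ⟨by linarith, by linarith⟩,
    by linarith, abs_le.2 ⟨by linarith, by linarith⟩, hκ, hκ, fun a b => ?_⟩
  have key : |(c₁ * a + (c₂ / 2 + s) * b) * (c₁ * a + (c₂ / 2 - s) * b)| ≤
      |c₁| * |c₁ * a ^ 2 + c₂ * a * b + c₃ * b ^ 2| := by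
    rw [← abs_mul]
    have e1 : (c₁ * a + (c₂ / 2 + s) * b) * (c₁ * a + (c₂ / 2 - s) * b) =
        (c₁ * a + c₂ / 2 * b) ^ 2 - D * b ^ 2 := by
      rw [← hss]
      ring
    rw [e1]
    rcases le_total 0 (c₂ ^ 2 / 4 - c₁ * c₃) with h | h
    · rw [hD, max_eq_left h]
      exact le_of_eq (congrArg _ (by ring))
    · rw [hD, max_eq_right h, zero_mul, sub_zero, abs_of_nonneg (sq_nonneg _)]
      refine le_trans ?_ (le_abs_self _)
      nlinarith [mul_nonneg (sub_nonneg.2 h) (sq_nonneg b)]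
  refine key.trans (mul_le_mul_of_nonneg_right ?_ (abs_nonneg _))
  linarith

/-- A nondegenerate real binary quadratic form dominates a product of two nondegenerate linear
forms. -/
theorem exists_linear_factors {c κ c₁ c₂ c₃ : ℝ} (hκ0 : 0 < κ) (h₁ : |c₁| ≤ c) (h₂ : |c₂| ≤ c)
    (h₃ : |c₃| ≤ c) (hκ : κ ≤ max |c₁| (max |c₂| |c₃|)) : ∃ α₁ β₁ α₂ β₂ : ℝ,
      |α₁| ≤ 3 * c ∧ |β₁| ≤ 3 * c ∧ |α₂| ≤ 3 * c ∧ |β₂| ≤ 3 * c ∧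
      (κ / 4 ≤ |α₁| ∨ κ / 4 ≤ |β₁|) ∧ (κ / 4 ≤ |α₂| ∨ κ / 4 ≤ |β₂|) ∧
      ∀ a b : ℝ, |(α₁ * a + β₁ * b) * (α₂ * a + β₂ * b)| ≤
        3 * c * |c₁ * a ^ 2 + c₂ * a * b + c₃ * b ^ 2| := by
  have hc : 0 ≤ c := (abs_nonneg _).trans h₁
  by_cases k₁ : κ / 4 ≤ |c₁|
  · obtain ⟨α₁, β₁, α₂, β₂, i1, i2, i3, i4, i5, i6, i7⟩ :=
      exists_linear_factors_of_outer h₁ h₂ h₃ k₁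
    exact ⟨α₁, β₁, α₂, β₂, i1, i2, i3, i4, Or.inl i5, Or.inl i6, i7⟩
  by_cases k₃ : κ / 4 ≤ |c₃|
  · obtain ⟨α₁, β₁, α₂, β₂, i1, i2, i3, i4, i5, i6, i7⟩ :=
      exists_linear_factors_of_outer h₃ h₂ h₁ k₃
    refine ⟨β₁, α₁, β₂, α₂, i2, i1, i4, i3, Or.inr i5, Or.inr i6, fun a b => ?_⟩
    have h := i7 b a
    rwa [show (α₁ * b + β₁ * a) * (α₂ * b + β₂ * a) = (β₁ * a + α₁ * b) * (β₂ * a + α₂ * b) by ring,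
      show c₃ * b ^ 2 + c₂ * b * a + c₁ * a ^ 2 = c₁ * a ^ 2 + c₂ * a * b + c₃ * b ^ 2 by ring] at h
  rw [not_le] at k₁ k₃
  have k₂ : κ ≤ |c₂| := by
    rcases le_max_iff.1 hκ with h | h
    · linarith
    · rcases le_max_iff.1 h with h | h
      · exact h
      · linarith
  have h22 : κ ^ 2 ≤ c₂ ^ 2 := by
    rw [← sq_abs c₂]
    exact pow_le_pow_left₀ hκ0.le k₂ 2
  have h22' : c₂ ^ 2 ≤ c ^ 2 := sq_le_sq.2 (by rwa [abs_of_nonneg hc])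
  have h13 : |c₁ * c₃| ≤ κ / 4 * (κ / 4) := by
    rw [abs_mul]
    exact mul_le_mul k₁.le k₃.le (abs_nonneg _) (by linarith)
  have h13' : |c₁ * c₃| ≤ c ^ 2 := by
    rw [abs_mul, sq]
    exact mul_le_mul h₁ h₃ (abs_nonneg _) hc
  set D := c₂ ^ 2 / 4 - c₁ * c₃ with hD
  -- With both outer coefficients below κ/4 and |c₂| at least κ, the discriminant is positive and
  -- the form splits over the reals.
  have hD0 : 0 ≤ D := by nlinarith [(abs_le.1 h13).2]
  have hDs : √D ^ 2 = D := Real.sq_sqrt hD0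
  have hs0 : 0 ≤ √D := Real.sqrt_nonneg _
  have hs2 : √D ≤ 2 * c := by
    refine Real.sqrt_le_iff.2 ⟨by linarith, ?_⟩
    nlinarith [(abs_le.1 h13').1]
  -- β is the root of β² - c₂β + c₁c₃ = 0 of larger modulus, so |β| ≥ |c₂|/2. The relation makes (βa
  -- + c₃b)(c₁a + βb) equal to β times the form, with β as a large coefficient in each factor.
  obtain ⟨β, hβ1, hβ2, hβ3⟩ : ∃ β : ℝ, β ^ 2 + c₁ * c₃ = β * c₂ ∧ κ / 4 ≤ |β| ∧ |β| ≤ 3 * c := by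
    obtain ⟨h2l, h2r⟩ := abs_le.1 h₂
    rcases le_total 0 c₂ with h | h
    · rw [abs_of_nonneg h] at k₂
      refine ⟨c₂ / 2 + √D, by nlinarith, ?_, ?_⟩ <;> rw [abs_of_nonneg (by linarith)] <;> linarith
    · rw [abs_of_nonpos h] at k₂
      refine ⟨c₂ / 2 - √D, by nlinarith, ?_, ?_⟩ <;> rw [abs_of_nonpos (by linarith)] <;> linarith
  refine ⟨β, c₃, c₁, β, hβ3, by linarith, by linarith, hβ3, Or.inl hβ2, Or.inr hβ2, fun a b => ?_⟩
  have e1 : (β * a + c₃ * b) * (c₁ * a + β * b) =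
      β * (c₁ * a ^ 2 + c₂ * a * b + c₃ * b ^ 2) := by
    linear_combination (a * b) * hβ1
  rw [e1, abs_mul]
  exact mul_le_mul_of_nonneg_right hβ3 (abs_nonneg _)

/-- The dyadic squares whose label is within `C` of `j`. -/
def strip {m : ℕ} (τ : Fin (2 ^ m) × Fin (2 ^ m) → ℤ) (C : ℕ) (j : ℤ) :
    Finset (Fin (2 ^ m) × Fin (2 ^ m)) :=
  Finset.univ.filter fun q => |τ q - j| ≤ C

theorem mem_strip {m : ℕ} {τ : Fin (2 ^ m) × Fin (2 ^ m) → ℤ} {C : ℕ} {j : ℤ}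
    {q : Fin (2 ^ m) × Fin (2 ^ m)} : q ∈ strip τ C j ↔ |τ q - j| ≤ C := by
  simp [strip]

/-- The label of a dyadic square with respect to a linear form. -/
def linearLabel (α β : ℝ) (m : ℕ) (q : Fin (2 ^ m) × Fin (2 ^ m)) : ℤ :=
  ⌊α * (q.1 : ℕ) + β * (q.2 : ℕ)⌋

theorem card_fin_le_of_diff_le {n d : ℕ} (s : Finset (Fin n))
    (h : ∀ i ∈ s, ∀ j ∈ s, (i : ℕ) ≤ j + d) : s.card ≤ d + 1 := by
  rcases s.eq_empty_or_nonempty with rfl | hs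
  · simp
  have h1 : s.card ≤ (Finset.Icc ((s.min' hs : Fin n) : ℕ) ((s.min' hs : Fin n) + d)).card := by
    refine Finset.card_le_card_of_injOn (fun i : Fin n => (i : ℕ)) (fun i hi => ?_)
      fun i _ j _ hij => Fin.ext hij
    simp only [Finset.coe_Icc, Set.mem_Icc]
    exact ⟨s.min'_le i hi, h i hi _ (s.min'_mem hs)⟩
  refine h1.trans ?_
  rw [Nat.card_Icc]
  omega

theorem diff_le_of_floor_near {δ α x y w : ℝ} {C : ℕ} {j : ℤ} (hδ : 0 < δ) (hα : δ ≤ |α|)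
    (hx : |⌊α * x + w⌋ - j| ≤ C) (hy : |⌊α * y + w⌋ - j| ≤ C) : |x - y| ≤ (2 * C + 1) / δ := by
  rw [le_div_iff₀ hδ]
  have h1 := Int.floor_le (α * x + w)
  have h2 := Int.lt_floor_add_one (α * x + w)
  have h3 := Int.floor_le (α * y + w)
  have h4 := Int.lt_floor_add_one (α * y + w)
  rw [abs_le] at hx hy
  have k1 : ((j : ℝ) - C) ≤ ⌊α * x + w⌋ := by exact_mod_cast (by linarith : j - (C : ℤ) ≤ _)
  have k2 : (⌊α * x + w⌋ : ℝ) ≤ j + C := by exact_mod_cast (by linarith : _ ≤ j + (C : ℤ))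
  have k3 : ((j : ℝ) - C) ≤ ⌊α * y + w⌋ := by exact_mod_cast (by linarith : j - (C : ℤ) ≤ _)
  have k4 : (⌊α * y + w⌋ : ℝ) ≤ j + C := by exact_mod_cast (by linarith : _ ≤ j + (C : ℤ))
  have h5 : |α * (x - y)| ≤ 2 * C + 1 := by
    rw [abs_le]
    constructor <;> nlinarith
  rw [abs_mul] at h5
  nlinarith [abs_nonneg (x - y)]

/-- Along the coordinate direction whose coefficient is at least δ in modulus, nearly equal labels
confine the index to a window of length (2C + 1)/δ. There are 2^m lines in that direction, so a
strip has O(2^m) squares. -/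
theorem card_strip_linearLabel_le {α β δ : ℝ} (hδ : 0 < δ) (h : δ ≤ |α| ∨ δ ≤ |β|) (C m : ℕ)
    (j : ℤ) : (strip (linearLabel α β m) C j).card ≤ (⌊(2 * C + 1) / δ⌋₊ + 1) * 2 ^ m := by
  classical
  have hfl (i k : Fin (2 ^ m)) (hik : |((i : ℕ) : ℝ) - (k : ℕ)| ≤ (2 * C + 1) / δ) :
      (i : ℕ) ≤ k + ⌊(2 * C + 1) / δ⌋₊ := by
    by_contra hlt
    rw [not_le] at hlt
    have h1 : (⌊(2 * C + 1) / δ⌋₊ + 1 : ℕ) ≤ (i : ℕ) - k := by omega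
    have h2 : ((i : ℕ) : ℝ) - (k : ℕ) = (((i : ℕ) - k : ℕ) : ℝ) := by
      rw [Nat.cast_sub (by omega)]
    have h3 := Nat.lt_floor_add_one ((2 * C + 1) / δ)
    have h4 : ((⌊(2 * C + 1) / δ⌋₊ + 1 : ℕ) : ℝ) ≤ (((i : ℕ) - k : ℕ) : ℝ) := by exact_mod_cast h1
    push_cast at h4
    linarith [le_abs_self (((i : ℕ) : ℝ) - (k : ℕ)), h2]
  -- Here f selects the line and f' the position on it; the strip is counted fibre by fibre over f.
  have himage (f : Fin (2 ^ m) × Fin (2 ^ m) → Fin (2 ^ m))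
      (f' : Fin (2 ^ m) × Fin (2 ^ m) → Fin (2 ^ m))
      (hinj : ∀ q r, f q = f r → f' q = f' r → q = r)
      (hd : ∀ q ∈ strip (linearLabel α β m) C j, ∀ r ∈ strip (linearLabel α β m) C j, f q = f r →
        |((f' q : ℕ) : ℝ) - (f' r : ℕ)| ≤ (2 * C + 1) / δ) :
      (strip (linearLabel α β m) C j).card ≤ (⌊(2 * C + 1) / δ⌋₊ + 1) * 2 ^ m := by
    refine (Finset.card_le_mul_card_image (f := f) _ (⌊(2 * C + 1) / δ⌋₊ + 1) fun a _ => ?_).trans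
      (Nat.mul_le_mul_left _ ((Finset.card_le_univ _).trans_eq (by simp)))
    have hcard : ((strip (linearLabel α β m) C j).filter fun q => f q = a).card =
        (((strip (linearLabel α β m) C j).filter fun q => f q = a).image f').card := by
      rw [Finset.card_image_of_injOn]
      intro q hq r hr hqr
      have h1 := (Finset.mem_filter.1 (Finset.mem_coe.1 hq)).2
      have h2 := (Finset.mem_filter.1 (Finset.mem_coe.1 hr)).2
      exact hinj q r (h1.trans h2.symm) hqr
    rw [hcard]
    refine card_fin_le_of_diff_le _ fun i hi k hk => ?_
    obtain ⟨q, hq, rfl⟩ := Finset.mem_image.1 hi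
    obtain ⟨r, hr, rfl⟩ := Finset.mem_image.1 hk
    obtain ⟨hq1, hq2⟩ := Finset.mem_filter.1 hq
    obtain ⟨hr1, hr2⟩ := Finset.mem_filter.1 hr
    exact hfl _ _ (hd q hq1 r hr1 (hq2.trans hr2.symm))
  rcases h with h | h
  · refine himage Prod.snd Prod.fst (fun q r h1 h2 => Prod.ext h2 h1) fun q hq r hr hqr => ?_
    rw [mem_strip, linearLabel] at hq hr
    rw [← hqr] at hr
    exact diff_le_of_floor_near hδ h hq hr
  · refine himage Prod.fst Prod.snd (fun q r h1 h2 => Prod.ext h1 h2) fun q hq r hr hqr => ?_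
    rw [mem_strip, linearLabel] at hq hr
    rw [← hqr] at hr
    rw [add_comm] at hq hr
    exact diff_le_of_floor_near hδ h hq hr

theorem abs_floor_sub_floor_le {x y : ℝ} {C : ℕ} (h : |x - y| ≤ C) :
    |⌊x⌋ - ⌊y⌋| ≤ ((C + 1 : ℕ) : ℤ) := by
  have h1 := Int.floor_le x
  have h2 := Int.lt_floor_add_one x
  have h3 := Int.floor_le y
  have h4 := Int.lt_floor_add_one y
  rw [abs_le] at h ⊢
  have k1 : ((⌊x⌋ : ℝ) - ⌊y⌋) < C + 1 := by linarith
  have k2 : -((C : ℝ) + 1) < ((⌊x⌋ : ℝ) - ⌊y⌋) := by linarith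
  have k1' : ⌊x⌋ - ⌊y⌋ < (C : ℤ) + 1 := by exact_mod_cast k1
  have k2' : -((C : ℤ) + 1) < ⌊x⌋ - ⌊y⌋ := by exact_mod_cast k2
  push_cast
  constructor <;> linarith

/-- Replacing the points by the lower left corners moves each rescaled coordinate difference by at
most one, hence the linear form by at most 2M: this gives 3M + 1, and the floors add one more. -/
theorem label_near_of_linear_form_small {α β M : ℝ} {m : ℕ} {q r : Fin (2 ^ m) × Fin (2 ^ m)}
    (hα : |α| ≤ M) (hβ : |β| ≤ M) {z w : ℝ × ℝ} (hz : z ∈ dyadicSquare m q)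
    (hw : w ∈ dyadicSquare m r)
    (h : |α * (2 ^ m * (z.1 - w.1)) + β * (2 ^ m * (z.2 - w.2))| ≤ M + 1) {C : ℕ}
    (hC : 3 * M + 1 ≤ C) : |linearLabel α β m q - linearLabel α β m r| ≤ ((C + 1 : ℕ) : ℤ) := by
  rw [mem_dyadicSquare_iff] at hz hw
  refine abs_floor_sub_floor_le (le_trans ?_ hC)
  have e1 : |(((q.1 : ℕ) : ℝ) - (r.1 : ℕ)) - 2 ^ m * (z.1 - w.1)| ≤ 1 := by
    rw [abs_le]
    constructor <;> linarith [hz.1, hz.2.1, hw.1, hw.2.1]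
  have e2 : |(((q.2 : ℕ) : ℝ) - (r.2 : ℕ)) - 2 ^ m * (z.2 - w.2)| ≤ 1 := by
    rw [abs_le]
    constructor <;> linarith [hz.2.2.1, hz.2.2.2, hw.2.2.1, hw.2.2.2]
  have hM : 0 ≤ M := (abs_nonneg _).trans hα
  have f1 : |α * ((((q.1 : ℕ) : ℝ) - (r.1 : ℕ)) - 2 ^ m * (z.1 - w.1))| ≤ M := by
    rw [abs_mul]
    nlinarith [abs_nonneg α, abs_nonneg ((((q.1 : ℕ) : ℝ) - (r.1 : ℕ)) - 2 ^ m * (z.1 - w.1))]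
  have f2 : |β * ((((q.2 : ℕ) : ℝ) - (r.2 : ℕ)) - 2 ^ m * (z.2 - w.2))| ≤ M := by
    rw [abs_mul]
    nlinarith [abs_nonneg β, abs_nonneg ((((q.2 : ℕ) : ℝ) - (r.2 : ℕ)) - 2 ^ m * (z.2 - w.2))]
  rw [abs_le] at *
  constructor <;> linarith [h.1, h.2, f1.1, f1.2, f2.1, f2.2]

theorem Coeffs.Nondegenerate.abs_minors_le {L : ℝ} {A : Coeffs} (h : A.Nondegenerate L) :
    |A.c1| ≤ 2 * L ^ 2 ∧ |A.c2| ≤ 2 * L ^ 2 ∧ |A.c3| ≤ 2 * L ^ 2 := by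
  obtain ⟨h1, h2, h3, h4, h5, h6, -⟩ := h
  have hL : 0 ≤ L := (abs_nonneg _).trans h1
  have key {a b c d : ℝ} (ha : |a| ≤ L) (hb : |b| ≤ L) (hc : |c| ≤ L) (hd : |d| ≤ L) :
      |a * b - c * d| ≤ 2 * L ^ 2 := by
    refine (abs_sub _ _).trans ?_
    rw [abs_mul, abs_mul]
    have := mul_le_mul ha hb (abs_nonneg _) hL
    have := mul_le_mul hc hd (abs_nonneg _) hL
    linarith
  exact ⟨key h1 h5 h2 h4, key h1 h6 h3 h4, key h6 h2 h5 h3⟩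

/-- For a nondegenerate surface, the squares of side length `1 / K` that are not
`K^{-2}`-transverse to a given square lie in the union of two strips of `O(K)` squares each. -/
theorem exists_strips {L : ℝ} (hL : 0 < L) : ∃ C C' : ℕ, ∀ A : Coeffs, A.Nondegenerate L →
    ∀ m : ℕ, ∃ τ₁ τ₂ : Fin (2 ^ m) × Fin (2 ^ m) → ℤ,
      (∀ j, (strip τ₁ C j).card ≤ C' * 2 ^ m) ∧ (∀ j, (strip τ₂ C j).card ≤ C' * 2 ^ m) ∧
      ∀ q r, ¬ Transverse A (1 / ((2 : ℝ) ^ m) ^ 2) (dyadicSquare m q) (dyadicSquare m r) →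
        |τ₁ r - τ₁ q| ≤ C ∨ |τ₂ r - τ₂ q| ≤ C := by
  set M : ℝ := 3 * (2 * L ^ 2) with hM
  have hM0 : 0 < M := by positivity
  have hδ : 0 < L⁻¹ / 4 := by positivity
  set C := ⌈3 * M + 1⌉₊ with hC
  refine ⟨C + 1, ⌊(2 * (C + 1 : ℕ) + 1) / (L⁻¹ / 4)⌋₊ + 1, fun A hA m => ?_⟩
  obtain ⟨h1, h2, h3⟩ := hA.abs_minors_le
  obtain ⟨α₁, β₁, α₂, β₂, i1, i2, i3, i4, i5, i6, i7⟩ :=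
    exists_linear_factors (inv_pos.2 hL) h1 h2 h3 hA.2.2.2.2.2.2
  refine ⟨linearLabel α₁ β₁ m, linearLabel α₂ β₂ m,
    card_strip_linearLabel_le hδ i5 (C + 1) m, card_strip_linearLabel_le hδ i6 (C + 1) m,
    fun q r hqr => ?_⟩
  have hK : (0 : ℝ) < 2 ^ m := by positivity
  rw [Transverse] at hqr
  push Not at hqr
  obtain ⟨z, hz, w, hw, hlt⟩ := hqr
  have hprod := i7 (2 ^ m * (z.1 - w.1)) (2 ^ m * (z.2 - w.2))
  have e1 : |A.c1 * (2 ^ m * (z.1 - w.1)) ^ 2 + A.c2 * (2 ^ m * (z.1 - w.1)) *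
      (2 ^ m * (z.2 - w.2)) + A.c3 * (2 ^ m * (z.2 - w.2)) ^ 2| ≤ 1 := by
    rw [show A.c1 * (2 ^ m * (z.1 - w.1)) ^ 2 + A.c2 * (2 ^ m * (z.1 - w.1)) *
      (2 ^ m * (z.2 - w.2)) + A.c3 * (2 ^ m * (z.2 - w.2)) ^ 2 = (2 ^ m) ^ 2 *
      (A.c1 * (z.1 - w.1) ^ 2 + A.c2 * (z.1 - w.1) * (z.2 - w.2) + A.c3 * (z.2 - w.2) ^ 2) by ring,
      abs_mul, abs_of_pos (by positivity : (0 : ℝ) < (2 ^ m) ^ 2)]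
    rw [lt_div_iff₀ (by positivity)] at hlt
    linarith
  have e2 : |(α₁ * (2 ^ m * (z.1 - w.1)) + β₁ * (2 ^ m * (z.2 - w.2))) *
      (α₂ * (2 ^ m * (z.1 - w.1)) + β₂ * (2 ^ m * (z.2 - w.2)))| ≤ M :=
    hprod.trans (mul_le_of_le_one_right hM0.le e1)
  rw [abs_mul] at e2
  have hCM : 3 * M + 1 ≤ C := Nat.le_ceil _
  -- A product of modulus at most M cannot have both factors above M + 1.
  rcases le_or_gt |α₁ * (2 ^ m * (z.1 - w.1)) + β₁ * (2 ^ m * (z.2 - w.2))| (M + 1) with h | h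
  · left
    rw [abs_sub_comm]
    exact label_near_of_linear_form_small i1 i2 hz hw h hCM
  · right
    rw [abs_sub_comm]
    refine label_near_of_linear_form_small i3 i4 hz hw ?_ hCM
    have := abs_nonneg (α₂ * (2 ^ m * (z.1 - w.1)) + β₂ * (2 ^ m * (z.2 - w.2)))
    nlinarith

/-! ### Dyadic partitions and the trivial decoupling inequality. -/

theorem iUnion_dyadicSquare (m : ℕ) : ⋃ q, dyadicSquare m q = unitSquare := by
  refine Set.Subset.antisymm (Set.iUnion_subset (dyadicSquare_subset_unitSquare m))
    fun z hz => ?_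
  simp only [unitSquare, square, Set.mem_prod, Set.mem_Icc, zero_add] at hz
  have hK : 0 < 2 ^ m := by positivity
  have key (x : ℝ) (h0 : 0 ≤ x) (h1 : x ≤ 1) :
      ∃ i : Fin (2 ^ m), ((i : ℕ) : ℝ) ≤ 2 ^ m * x ∧ 2 ^ m * x ≤ (i : ℕ) + 1 := by
    rcases h1.eq_or_lt with rfl | h1
    -- The endpoint x = 1 belongs to the last closed interval; the floor would give an index out of
    -- range.
    · refine ⟨⟨2 ^ m - 1, by omega⟩, ?_⟩
      simp only [mul_one]
      rw [Nat.cast_sub hK]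
      push_cast
      constructor <;> linarith
    · have hx : 0 ≤ (2 : ℝ) ^ m * x := by positivity
      refine ⟨⟨⌊(2 : ℝ) ^ m * x⌋₊, ?_⟩, Nat.floor_le hx, (Nat.lt_floor_add_one _).le⟩
      rw [Nat.floor_lt hx]
      push_cast
      have : (0 : ℝ) < 2 ^ m := by positivity
      nlinarith
  obtain ⟨i, hi⟩ := key z.1 hz.1.1 hz.1.2
  obtain ⟨j, hj⟩ := key z.2 hz.2.1 hz.2.2
  exact Set.mem_iUnion.2 ⟨(i, j), mem_dyadicSquare_iff.2 ⟨hi.1, hi.2, hj.1, hj.2⟩⟩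

theorem volume_fst_eq (a : ℝ) : volume {z : ℝ × ℝ | z.1 = a} = 0 := by
  rw [show {z : ℝ × ℝ | z.1 = a} = {a} ×ˢ Set.univ by ext; simp, Measure.volume_eq_prod,
    Measure.prod_prod]
  simp

theorem volume_snd_eq (a : ℝ) : volume {z : ℝ × ℝ | z.2 = a} = 0 := by
  rw [show {z : ℝ × ℝ | z.2 = a} = Set.univ ×ˢ {a} by ext; simp, Measure.volume_eq_prod,
    Measure.prod_prod]
  simp

/-- The closed squares can share only boundary points: where two indices differ, the common
coordinate is forced to equal the larger index over 2^m, and the intersection lies on a line. -/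
theorem aedisjoint_dyadicSquare {m : ℕ} {q r : Fin (2 ^ m) × Fin (2 ^ m)} (h : q ≠ r) :
    AEDisjoint volume (dyadicSquare m q) (dyadicSquare m r) := by
  have hK : (0 : ℝ) < 2 ^ m := by positivity
  have key (i j : Fin (2 ^ m)) (x : ℝ) (hij : i ≠ j) (h1 : ((i : ℕ) : ℝ) ≤ 2 ^ m * x)
      (h2 : 2 ^ m * x ≤ (i : ℕ) + 1) (h3 : ((j : ℕ) : ℝ) ≤ 2 ^ m * x)
      (h4 : 2 ^ m * x ≤ (j : ℕ) + 1) : x = (max (i : ℕ) (j : ℕ) : ℕ) / 2 ^ m := by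
    rw [eq_div_iff hK.ne', mul_comm]
    rcases lt_or_gt_of_ne (fun h => hij (Fin.ext h) : (i : ℕ) ≠ j) with hlt | hlt
    · rw [max_eq_right hlt.le]
      have : ((i : ℕ) : ℝ) + 1 ≤ (j : ℕ) := by exact_mod_cast hlt
      linarith
    · rw [max_eq_left hlt.le]
      have : ((j : ℕ) : ℝ) + 1 ≤ (i : ℕ) := by exact_mod_cast hlt
      linarith
  by_cases h1 : q.1 = r.1
  · have h2 : q.2 ≠ r.2 := fun h2 => h (Prod.ext h1 h2)
    refine measure_mono_null (fun z hz => ?_)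
      (volume_snd_eq ((max (q.2 : ℕ) (r.2 : ℕ) : ℕ) / 2 ^ m))
    have hz1 := mem_dyadicSquare_iff.1 hz.1
    have hz2 := mem_dyadicSquare_iff.1 hz.2
    exact key _ _ _ h2 hz1.2.2.1 hz1.2.2.2 hz2.2.2.1 hz2.2.2.2
  · refine measure_mono_null (fun z hz => ?_)
      (volume_fst_eq ((max (q.1 : ℕ) (r.1 : ℕ) : ℕ) / 2 ^ m))
    have hz1 := mem_dyadicSquare_iff.1 hz.1
    have hz2 := mem_dyadicSquare_iff.1 hz.2
    exact key _ _ _ h1 hz1.1 hz1.2.1 hz2.1 hz2.2.1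

theorem extension_unitSquare_eq_sum {A : Coeffs} {g : ℝ × ℝ → ℂ} (hg : IntegrableOn g unitSquare)
    (m : ℕ) (x : EuclideanSpace ℝ (Fin 4)) :
    extension A unitSquare g x = ∑ q, extension A (dyadicSquare m q) g x := by
  have hi := integrableOn_mul_phase (A := A) hg x
  simp only [extension]
  rw [← iUnion_dyadicSquare m] at hi ⊢
  rw [integral_iUnion_ae (fun q => (measurableSet_dyadicSquare m q).nullMeasurableSet)
    (fun q r h => aedisjoint_dyadicSquare h) hi, tsum_fintype]

/-- The dyadic square of side `2⁻ᵐ` that contains a given dyadic square of side `2⁻ⁿ`. -/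
def dyadicParent {m n : ℕ} (h : m ≤ n) (q : Fin (2 ^ n) × Fin (2 ^ n)) :
    Fin (2 ^ m) × Fin (2 ^ m) :=
  have hdiv (i : Fin (2 ^ n)) : (i : ℕ) / 2 ^ (n - m) < 2 ^ m := by
    rw [Nat.div_lt_iff_lt_mul (by positivity), ← pow_add, Nat.add_sub_cancel' h]
    exact i.2
  (⟨(q.1 : ℕ) / 2 ^ (n - m), hdiv _⟩, ⟨(q.2 : ℕ) / 2 ^ (n - m), hdiv _⟩)

theorem dyadicSquare_subset_parent {m n : ℕ} (h : m ≤ n) (q : Fin (2 ^ n) × Fin (2 ^ n)) :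
    dyadicSquare n q ⊆ dyadicSquare m (dyadicParent h q) := by
  intro z hz
  rw [mem_dyadicSquare_iff] at hz ⊢
  have key (i : ℕ) (x : ℝ) (h1 : (i : ℝ) ≤ 2 ^ n * x) (h2 : 2 ^ n * x ≤ i + 1) :
      ((i / 2 ^ (n - m) : ℕ) : ℝ) ≤ 2 ^ m * x ∧ 2 ^ m * x ≤ ((i / 2 ^ (n - m) : ℕ) : ℝ) + 1 := by
    have hd : (0 : ℝ) < 2 ^ (n - m) := by positivity
    have hn : (2 : ℝ) ^ n = 2 ^ (n - m) * 2 ^ m := by rw [← pow_add, Nat.sub_add_cancel h]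
    rw [hn, mul_assoc] at h1 h2
    have h3 : (2 : ℝ) ^ (n - m) * ((i / 2 ^ (n - m) : ℕ) : ℝ) ≤ i := by
      exact_mod_cast Nat.mul_div_le i (2 ^ (n - m))
    have h4 : (i : ℝ) + 1 ≤ 2 ^ (n - m) * (((i / 2 ^ (n - m) : ℕ) : ℝ) + 1) := by
      exact_mod_cast Nat.lt_mul_div_succ i (by positivity)
    exact ⟨le_of_mul_le_mul_left (h3.trans h1) hd, le_of_mul_le_mul_left (h2.trans h4) hd⟩
  obtain ⟨a1, a2⟩ := key _ _ hz.1 hz.2.1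
  obtain ⟨b1, b2⟩ := key _ _ hz.2.2.1 hz.2.2.2
  exact ⟨a1, a2, b1, b2⟩

theorem extension_indicator_of_subset (A : Coeffs) {S T : Set (ℝ × ℝ)} (g : ℝ × ℝ → ℂ)
    (hS : MeasurableSet S) (h : S ⊆ T) : extension A S (T.indicator g) = extension A S g := by
  ext x
  refine setIntegral_congr_fun hS fun z hz => ?_
  rw [Set.indicator_of_mem (h hz)]

theorem extension_indicator_of_aedisjoint (A : Coeffs) {S T : Set (ℝ × ℝ)} (g : ℝ × ℝ → ℂ)
    (h : AEDisjoint volume S T) :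
    extension A S (T.indicator g) = 0 := by
  ext x
  refine setIntegral_eq_zero_of_ae_eq_zero ?_
  have h0 : ∀ᵐ z, z ∉ S ∩ T := measure_eq_zero_iff_ae_notMem.1 h
  filter_upwards [h0] with z hz hzS
  rw [Set.indicator_of_notMem fun hzT => hz ⟨hzS, hzT⟩, zero_mul]

theorem wNorm_zero {p : ℝ} (c : EuclideanSpace ℝ (Fin 4)) (R : ℝ) :
    wNorm p c R (0 : EuclideanSpace ℝ (Fin 4) → ℂ) = 0 := by
  simp [wNorm]

/-- Localising to coarser dyadic squares distributes the small pieces among them. -/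
theorem sum_pieceSum_indicator (A : Coeffs) {p : ℝ} (hp : 0 < p) {m n : ℕ} (h : m ≤ n)
    (c : EuclideanSpace ℝ (Fin 4)) (R : ℝ) (g : ℝ × ℝ → ℂ) :
    ∑ q, pieceSum A p n c R ((dyadicSquare m q).indicator g) = pieceSum A p n c R g := by
  simp only [pieceSum]
  rw [Finset.sum_comm]
  refine Finset.sum_congr rfl fun d _ => ?_
  rw [Finset.sum_eq_single (dyadicParent h d)]
  · rw [extension_indicator_of_subset A g (measurableSet_dyadicSquare n d)
      (dyadicSquare_subset_parent h d)]
  · intro q _ hq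
    rw [extension_indicator_of_aedisjoint A g ((aedisjoint_dyadicSquare hq.symm).mono
      (dyadicSquare_subset_parent h d) subset_rfl), wNorm_zero,
      ENNReal.zero_rpow_of_pos hp]
  · exact fun hq => absurd (Finset.mem_univ _) hq

theorem enorm_sum_rpow_le {ι : Type*} (s : Finset ι) (f : ι → ℂ) {p : ℝ} (hp : 1 ≤ p) :
    ‖∑ i ∈ s, f i‖ₑ ^ p ≤ (s.card : ℝ≥0∞) ^ (p - 1) * ∑ i ∈ s, ‖f i‖ₑ ^ p :=
  (ENNReal.rpow_le_rpow (enorm_sum_le _ _) (by linarith)).trans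
    (ENNReal.rpow_sum_le_const_mul_sum_rpow s _ hp)

theorem measurable_weighted {f : EuclideanSpace ℝ (Fin 4) → ℂ} (hf : Continuous f) (p : ℝ)
    {R : ℝ} (hR : 0 < R) (c : EuclideanSpace ℝ (Fin 4)) :
    Measurable fun x => ‖f x‖ₑ ^ p * ENNReal.ofReal (ballWeight c R x) :=
  (hf.enorm.measurable.pow_const p).mul (measurable_ballWeight hR c)

/-- The trivial decoupling inequality. -/
theorem wNorm_extension_rpow_le_pieceSum {A : Coeffs} {p : ℝ} (hp : 1 ≤ p)
    {g : ℝ × ℝ → ℂ} (hg : IntegrableOn g unitSquare) (n : ℕ) (c : EuclideanSpace ℝ (Fin 4))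
    {R : ℝ} (hR : 0 < R) :
    wNorm p c R (extension A unitSquare g) ^ p ≤
      ((4 ^ n : ℕ) : ℝ≥0∞) ^ (p - 1) * pieceSum A p n c R g := by
  have hp0 : 0 < p := by linarith
  have hf (q) : Continuous (extension A (dyadicSquare n q) g) :=
    continuous_extension (hg.mono_set (dyadicSquare_subset_unitSquare n q))
  simp only [pieceSum]
  simp_rw [wNorm_rpow hp0 c hR]
  rw [← lintegral_finsetSum _ fun q _ => measurable_weighted (hf q) p hR c,
    ← lintegral_const_mul _ (Finset.measurable_fun_sum _ fun q _ =>
      measurable_weighted (hf q) p hR c)]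
  refine lintegral_mono fun x => ?_
  rw [← Finset.sum_mul, ← mul_assoc]
  refine mul_le_mul_left ?_ _
  rw [extension_unitSquare_eq_sum hg n]
  refine (enorm_sum_rpow_le _ _ hp).trans_eq ?_
  simp only [Finset.card_univ, Fintype.card_prod, Fintype.card_fin]
  norm_num [← mul_pow]

theorem wNorm_rpow_lt_top {A : Coeffs} {p : ℝ} (hp : 0 < p) {S : Set (ℝ × ℝ)} (g : ℝ × ℝ → ℂ)
    (c : EuclideanSpace ℝ (Fin 4)) {R : ℝ} (hR : 0 < R) :
    wNorm p c R (extension A S g) ^ p < ∞ := by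
  rw [wNorm_rpow hp c hR]
  calc _ ≤ ∫⁻ x, ENNReal.ofReal (∫ z in S, ‖g z‖) ^ p * ENNReal.ofReal (ballWeight c R x) := by
        refine lintegral_mono fun x => ?_
        refine mul_le_mul_left (ENNReal.rpow_le_rpow ?_ hp.le) _
        rw [← ofReal_norm]
        exact ENNReal.ofReal_le_ofReal (norm_extension_le x)
    _ = ENNReal.ofReal (∫ z in S, ‖g z‖) ^ p * ∫⁻ x, ENNReal.ofReal (ballWeight c R x) :=
        lintegral_const_mul _ (measurable_ballWeight hR c)
    _ < ∞ := ENNReal.mul_lt_top (ENNReal.rpow_lt_top_of_nonneg hp.le ENNReal.ofReal_ne_top)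
        (lintegral_ballWeight_lt_top hR c)

theorem pieceSum_lt_top (A : Coeffs) {p : ℝ} (hp : 0 < p) (n : ℕ) (g : ℝ × ℝ → ℂ)
    (c : EuclideanSpace ℝ (Fin 4)) {R : ℝ} (hR : 0 < R) : pieceSum A p n c R g < ∞ :=
  ENNReal.sum_lt_top.2 fun _ _ => wNorm_rpow_lt_top hp g c hR

theorem extension_eq_of_support_subset (A : Coeffs) {S T : Set (ℝ × ℝ)} {g : ℝ × ℝ → ℂ}
    (hT : MeasurableSet T) (h : S ⊆ T) (hg : Function.support g ⊆ S) :
    extension A S g = extension A T g := by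
  ext x
  refine (setIntegral_eq_of_subset_of_forall_sdiff_eq_zero hT h fun z hz => ?_).symm
  rw [Function.notMem_support.1 fun hz' => hz.2 (hg hz'), zero_mul]

/-! ### Admissibility of the bilinear constant. -/

theorem ae_extension_eq_zero_of_pieceSum_eq_zero {A : Coeffs} {p : ℝ} (hp : 1 ≤ p)
    {g : ℝ × ℝ → ℂ} (hg : IntegrableOn g unitSquare) {n : ℕ} {c : EuclideanSpace ℝ (Fin 4)}
    {R : ℝ} (hR : 0 < R) (h : pieceSum A p n c R g = 0) :
    ∀ᵐ x, extension A unitSquare g x = 0 := by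
  have hp0 : 0 < p := by linarith
  have h1 := wNorm_extension_rpow_le_pieceSum (A := A) hp hg n c hR
  rw [h, mul_zero, nonpos_iff_eq_zero, wNorm_rpow hp0 c hR,
    lintegral_eq_zero_iff (measurable_weighted (continuous_extension hg) p hR c)] at h1
  filter_upwards [h1] with x hx
  simp only [Pi.zero_apply, mul_eq_zero, ENNReal.ofReal_eq_zero, not_le.2 (ballWeight_pos hR c x),
    or_false] at hx
  rw [ENNReal.rpow_eq_zero_iff_of_pos hp0] at hx
  simpa using hx

/-- The bilinear decoupling constant is itself admissible. -/
theorem wNorm_mul_le_Dmulti {A : Coeffs} {p : ℝ} (hp : 1 ≤ p) {n : ℕ} {ν : ℝ}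
    {a₁ b₁ l₁ a₂ b₂ l₂ : ℝ} (hl₁ : 0 < l₁) (hl₂ : 0 < l₂)
    (h₁ : square a₁ b₁ l₁ ⊆ unitSquare) (h₂ : square a₂ b₂ l₂ ⊆ unitSquare)
    (ht : Transverse A ν (square a₁ b₁ l₁) (square a₂ b₂ l₂)) {g₁ g₂ : ℝ × ℝ → ℂ}
    (hg₁ : Integrable g₁) (hg₂ : Integrable g₂) (hs₁ : Function.support g₁ ⊆ square a₁ b₁ l₁)
    (hs₂ : Function.support g₂ ⊆ square a₂ b₂ l₂) (c : EuclideanSpace ℝ (Fin 4)) :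
    wNorm p c (4 ^ n) (fun x => ‖extension A (square a₁ b₁ l₁) g₁ x *
        extension A (square a₂ b₂ l₂) g₂ x‖ ^ (1 / 2 : ℝ)) ≤
      Dmulti A n p ν * (pieceSum A p n c (4 ^ n) g₁ * pieceSum A p n c (4 ^ n) g₂) ^
        (1 / (2 * p)) := by
  have hp0 : 0 < p := by linarith
  have hR : (0 : ℝ) < 4 ^ n := by positivity
  set X := (pieceSum A p n c (4 ^ n) g₁ * pieceSum A p n c (4 ^ n) g₂) ^ (1 / (2 * p)) with hX
  have hXtop : X ≠ ∞ := ENNReal.rpow_ne_top_of_nonneg (by positivity)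
    (ENNReal.mul_lt_top (pieceSum_lt_top A hp0 n g₁ c hR) (pieceSum_lt_top A hp0 n g₂ c hR)).ne
  -- If the right-hand factor is zero one cannot divide by it, and an infinite constant times zero
  -- would not help. In that case one extension vanishes almost everywhere by the trivial
  -- decoupling, so the left side is zero.
  by_cases hX0 : X = 0
  · have hprod : ∀ᵐ x, extension A (square a₁ b₁ l₁) g₁ x *
        extension A (square a₂ b₂ l₂) g₂ x = 0 := by
      rw [hX, ENNReal.rpow_eq_zero_iff_of_pos (by positivity), mul_eq_zero] at hX0
      rw [extension_eq_of_support_subset A (measurableSet_square 0 0 1) h₁ hs₁,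
        extension_eq_of_support_subset A (measurableSet_square 0 0 1) h₂ hs₂]
      rcases hX0 with h | h
      · filter_upwards [ae_extension_eq_zero_of_pieceSum_eq_zero hp hg₁.integrableOn hR h] with x hx
        exact mul_eq_zero_of_left hx _
      · filter_upwards [ae_extension_eq_zero_of_pieceSum_eq_zero hp hg₂.integrableOn hR h] with x hx
        exact mul_eq_zero_of_right _ hx
    have h0 : wNorm p c (4 ^ n) (fun x => ‖extension A (square a₁ b₁ l₁) g₁ x *
        extension A (square a₂ b₂ l₂) g₂ x‖ ^ (1 / 2 : ℝ)) = 0 := by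
      refine eLpNorm_eq_zero_of_ae_zero ?_
      refine (withDensity_absolutelyContinuous volume _).ae_le ?_
      filter_upwards [hprod] with x hx
      rw [hx]
      simp
    rw [h0]
    exact zero_le
  · rw [← ENNReal.div_le_iff hX0 hXtop]
    refine le_sInf fun D hD => ?_
    rw [ENNReal.div_le_iff hX0 hXtop]
    exact hD a₁ b₁ l₁ a₂ b₂ l₂ hl₁ hl₂ h₁ h₂ ht g₁ g₂ hg₁ hg₂ hs₁ hs₂ c

/-! ### The broad-narrow argument. -/

/-- The broad-narrow dichotomy: a sum over `K²` terms is controlled either by a transverse pair or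
by the terms near the largest one. -/
theorem broad_narrow {Q : Type*} [Fintype Q] [Nonempty Q] [DecidableEq Q] (f : Q → ℂ) {K : ℝ}
    (hK : 0 < K) (hcard : (Fintype.card Q : ℝ) = K ^ 2) (near : Q → Finset Q) :
    ∃ q, (∃ r, r ∉ near q ∧ ‖∑ i, f i‖ ≤ K ^ 3 * ‖f q * f r‖ ^ (1 / 2 : ℝ)) ∨
      ‖∑ i, f i‖ ≤ ‖∑ i ∈ near q, f i‖ + ‖f q‖ := by
  obtain ⟨q, hq⟩ := Finite.exists_max fun i => ‖f i‖
  refine ⟨q, ?_⟩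
  have hK2 : 0 < K ^ 2 := by positivity
  -- The threshold K^{-2} is one over the number of terms: if it fails for every r outside the
  -- neighbourhood, those terms add up to at most |f_q|.
  by_cases h : ∃ r, r ∉ near q ∧ ‖f q‖ ≤ K ^ 2 * ‖f r‖
  · obtain ⟨r, hr, hle⟩ := h
    refine Or.inl ⟨r, hr, ?_⟩
    have h1 : ‖∑ i, f i‖ ≤ K ^ 2 * ‖f q‖ := by
      refine (norm_sum_le _ _).trans ((Finset.sum_le_sum fun i _ => hq i).trans_eq ?_)
      rw [Finset.sum_const, nsmul_eq_mul, Finset.card_univ, hcard]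
    have h2 : ‖f q‖ ≤ K * ‖f q * f r‖ ^ (1 / 2 : ℝ) := by
      rw [← Real.sqrt_eq_rpow, norm_mul]
      refine le_of_sq_le_sq ?_ (by positivity)
      rw [mul_pow, Real.sq_sqrt (by positivity)]
      nlinarith [norm_nonneg (f q)]
    calc _ ≤ K ^ 2 * ‖f q‖ := h1
      _ ≤ K ^ 2 * (K * ‖f q * f r‖ ^ (1 / 2 : ℝ)) := by gcongr
      _ = _ := by ring
  · push Not at h
    refine Or.inr ?_
    rw [← Finset.sum_add_sum_compl (near q) f]
    refine (norm_add_le _ _).trans (add_le_add le_rfl ?_)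
    have h1 : ∀ i ∈ (near q)ᶜ, ‖f i‖ ≤ ‖f q‖ / K ^ 2 := fun i hi => by
      rw [le_div_iff₀ hK2, mul_comm]
      exact (h i (Finset.mem_compl.1 hi)).le
    calc ‖∑ i ∈ (near q)ᶜ, f i‖ ≤ ∑ i ∈ (near q)ᶜ, ‖f q‖ / K ^ 2 :=
          (norm_sum_le _ _).trans (Finset.sum_le_sum h1)
      _ ≤ ∑ _i : Q, ‖f q‖ / K ^ 2 :=
          Finset.sum_le_sum_of_subset_of_nonneg (Finset.subset_univ _) fun _ _ _ => by positivity
      _ = ‖f q‖ := by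
          rw [Finset.sum_const, nsmul_eq_mul, Finset.card_univ, hcard]
          field_simp

/-- A square belongs to the strip of j only when j is within C of its label, so to at most 2C + 1
strips. This bounded overlap allows the strip selected at each x to be replaced by the sum over all
strips. -/
theorem sum_sum_strip_le {m : ℕ} (τ : Fin (2 ^ m) × Fin (2 ^ m) → ℤ) (C : ℕ) (J : Finset ℤ)
    (v : Fin (2 ^ m) × Fin (2 ^ m) → ℝ≥0∞) :
    ∑ j ∈ J, ∑ q ∈ strip τ C j, v q ≤ (2 * C + 1 : ℕ) * ∑ q, v q := by
  calc _ = ∑ j ∈ J, ∑ q, (if |τ q - j| ≤ C then v q else 0) := by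
        refine Finset.sum_congr rfl fun j _ => ?_
        rw [strip, Finset.sum_filter]
    _ = ∑ q, ∑ j ∈ J, (if |τ q - j| ≤ C then v q else 0) := Finset.sum_comm
    _ ≤ ∑ q, (2 * C + 1 : ℕ) * v q := by
        refine Finset.sum_le_sum fun q _ => ?_
        rw [← Finset.sum_filter, Finset.sum_const, nsmul_eq_mul]
        refine mul_le_mul_left ?_ _
        have : (J.filter fun j => |τ q - j| ≤ C) ⊆ Finset.Icc (τ q - C) (τ q + C) := by
          intro j hj
          have := abs_le.1 (Finset.mem_filter.1 hj).2
          rw [Finset.mem_Icc]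
          constructor <;> linarith
        have h2 := Finset.card_le_card this
        rw [Int.card_Icc] at h2
        exact_mod_cast h2.trans (by omega)
    _ = _ := (Finset.mul_sum _ _ _).symm

theorem sum_sum_strip_inter_le {m : ℕ} (τ₁ τ₂ : Fin (2 ^ m) × Fin (2 ^ m) → ℤ) (C : ℕ)
    (J₁ J₂ : Finset ℤ) (v : Fin (2 ^ m) × Fin (2 ^ m) → ℝ≥0∞) :
    ∑ j ∈ J₁, ∑ k ∈ J₂, ∑ q ∈ strip τ₁ C j ∩ strip τ₂ C k, v q ≤
      (2 * C + 1 : ℕ) * ((2 * C + 1 : ℕ) * ∑ q, v q) := by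
  calc _ = ∑ j ∈ J₁, ∑ k ∈ J₂, ∑ q ∈ strip τ₂ C k, (if |τ₁ q - j| ≤ C then v q else 0) := by
        refine Finset.sum_congr rfl fun j _ => Finset.sum_congr rfl fun k _ => ?_
        rw [← Finset.sum_filter]
        congr 1
        ext q
        rw [Finset.mem_inter, Finset.mem_filter, mem_strip, and_comm]
    -- The overlap bound is applied to the second family with v cut off to a strip of the first.
    _ ≤ ∑ j ∈ J₁, (2 * C + 1 : ℕ) * ∑ q, (if |τ₁ q - j| ≤ C then v q else 0) :=
        Finset.sum_le_sum fun j _ => sum_sum_strip_le τ₂ C J₂ _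
    _ = (2 * C + 1 : ℕ) * ∑ j ∈ J₁, ∑ q ∈ strip τ₁ C j, v q := by
        rw [← Finset.mul_sum]
        congr 1
        refine Finset.sum_congr rfl fun j _ => ?_
        rw [strip, Finset.sum_filter]
    _ ≤ _ := mul_le_mul_right (sum_sum_strip_le τ₁ C J₁ v) _

open Classical in
/-- The pointwise inequality behind the broad-narrow analysis. -/
theorem enorm_sum_rpow_le_broad_narrow {m : ℕ} {p : ℝ} (hp : 1 ≤ p)
    (f : Fin (2 ^ m) × Fin (2 ^ m) → ℂ) (τ₁ τ₂ : Fin (2 ^ m) × Fin (2 ^ m) → ℤ) (C : ℕ)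
    (tr : Fin (2 ^ m) × Fin (2 ^ m) → Fin (2 ^ m) × Fin (2 ^ m) → Prop)
    (htr : ∀ q r, ¬ tr q r → |τ₁ r - τ₁ q| ≤ C ∨ |τ₂ r - τ₂ q| ≤ C) :
    ‖∑ q, f q‖ₑ ^ p ≤ (4 : ℝ≥0∞) ^ (p - 1) *
      (∑ j ∈ Finset.univ.image τ₁, ‖∑ q ∈ strip τ₁ C j, f q‖ₑ ^ p +
        ∑ k ∈ Finset.univ.image τ₂, ‖∑ q ∈ strip τ₂ C k, f q‖ₑ ^ p +
        ∑ j ∈ Finset.univ.image τ₁, ∑ k ∈ Finset.univ.image τ₂,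
          ‖∑ q ∈ strip τ₁ C j ∩ strip τ₂ C k, f q‖ₑ ^ p +
        ∑ q, ‖f q‖ₑ ^ p) +
      (2 ^ m : ℝ≥0∞) ^ (3 * p) * ∑ q, ∑ r,
        (if tr q r then ‖‖f q * f r‖ ^ (1 / 2 : ℝ)‖ₑ ^ p else 0) := by
  have hp0 : 0 < p := by linarith
  obtain ⟨q, h⟩ := broad_narrow f (K := 2 ^ m) (by positivity)
    (by simp [Fintype.card_prod]; ring) fun q => strip τ₁ C (τ₁ q) ∪ strip τ₂ C (τ₂ q)
  rcases h with ⟨r, hr, hle⟩ | hle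
  · refine le_add_left ?_
    have htqr : tr q r := by
      by_contra hn
      refine hr (Finset.mem_union.2 ?_)
      rw [mem_strip, mem_strip]
      exact htr q r hn
    have h1 : ‖∑ i, f i‖ₑ ≤ (2 ^ m : ℝ≥0∞) ^ 3 * ‖‖f q * f r‖ ^ (1 / 2 : ℝ)‖ₑ := by
      rw [← ofReal_norm, ← ofReal_norm, Real.norm_of_nonneg (by positivity :
        0 ≤ ‖f q * f r‖ ^ (1 / 2 : ℝ))]
      refine (ENNReal.ofReal_le_ofReal hle).trans_eq ?_
      rw [ENNReal.ofReal_mul (by positivity), ENNReal.ofReal_pow (by positivity),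
        ENNReal.ofReal_pow (by positivity), ENNReal.ofReal_ofNat]
    calc _ ≤ ((2 ^ m : ℝ≥0∞) ^ 3 * ‖‖f q * f r‖ ^ (1 / 2 : ℝ)‖ₑ) ^ p :=
          ENNReal.rpow_le_rpow h1 hp0.le
      _ = (2 ^ m : ℝ≥0∞) ^ (3 * p) *
          (if tr q r then ‖‖f q * f r‖ ^ (1 / 2 : ℝ)‖ₑ ^ p else 0) := by
          rw [ENNReal.mul_rpow_of_nonneg _ _ hp0.le, if_pos htqr, ENNReal.rpow_mul]
          congr 2
          exact_mod_cast (ENNReal.rpow_natCast ((2 : ℝ≥0∞) ^ m) 3).symm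
      _ ≤ _ := by
          gcongr
          refine le_trans ?_ (Finset.single_le_sum (f := fun q => ∑ r,
            (if tr q r then ‖‖f q * f r‖ ^ (1 / 2 : ℝ)‖ₑ ^ p else 0)) (fun _ _ => zero_le)
            (Finset.mem_univ q))
          exact Finset.single_le_sum (f := fun r =>
            (if tr q r then ‖‖f q * f r‖ ^ (1 / 2 : ℝ)‖ₑ ^ p else 0)) (fun _ _ => zero_le)
            (Finset.mem_univ r)
  · refine le_add_right ?_
    -- Inclusion-exclusion for the union of the two strips, followed by the maximal term itself:
    -- four terms, whence the factor 4^{p-1}.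
    set F := ![∑ i ∈ strip τ₁ C (τ₁ q), f i, ∑ i ∈ strip τ₂ C (τ₂ q), f i,
      ∑ i ∈ strip τ₁ C (τ₁ q) ∩ strip τ₂ C (τ₂ q), f i, f q] with hF
    have h1 : ‖∑ i, f i‖ₑ ≤ ∑ i, ‖F i‖ₑ := by
      have h2 : ‖∑ i, f i‖ ≤ ∑ i, ‖F i‖ := by
        refine hle.trans ?_
        have h3 : ∑ i ∈ strip τ₁ C (τ₁ q) ∪ strip τ₂ C (τ₂ q), f i = F 0 + F 1 - F 2 := by
          rw [eq_sub_iff_add_eq]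
          exact Finset.sum_union_inter
        rw [h3, Fin.sum_univ_four]
        exact add_le_add ((norm_sub_le _ _).trans (add_le_add (norm_add_le _ _) le_rfl)) le_rfl
      rw [← ofReal_norm]
      refine (ENNReal.ofReal_le_ofReal h2).trans_eq ?_
      rw [ENNReal.ofReal_sum_of_nonneg fun i _ => norm_nonneg _]
      simp_rw [ofReal_norm]
    calc _ ≤ (∑ i, ‖F i‖ₑ) ^ p := ENNReal.rpow_le_rpow h1 hp0.le
      _ ≤ (4 : ℝ≥0∞) ^ (p - 1) * ∑ i, ‖F i‖ₑ ^ p := by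
          simpa using ENNReal.rpow_sum_le_const_mul_sum_rpow Finset.univ (fun i => ‖F i‖ₑ) hp
      _ ≤ _ := by
          gcongr
          have m1 : τ₁ q ∈ Finset.univ.image τ₁ := Finset.mem_image_of_mem _ (Finset.mem_univ q)
          have m2 : τ₂ q ∈ Finset.univ.image τ₂ := Finset.mem_image_of_mem _ (Finset.mem_univ q)
          rw [Fin.sum_univ_four]
          refine add_le_add (add_le_add (add_le_add ?_ ?_) ?_) ?_
          · exact Finset.single_le_sum (f := fun j => ‖∑ q ∈ strip τ₁ C j, f q‖ₑ ^ p)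
              (fun _ _ => zero_le) m1
          · exact Finset.single_le_sum (f := fun k => ‖∑ q ∈ strip τ₂ C k, f q‖ₑ ^ p)
              (fun _ _ => zero_le) m2
          · refine le_trans ?_ (Finset.single_le_sum (f := fun j => ∑ k ∈ Finset.univ.image τ₂,
              ‖∑ q ∈ strip τ₁ C j ∩ strip τ₂ C k, f q‖ₑ ^ p) (fun _ _ => zero_le) m1)
            exact Finset.single_le_sum (f := fun k =>
              ‖∑ q ∈ strip τ₁ C (τ₁ q) ∩ strip τ₂ C k, f q‖ₑ ^ p) (fun _ _ => zero_le) m2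
          · exact Finset.single_le_sum (f := fun q => ‖f q‖ₑ ^ p) (fun _ _ => zero_le)
              (Finset.mem_univ q)

/-- The crude bound (ab)^{1/2} ≤ a + b is enough: over all pairs of squares it costs a factor O(K²),
for which K^{4p} leaves room. -/
theorem sum_strip_pairs_le {ι : Type*} (s : Finset ι) (P : ι → ℝ≥0∞) :
    ∑ q ∈ s, ∑ r ∈ s, (P q * P r) ^ (1 / 2 : ℝ) ≤ 2 * s.card * ∑ q ∈ s, P q := by
  have h (a b : ℝ≥0∞) : (a * b) ^ (1 / 2 : ℝ) ≤ a + b := by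
    have h1 : a * b ≤ (a + b) ^ (2 : ℝ) := by
      rw [ENNReal.rpow_two, sq]
      exact mul_le_mul' le_self_add le_add_self
    refine (ENNReal.rpow_le_rpow h1 (by norm_num)).trans_eq ?_
    rw [← ENNReal.rpow_mul]
    norm_num
  calc _ ≤ ∑ q ∈ s, ∑ r ∈ s, (P q + P r) :=
        Finset.sum_le_sum fun q _ => Finset.sum_le_sum fun r _ => h _ _
    _ = _ := by
        simp_rw [Finset.sum_add_distrib, Finset.sum_const, nsmul_eq_mul]
        rw [← Finset.mul_sum]
        ring

theorem wNorm_rpow_eq_lintegral {F : Type*} [NormedAddCommGroup F] {p : ℝ} (hp : 0 < p)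
    (c : EuclideanSpace ℝ (Fin 4)) (R : ℝ) (f : EuclideanSpace ℝ (Fin 4) → F) :
    wNorm p c R f ^ p =
      ∫⁻ x, ‖f x‖ₑ ^ p ∂(volume.withDensity fun x => ENNReal.ofReal (ballWeight c R x)) := by
  have h0 : ENNReal.ofReal p ≠ 0 := by simpa using hp
  rw [wNorm, eLpNorm_eq_lintegral_rpow_enorm_toReal h0 ENNReal.ofReal_ne_top,
    ENNReal.toReal_ofReal hp.le, ← ENNReal.rpow_mul, one_div_mul_cancel hp.ne', ENNReal.rpow_one]

/-- The contribution of a transverse pair of dyadic squares. -/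
theorem wNorm_transverse_pair_le {A : Coeffs} {p : ℝ} (hp : 1 ≤ p) {m n : ℕ} {ν : ℝ}
    {q r : Fin (2 ^ m) × Fin (2 ^ m)} (ht : Transverse A ν (dyadicSquare m q) (dyadicSquare m r))
    {g : ℝ × ℝ → ℂ} (hg : IntegrableOn g unitSquare) (c : EuclideanSpace ℝ (Fin 4)) :
    wNorm p c (4 ^ n) (fun x => ‖extension A (dyadicSquare m q) g x *
        extension A (dyadicSquare m r) g x‖ ^ (1 / 2 : ℝ)) ^ p ≤
      Dmulti A n p ν ^ p * (pieceSum A p n c (4 ^ n) ((dyadicSquare m q).indicator g) *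
        pieceSum A p n c (4 ^ n) ((dyadicSquare m r).indicator g)) ^ (1 / 2 : ℝ) := by
  have hp0 : 0 < p := by linarith
  have hl : (0 : ℝ) < 1 / 2 ^ m := by positivity
  have hi (q : Fin (2 ^ m) × Fin (2 ^ m)) : Integrable ((dyadicSquare m q).indicator g) :=
    (integrable_indicator_iff (measurableSet_dyadicSquare m q)).2
      (hg.mono_set (dyadicSquare_subset_unitSquare m q))
  have h := wNorm_mul_le_Dmulti (A := A) (n := n) hp hl hl (dyadicSquare_subset_unitSquare m q)
    (dyadicSquare_subset_unitSquare m r) ht (hi q) (hi r) Set.support_indicator_subset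
    Set.support_indicator_subset c
  change wNorm p c (4 ^ n) (fun x => ‖extension A (dyadicSquare m q)
    ((dyadicSquare m q).indicator g) x * extension A (dyadicSquare m r)
    ((dyadicSquare m r).indicator g) x‖ ^ (1 / 2 : ℝ)) ≤ _ at h
  rw [extension_indicator_of_subset A g (measurableSet_dyadicSquare m q) subset_rfl,
    extension_indicator_of_subset A g (measurableSet_dyadicSquare m r) subset_rfl] at h
  refine (ENNReal.rpow_le_rpow h hp0.le).trans_eq ?_
  rw [ENNReal.mul_rpow_of_nonneg _ _ hp0.le, ← ENNReal.rpow_mul]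
  congr 2
  field_simp

theorem lintegral_linear_combination {α : Type*} [MeasurableSpace α] (μ : Measure α)
    {f₁ f₂ f₃ f₄ f₅ : α → ℝ≥0∞} (h₁ : Measurable f₁) (h₂ : Measurable f₂) (h₃ : Measurable f₃)
    (h₄ : Measurable f₄) (h₅ : Measurable f₅) (a b : ℝ≥0∞) :
    ∫⁻ x, a * (f₁ x + f₂ x + f₃ x + f₄ x) + b * f₅ x ∂μ =
      a * (∫⁻ x, f₁ x ∂μ + ∫⁻ x, f₂ x ∂μ + ∫⁻ x, f₃ x ∂μ + ∫⁻ x, f₄ x ∂μ) +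
        b * ∫⁻ x, f₅ x ∂μ := by
  have h : Measurable fun x => f₁ x + f₂ x + f₃ x + f₄ x := ((h₁.add h₂).add h₃).add h₄
  rw [lintegral_add_right _ (h₅.const_mul _), lintegral_const_mul _ h₅, lintegral_const_mul _ h,
    lintegral_add_right _ h₄, lintegral_add_right _ h₃, lintegral_add_right _ h₂]

theorem card_rpow_le {m C' : ℕ} {s : Finset (Fin (2 ^ m) × Fin (2 ^ m))}
    (hs : s.card ≤ C' * 2 ^ m) {t : ℝ} (ht : 0 ≤ t) :
    (s.card : ℝ≥0∞) ^ t ≤ (C' : ℝ≥0∞) ^ t * (2 ^ m : ℝ≥0∞) ^ t := by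
  rw [← ENNReal.mul_rpow_of_nonneg _ _ ht]
  refine ENNReal.rpow_le_rpow ?_ ht
  exact_mod_cast hs

/-- The broad-narrow inequality when the small squares are finer than the large ones. -/
theorem exists_multilinear_bound_of_le {p : ℝ} (hp : 2 ≤ p) {L : ℝ} (hL : 0 < L) : ∃ C : ℝ≥0,
    ∀ A : Coeffs, A.Nondegenerate L → ∀ m n : ℕ, m ≤ n → ∀ g : ℝ × ℝ → ℂ,
      IntegrableOn g unitSquare → ∀ c : EuclideanSpace ℝ (Fin 4),
      wNorm p c (4 ^ n) (extension A unitSquare g) ^ p ≤ (C : ℝ≥0∞) *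
        ((2 ^ m : ℝ≥0∞) ^ (p - 2) * pieceSum A p m c (4 ^ n) g +
          (2 ^ m : ℝ≥0∞) ^ (4 * p) * Dmulti A n p (1 / ((2 : ℝ) ^ m) ^ 2) ^ p *
            pieceSum A p n c (4 ^ n) g) := by
  classical
  obtain ⟨C, C', hstrips⟩ := exists_strips hL
  obtain ⟨C₀, hflat⟩ := exists_flat_decoupling hp
  have hp0 : 0 < p := by linarith
  have hp1 : 1 ≤ p := by linarith
  have hp2 : 0 ≤ p - 2 := by linarith
  set c₁ : ℝ≥0∞ := ((2 * C + 1 : ℕ) : ℝ≥0∞) with hc₁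
  set B : ℝ≥0∞ := C₀ * (C' : ℝ≥0∞) ^ (p - 2) with hB
  set M : ℝ≥0∞ := (4 : ℝ≥0∞) ^ (p - 1) * (B * c₁ + B * c₁ + B * (c₁ * c₁) + 1) + 2 with hM
  have hBtop : B ≠ ∞ := ENNReal.mul_ne_top ENNReal.coe_ne_top
    (ENNReal.rpow_ne_top_of_nonneg hp2 (ENNReal.natCast_ne_top _))
  have hc₁top : c₁ ≠ ∞ := ENNReal.natCast_ne_top _
  have hMtop : M ≠ ∞ := by
    refine ENNReal.add_ne_top.2 ⟨ENNReal.mul_ne_top (ENNReal.rpow_ne_top_of_nonneg (by linarith)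
      (by norm_num)) ?_, by norm_num⟩
    simp only [ne_eq, ENNReal.add_eq_top, not_or]
    exact ⟨⟨⟨ENNReal.mul_ne_top hBtop hc₁top, ENNReal.mul_ne_top hBtop hc₁top⟩,
      ENNReal.mul_ne_top hBtop (ENNReal.mul_ne_top hc₁top hc₁top)⟩, ENNReal.one_ne_top⟩
  refine ⟨M.toNNReal, fun A hA m n hmn g hg c => ?_⟩
  rw [ENNReal.coe_toNNReal hMtop]
  obtain ⟨τ₁, τ₂, hcard₁, hcard₂, hnear⟩ := hstrips A hA m
  set tr : Fin (2 ^ m) × Fin (2 ^ m) → Fin (2 ^ m) × Fin (2 ^ m) → Prop := fun q r =>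
    Transverse A (1 / ((2 : ℝ) ^ m) ^ 2) (dyadicSquare m q) (dyadicSquare m r) with htr
  set E : Fin (2 ^ m) × Fin (2 ^ m) → EuclideanSpace ℝ (Fin 4) → ℂ :=
    fun q => extension A (dyadicSquare m q) g with hE
  set J₁ := Finset.univ.image τ₁ with hJ₁
  set J₂ := Finset.univ.image τ₂ with hJ₂
  set μ := volume.withDensity fun x => ENNReal.ofReal (ballWeight c (4 ^ n) x) with hμ
  set K : ℝ≥0∞ := 2 ^ m with hK
  set D := Dmulti A n p (1 / ((2 : ℝ) ^ m) ^ 2) with hD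
  set P := fun q => pieceSum A p n c (4 ^ n) ((dyadicSquare m q).indicator g) with hP
  have hK1 : 1 ≤ K := one_le_pow₀ (by norm_num)
  have hR : (2 : ℝ) ^ m ≤ 4 ^ n := by
    calc (2 : ℝ) ^ m ≤ 2 ^ n := pow_le_pow_right₀ (by norm_num) hmn
      _ ≤ 4 ^ n := pow_le_pow_left₀ (by norm_num) (by norm_num) n
  have hEc (q) : Continuous (E q) :=
    continuous_extension (hg.mono_set (dyadicSquare_subset_unitSquare m q))
  have hsum (s : Finset (Fin (2 ^ m) × Fin (2 ^ m))) : Measurable fun x =>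
      ‖∑ q ∈ s, E q x‖ₑ ^ p :=
    ((continuous_finsetSum s fun q _ => hEc q).enorm.measurable).pow_const p
  have hone (q) : Measurable fun x => ‖E q x‖ₑ ^ p := (hEc q).enorm.measurable.pow_const p
  have hpair (q r) : Measurable fun x =>
      if tr q r then ‖‖E q x * E r x‖ ^ (1 / 2 : ℝ)‖ₑ ^ p else 0 := by
    by_cases h : tr q r
    · simp only [h, if_true]
      exact (((((hEc q).mul (hEc r)).norm.rpow_const fun _ => Or.inr
        (by norm_num)).enorm.measurable).pow_const p)
    · simp only [h, if_false]
      exact measurable_const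
  set V := pieceSum A p m c (4 ^ n) g with hV
  have hVsum : V = ∑ q, ∫⁻ x, ‖E q x‖ₑ ^ p ∂μ := by
    rw [hV, pieceSum]
    exact Finset.sum_congr rfl fun q _ => wNorm_rpow_eq_lintegral hp0 c _ _
  have hs (s : Finset (Fin (2 ^ m) × Fin (2 ^ m))) (hcs : s.card ≤ C' * 2 ^ m) :
      ∫⁻ x, ‖∑ q ∈ s, E q x‖ₑ ^ p ∂μ ≤
        B * K ^ (p - 2) * ∑ q ∈ s, ∫⁻ x, ‖E q x‖ₑ ^ p ∂μ := by
    have h := hflat A m (4 ^ n) hR g hg c s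
    simp_rw [wNorm_rpow_eq_lintegral hp0 c] at h
    refine h.trans (mul_le_mul_left ?_ _)
    rw [hB, mul_assoc]
    exact mul_le_mul_right (card_rpow_le hcs hp2) _
  have hinter (j k) : (strip τ₁ C j ∩ strip τ₂ C k).card ≤ C' * 2 ^ m :=
    (Finset.card_le_card Finset.inter_subset_left).trans (hcard₁ j)
  have t₁ : ∑ j ∈ J₁, ∫⁻ x, ‖∑ q ∈ strip τ₁ C j, E q x‖ₑ ^ p ∂μ ≤ B * c₁ * (K ^ (p - 2) * V) := by
    calc _ ≤ ∑ j ∈ J₁, B * K ^ (p - 2) * ∑ q ∈ strip τ₁ C j, ∫⁻ x, ‖E q x‖ₑ ^ p ∂μ :=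
          Finset.sum_le_sum fun j _ => hs _ (hcard₁ j)
      _ ≤ B * K ^ (p - 2) * (c₁ * V) := by
          rw [← Finset.mul_sum, hVsum]
          exact mul_le_mul_right (sum_sum_strip_le τ₁ C J₁ _) _
      _ = _ := by ring
  have t₂ : ∑ j ∈ J₂, ∫⁻ x, ‖∑ q ∈ strip τ₂ C j, E q x‖ₑ ^ p ∂μ ≤ B * c₁ * (K ^ (p - 2) * V) := by
    calc _ ≤ ∑ j ∈ J₂, B * K ^ (p - 2) * ∑ q ∈ strip τ₂ C j, ∫⁻ x, ‖E q x‖ₑ ^ p ∂μ :=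
          Finset.sum_le_sum fun j _ => hs _ (hcard₂ j)
      _ ≤ B * K ^ (p - 2) * (c₁ * V) := by
          rw [← Finset.mul_sum, hVsum]
          exact mul_le_mul_right (sum_sum_strip_le τ₂ C J₂ _) _
      _ = _ := by ring
  have t₃ : ∑ j ∈ J₁, ∑ k ∈ J₂, ∫⁻ x, ‖∑ q ∈ strip τ₁ C j ∩ strip τ₂ C k, E q x‖ₑ ^ p ∂μ ≤
      B * (c₁ * c₁) * (K ^ (p - 2) * V) := by
    calc _ ≤ ∑ j ∈ J₁, ∑ k ∈ J₂, B * K ^ (p - 2) *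
          ∑ q ∈ strip τ₁ C j ∩ strip τ₂ C k, ∫⁻ x, ‖E q x‖ₑ ^ p ∂μ :=
          Finset.sum_le_sum fun j _ => Finset.sum_le_sum fun k _ => hs _ (hinter j k)
      _ ≤ B * K ^ (p - 2) * (c₁ * (c₁ * V)) := by
          simp_rw [← Finset.mul_sum]
          rw [hVsum]
          exact mul_le_mul_right (sum_sum_strip_inter_le τ₁ τ₂ C J₁ J₂ _) _
      _ = _ := by ring
  have t₄ : ∑ q, ∫⁻ x, ‖E q x‖ₑ ^ p ∂μ ≤ K ^ (p - 2) * V := by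
    rw [← hVsum]
    exact le_mul_of_one_le_left zero_le (by
      simpa using ENNReal.rpow_le_rpow_of_exponent_le hK1 hp2)
  have t₅ : ∑ q, ∑ r, ∫⁻ x, (if tr q r then ‖‖E q x * E r x‖ ^ (1 / 2 : ℝ)‖ₑ ^ p else 0) ∂μ ≤
      D ^ p * (2 * K ^ 2 * pieceSum A p n c (4 ^ n) g) := by
    calc _ ≤ ∑ q, ∑ r, D ^ p * (P q * P r) ^ (1 / 2 : ℝ) := by
          refine Finset.sum_le_sum fun q _ => Finset.sum_le_sum fun r _ => ?_
          by_cases h : tr q r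
          · simp only [h, if_true]
            have := wNorm_transverse_pair_le (n := n) hp1 h hg c
            rwa [wNorm_rpow_eq_lintegral hp0 c] at this
          · simp [h]
      _ = D ^ p * ∑ q, ∑ r, (P q * P r) ^ (1 / 2 : ℝ) := by simp_rw [← Finset.mul_sum]
      _ ≤ D ^ p * (2 * ((Finset.univ : Finset (Fin (2 ^ m) × Fin (2 ^ m))).card : ℝ≥0∞) *
          ∑ q, P q) := mul_le_mul_right (sum_strip_pairs_le _ P) _
      _ = _ := by
          -- The only step that needs m ≤ n: each small square lies in a single large one, so
          -- localisation redistributes the small pieces without loss.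
          rw [sum_pieceSum_indicator A hp0 hmn]
          simp only [Finset.card_univ, Fintype.card_prod, Fintype.card_fin, hK]
          push_cast
          ring
  have hmain : wNorm p c (4 ^ n) (extension A unitSquare g) ^ p ≤
      (4 : ℝ≥0∞) ^ (p - 1) *
      (∑ j ∈ J₁, ∫⁻ x, ‖∑ q ∈ strip τ₁ C j, E q x‖ₑ ^ p ∂μ +
        ∑ k ∈ J₂, ∫⁻ x, ‖∑ q ∈ strip τ₂ C k, E q x‖ₑ ^ p ∂μ +
        ∑ j ∈ J₁, ∑ k ∈ J₂, ∫⁻ x, ‖∑ q ∈ strip τ₁ C j ∩ strip τ₂ C k, E q x‖ₑ ^ p ∂μ +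
        ∑ q, ∫⁻ x, ‖E q x‖ₑ ^ p ∂μ) +
      K ^ (3 * p) * ∑ q, ∑ r, ∫⁻ x,
        (if tr q r then ‖‖E q x * E r x‖ ^ (1 / 2 : ℝ)‖ₑ ^ p else 0) ∂μ := by
    rw [wNorm_rpow_eq_lintegral hp0 c, ← hμ]
    have hpw (x) : ‖extension A unitSquare g x‖ₑ ^ p ≤ (4 : ℝ≥0∞) ^ (p - 1) *
        (∑ j ∈ J₁, ‖∑ q ∈ strip τ₁ C j, E q x‖ₑ ^ p + ∑ k ∈ J₂, ‖∑ q ∈ strip τ₂ C k, E q x‖ₑ ^ p +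
          ∑ j ∈ J₁, ∑ k ∈ J₂, ‖∑ q ∈ strip τ₁ C j ∩ strip τ₂ C k, E q x‖ₑ ^ p +
          ∑ q, ‖E q x‖ₑ ^ p) +
        K ^ (3 * p) * ∑ q, ∑ r,
          (if tr q r then ‖‖E q x * E r x‖ ^ (1 / 2 : ℝ)‖ₑ ^ p else 0) := by
      have := enorm_sum_rpow_le_broad_narrow hp1 (fun q => E q x) τ₁ τ₂ C tr hnear
      rwa [← extension_unitSquare_eq_sum hg m x] at this
    calc _ ≤ _ := lintegral_mono hpw
      _ = _ := by
          have m1 : Measurable fun x => ∑ j ∈ J₁, ‖∑ q ∈ strip τ₁ C j, E q x‖ₑ ^ p :=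
            Finset.measurable_fun_sum _ fun j _ => hsum _
          have m2 : Measurable fun x => ∑ j ∈ J₂, ‖∑ q ∈ strip τ₂ C j, E q x‖ₑ ^ p :=
            Finset.measurable_fun_sum _ fun j _ => hsum _
          have m3' (j) : Measurable fun x =>
              ∑ k ∈ J₂, ‖∑ q ∈ strip τ₁ C j ∩ strip τ₂ C k, E q x‖ₑ ^ p :=
            Finset.measurable_fun_sum _ fun k _ => hsum _
          have m3 : Measurable fun x => ∑ j ∈ J₁, ∑ k ∈ J₂,
              ‖∑ q ∈ strip τ₁ C j ∩ strip τ₂ C k, E q x‖ₑ ^ p :=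
            Finset.measurable_fun_sum _ fun j _ => m3' j
          have m4 : Measurable fun x => ∑ q, ‖E q x‖ₑ ^ p :=
            Finset.measurable_fun_sum _ fun q _ => hone q
          have m5' (q) : Measurable fun x => ∑ r,
              (if tr q r then ‖‖E q x * E r x‖ ^ (1 / 2 : ℝ)‖ₑ ^ p else 0) :=
            Finset.measurable_fun_sum _ fun r _ => hpair q r
          have m5 : Measurable fun x => ∑ q, ∑ r,
              (if tr q r then ‖‖E q x * E r x‖ ^ (1 / 2 : ℝ)‖ₑ ^ p else 0) :=
            Finset.measurable_fun_sum _ fun q _ => m5' q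
          rw [lintegral_linear_combination _ m1 m2 m3 m4 m5,
            lintegral_finsetSum _ fun j _ => hsum _, lintegral_finsetSum _ fun j _ => hsum _,
            lintegral_finsetSum _ fun j _ => m3' j, lintegral_finsetSum _ fun q _ => hone q,
            lintegral_finsetSum _ fun q _ => m5' q]
          simp_rw [lintegral_finsetSum _ fun r _ => hpair _ r,
            lintegral_finsetSum _ fun k _ => hsum _]
  -- Since p ≥ 2, the loss K² from the number of pairs fits into K^p.
  have hKp : K ^ (3 * p) * K ^ 2 ≤ K ^ (4 * p) := by
    rw [← ENNReal.rpow_natCast K 2,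
      ← ENNReal.rpow_add_of_nonneg _ _ (by positivity) (by positivity)]
    refine ENNReal.rpow_le_rpow_of_exponent_le hK1 ?_
    push_cast
    linarith
  set W := pieceSum A p n c (4 ^ n) g with hW
  calc _ ≤ (4 : ℝ≥0∞) ^ (p - 1) * (B * c₁ * (K ^ (p - 2) * V) + B * c₁ * (K ^ (p - 2) * V) +
        B * (c₁ * c₁) * (K ^ (p - 2) * V) + K ^ (p - 2) * V) +
        K ^ (3 * p) * (D ^ p * (2 * K ^ 2 * W)) := by
        refine hmain.trans (add_le_add (mul_le_mul_right (add_le_add (add_le_add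
          (add_le_add t₁ t₂) t₃) t₄) _) (mul_le_mul_right t₅ _))
    _ = (4 : ℝ≥0∞) ^ (p - 1) * (B * c₁ + B * c₁ + B * (c₁ * c₁) + 1) * (K ^ (p - 2) * V) +
        2 * ((K ^ (3 * p) * K ^ 2) * D ^ p * W) := by ring
    _ ≤ M * (K ^ (p - 2) * V) + M * (K ^ (4 * p) * D ^ p * W) := by
        gcongr
        · exact le_self_add
        · exact le_add_self
    _ = _ := by ring

/-! ### A lower bound for the bilinear constant; all scales. -/

theorem volume_square (a b : ℝ) {l : ℝ} (hl : 0 ≤ l) :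
    volume (square a b l) = ENNReal.ofReal (l ^ 2) := by
  rw [square, Measure.volume_eq_prod, Measure.prod_prod, Real.volume_Icc, Real.volume_Icc,
    add_sub_cancel_left, add_sub_cancel_left, ← ENNReal.ofReal_mul hl, sq]

/-- The displacements (1, 0), (0, 1), (1, 1) and (1, -1) give the values c₁, c₃ and c₁ ± c₂ + c₃;
the last two differ by 2c₂. If all four were below 1/L in modulus, so would be all three minors. -/
theorem Coeffs.Nondegenerate.exists_form_ge {L : ℝ} {A : Coeffs} (h : A.Nondegenerate L) :
    ∃ z ∈ unitSquare, ∃ w ∈ unitSquare, L⁻¹ ≤ |A.c1 * (z.1 - w.1) ^ 2 +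
      A.c2 * (z.1 - w.1) * (z.2 - w.2) + A.c3 * (z.2 - w.2) ^ 2| := by
  have mem (x y : ℝ) (hx : 0 ≤ x) (hx1 : x ≤ 1) (hy : 0 ≤ y) (hy1 : y ≤ 1) :
      ((x, y) : ℝ × ℝ) ∈ unitSquare := by
    simp [unitSquare, square, hx, hx1, hy, hy1]
  by_contra hcon
  push Not at hcon
  have h1 := hcon (1, 0) (mem _ _ (by norm_num) (by norm_num) (by norm_num) (by norm_num)) (0, 0)
    (mem _ _ (by norm_num) (by norm_num) (by norm_num) (by norm_num))
  have h2 := hcon (0, 1) (mem _ _ (by norm_num) (by norm_num) (by norm_num) (by norm_num)) (0, 0)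
    (mem _ _ (by norm_num) (by norm_num) (by norm_num) (by norm_num))
  have h3 := hcon (1, 1) (mem _ _ (by norm_num) (by norm_num) (by norm_num) (by norm_num)) (0, 0)
    (mem _ _ (by norm_num) (by norm_num) (by norm_num) (by norm_num))
  have h4 := hcon (1, 0) (mem _ _ (by norm_num) (by norm_num) (by norm_num) (by norm_num)) (0, 1)
    (mem _ _ (by norm_num) (by norm_num) (by norm_num) (by norm_num))
  norm_num at h1 h2 h3 h4
  have hmax := h.2.2.2.2.2.2
  have h5 : |A.c2| < L⁻¹ := by
    rw [abs_lt] at h3 h4 ⊢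
    constructor <;> linarith
  exact absurd hmax (not_le.2 (max_lt h1 (max_lt h5 h2)))

/-- The corner z(1 - l) is chosen so that the square contains z and stays inside the unit square
even when z lies on its boundary. -/
theorem square_subset_closedBall {z : ℝ × ℝ} (hz : z ∈ unitSquare) {l : ℝ} (hl : 0 < l) :
    square (z.1 * (1 - l)) (z.2 * (1 - l)) l ⊆ Metric.closedBall z l := by
  simp only [unitSquare, square, Set.mem_prod, Set.mem_Icc, zero_add] at hz
  obtain ⟨⟨h1, h2⟩, h3, h4⟩ := hz
  intro w hw
  simp only [square, Set.mem_prod, Set.mem_Icc] at hw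
  obtain ⟨⟨k1, k2⟩, k3, k4⟩ := hw
  rw [Metric.mem_closedBall, Prod.dist_eq, max_le_iff, Real.dist_eq, Real.dist_eq, abs_le, abs_le]
  refine ⟨⟨?_, ?_⟩, ?_, ?_⟩ <;> nlinarith

theorem square_subset_unitSquare {z : ℝ × ℝ} (hz : z ∈ unitSquare) {l : ℝ}
    (hl1 : l ≤ 1) : square (z.1 * (1 - l)) (z.2 * (1 - l)) l ⊆ unitSquare := by
  simp only [unitSquare, square, Set.mem_prod, Set.mem_Icc, zero_add] at hz
  obtain ⟨⟨h1, h2⟩, h3, h4⟩ := hz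
  intro w hw
  simp only [unitSquare, square, Set.mem_prod, Set.mem_Icc, zero_add] at hw ⊢
  obtain ⟨⟨k1, k2⟩, k3, k4⟩ := hw
  refine ⟨⟨?_, ?_⟩, ?_, ?_⟩ <;> nlinarith

/-- On a fixed ball, the extension of a sufficiently concentrated function has no cancellation. -/
theorem eventually_le_norm_extension (A : Coeffs) {z : ℝ × ℝ} (hz : z ∈ unitSquare) (ρ : ℝ) :
    ∃ l₀ > 0, ∀ l, 0 < l → l ≤ l₀ → ∀ x ∈ Metric.closedBall (0 : EuclideanSpace ℝ (Fin 4)) ρ,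
      l ^ 2 / 2 ≤ ‖extension A (square (z.1 * (1 - l)) (z.2 * (1 - l)) l)
        ((square (z.1 * (1 - l)) (z.2 * (1 - l)) l).indicator fun _ => 1) x‖ := by
  have hcont : Continuous fun y : (ℝ × ℝ) × EuclideanSpace ℝ (Fin 4) =>
      ‖e (inner ℝ y.2 (surface A y.1)) - e (inner ℝ y.2 (surface A z))‖ := by fun_prop
  -- Compactness of the ball makes the closeness of the phases uniform in x.
  have hev : ∀ᶠ w in nhds z, ∀ x ∈ Metric.closedBall (0 : EuclideanSpace ℝ (Fin 4)) ρ,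
      ‖e (inner ℝ x (surface A w)) - e (inner ℝ x (surface A z))‖ < 1 / 2 := by
    refine (isCompact_closedBall _ _).eventually_forall_of_forall_eventually fun x _ => ?_
    refine hcont.continuousAt.eventually_lt continuousAt_const ?_
    simp
  obtain ⟨ε, hε, hball⟩ := Metric.eventually_nhds_iff.1 hev
  refine ⟨ε / 2, by positivity, fun l hl hle x hx => ?_⟩
  set S := square (z.1 * (1 - l)) (z.2 * (1 - l)) l with hS
  have hvol : volume S = ENNReal.ofReal (l ^ 2) := volume_square _ _ hl.le
  have hvolr : volume.real S = l ^ 2 := by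
    rw [Measure.real, hvol, ENNReal.toReal_ofReal (by positivity)]
  have hSm : MeasurableSet S := measurableSet_square _ _ _
  have h1 : extension A S (S.indicator fun _ => 1) x = ∫ w in S, e (inner ℝ x (surface A w)) := by
    refine setIntegral_congr_fun hSm fun w hw => ?_
    rw [Set.indicator_of_mem hw, one_mul]
  have hi (y : EuclideanSpace ℝ (Fin 4)) :
      IntegrableOn (fun w => e (inner ℝ y (surface A w))) S := by
    have : IntegrableOn (fun _ : ℝ × ℝ => (1 : ℂ)) S :=
      integrableOn_const (by rw [hvol]; exact ENNReal.ofReal_ne_top)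
    simpa using integrableOn_mul_phase (A := A) this y
  have h2 : ‖∫ w in S, (e (inner ℝ x (surface A w)) - e (inner ℝ x (surface A z)))‖ ≤
      1 / 2 * volume.real S := by
    refine norm_setIntegral_le_of_norm_le_const (by rw [hvol]; exact ENNReal.ofReal_lt_top)
      fun w hw => ?_
    refine (hball (lt_of_le_of_lt (square_subset_closedBall hz hl hw) ?_) x hx).le
    linarith
  have hc : IntegrableOn (fun _ : ℝ × ℝ => e (inner ℝ x (surface A z))) S :=
    integrableOn_const (by rw [hvol]; exact ENNReal.ofReal_ne_top)
  rw [integral_sub (hi x) hc, setIntegral_const, hvolr, ← h1] at h2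
  have h3 := norm_sub_norm_le (l ^ 2 • e (inner ℝ x (surface A z)))
    (extension A S (S.indicator fun _ => 1) x)
  rw [norm_smul, norm_e, mul_one, Real.norm_of_nonneg (by positivity), norm_sub_rev] at h3
  linarith

/-- Each piece is bounded by the area of its square inside S, and ∑ |Δ ∩ S|^p ≤ |S|^{p-1} ∑ |Δ ∩ S|
≤ |S|^p. No loss depends on the number of pieces. -/
theorem pieceSum_indicator_square_le (A : Coeffs) {p : ℝ} (hp : 1 ≤ p) (n : ℕ)
    (c : EuclideanSpace ℝ (Fin 4)) {R : ℝ} (hR : 0 < R) (a b : ℝ) {l : ℝ} (hl : 0 ≤ l) :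
    pieceSum A p n c R ((square a b l).indicator fun _ => 1) ≤
      ENNReal.ofReal (l ^ 2) ^ p * ∫⁻ x, ENNReal.ofReal (ballWeight c R x) := by
  have hp0 : 0 < p := by linarith
  set S := square a b l with hS
  have hvol : volume S = ENNReal.ofReal (l ^ 2) := volume_square _ _ hl
  have hSm : MeasurableSet S := measurableSet_square _ _ _
  have hle (q) : wNorm p c R (extension A (dyadicSquare n q) (S.indicator fun _ => 1)) ^ p ≤
      volume (dyadicSquare n q ∩ S) ^ p * ∫⁻ x, ENNReal.ofReal (ballWeight c R x) := by
    rw [wNorm_rpow hp0 c hR, ← lintegral_const_mul _ (measurable_ballWeight hR c)]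
    refine lintegral_mono fun x => ?_
    refine mul_le_mul_left (ENNReal.rpow_le_rpow ?_ hp0.le) _
    rw [extension]
    refine (enorm_integral_le_lintegral_enorm _).trans_eq ?_
    have : ∀ z, ‖S.indicator (fun _ => (1 : ℂ)) z * e (inner ℝ x (surface A z))‖ₑ =
        S.indicator 1 z := by
      intro z
      by_cases h : z ∈ S
      · rw [Set.indicator_of_mem h, Set.indicator_of_mem h, one_mul, ← ofReal_norm, norm_e]
        simp
      · rw [Set.indicator_of_notMem h, Set.indicator_of_notMem h, zero_mul, enorm_zero]
    simp_rw [this]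
    rw [lintegral_indicator_one hSm, Measure.restrict_apply hSm, Set.inter_comm]
  rw [pieceSum]
  refine (Finset.sum_le_sum fun q _ => hle q).trans ?_
  rw [← Finset.sum_mul]
  refine mul_le_mul_left ?_ _
  have hsum : ∑ q, volume (dyadicSquare n q ∩ S) ≤ volume S := by
    have hd : Pairwise fun q r => AEDisjoint volume (dyadicSquare n q ∩ S) (dyadicSquare n r ∩ S) :=
      fun q r h => (aedisjoint_dyadicSquare h).mono Set.inter_subset_left Set.inter_subset_left
    have hU := measure_iUnion₀ hd fun q =>
      ((measurableSet_dyadicSquare n q).inter hSm).nullMeasurableSet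
    rw [tsum_fintype] at hU
    rw [← hU]
    exact measure_mono (Set.iUnion_subset fun q => Set.inter_subset_right)
  have hsplit (v : ℝ≥0∞) : v ^ p = v ^ (p - 1) * v := by
    conv_lhs => rw [show p = (p - 1) + 1 by ring,
      ENNReal.rpow_add_of_nonneg _ _ (by linarith) zero_le_one, ENNReal.rpow_one]
  calc _ ≤ ∑ q, volume S ^ (p - 1) * volume (dyadicSquare n q ∩ S) := by
        refine Finset.sum_le_sum fun q _ => ?_
        rw [hsplit]
        exact mul_le_mul_left (ENNReal.rpow_le_rpow (measure_mono Set.inter_subset_right)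
          (by linarith)) _
    _ = volume S ^ (p - 1) * ∑ q, volume (dyadicSquare n q ∩ S) := (Finset.mul_sum _ _ _).symm
    _ ≤ volume S ^ (p - 1) * volume S := mul_le_mul_right hsum _
    _ = _ := by rw [← hsplit, hvol]

/-- The bilinear constant is bounded below as soon as transverse points exist. -/
theorem le_Dmulti {A : Coeffs} {p : ℝ} (hp : 1 ≤ p) (n : ℕ) {ν : ℝ} {z w : ℝ × ℝ}
    (hz : z ∈ unitSquare) (hw : w ∈ unitSquare)
    (h : ν < |A.c1 * (z.1 - w.1) ^ 2 + A.c2 * (z.1 - w.1) * (z.2 - w.2) +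
      A.c3 * (z.2 - w.2) ^ 2|) : 4⁻¹ ≤ Dmulti A n p ν := by
  have hp0 : 0 < p := by linarith
  have hR : (0 : ℝ) < 4 ^ n := by positivity
  refine le_sInf fun D hD => ?_
  set μ := volume.withDensity fun x => ENNReal.ofReal (ballWeight 0 (4 ^ n) x) with hμ
  set W := ∫⁻ x, ENNReal.ofReal (ballWeight 0 (4 ^ n) x) with hW
  have hμW : μ Set.univ = W := by rw [hμ, withDensity_apply _ MeasurableSet.univ]; simp [hW]
  have hWtop : W ≠ ∞ := (lintegral_ballWeight_lt_top hR 0).ne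
  have hW0 : W ≠ 0 := by
    rw [hW, ← pos_iff_ne_zero, lintegral_pos_iff_support (measurable_ballWeight hR 0)]
    have : (Function.support fun x => ENNReal.ofReal (ballWeight 0 (4 ^ n) x)) = Set.univ := by
      ext x
      simpa using ballWeight_pos hR 0 x
    rw [this]
    exact isOpen_univ.measure_pos volume Set.univ_nonempty
  -- The ball is fixed first, with more than half of the weighted mass; the squares are then taken
  -- so small that neither extension has cancellation on it.
  obtain ⟨ρ, hρ⟩ : ∃ ρ : ℕ, W / 2 < μ (Metric.closedBall 0 ρ) := by
    have hmono : Monotone fun k : ℕ => Metric.closedBall (0 : EuclideanSpace ℝ (Fin 4)) k :=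
      fun i j hij => Metric.closedBall_subset_closedBall (by exact_mod_cast hij)
    have hlim := tendsto_measure_iUnion_atTop (μ := μ) hmono
    rw [Metric.iUnion_closedBall_nat, hμW] at hlim
    exact (hlim.eventually_const_lt (ENNReal.half_lt_self hW0 hWtop)).exists
  obtain ⟨l₁, hl₁, hlow₁⟩ := eventually_le_norm_extension A hz ρ
  obtain ⟨l₂, hl₂, hlow₂⟩ := eventually_le_norm_extension A hw ρ
  have hcont : Continuous fun y : (ℝ × ℝ) × (ℝ × ℝ) => |A.c1 * (y.1.1 - y.2.1) ^ 2 +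
      A.c2 * (y.1.1 - y.2.1) * (y.1.2 - y.2.2) + A.c3 * (y.1.2 - y.2.2) ^ 2| := by fun_prop
  obtain ⟨ε, hε, hball⟩ := Metric.eventually_nhds_iff.1
    ((hcont.continuousAt (x := (z, w))).eventually_const_lt h)
  obtain ⟨l, hl, hl1, hll₁, hll₂, hlε⟩ :
      ∃ l : ℝ, 0 < l ∧ l ≤ 1 ∧ l ≤ l₁ ∧ l ≤ l₂ ∧ l ≤ ε / 2 := by
    refine ⟨min (min 1 l₁) (min l₂ (ε / 2)), by positivity, ?_, ?_, ?_, ?_⟩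
    · exact (min_le_left _ _).trans (min_le_left _ _)
    · exact (min_le_left _ _).trans (min_le_right _ _)
    · exact (min_le_right _ _).trans (min_le_left _ _)
    · exact (min_le_right _ _).trans (min_le_right _ _)
  set S := square (z.1 * (1 - l)) (z.2 * (1 - l)) l with hS
  set T := square (w.1 * (1 - l)) (w.2 * (1 - l)) l with hT
  have htrans : Transverse A ν S T := by
    intro z' hz' w' hw'
    refine (hball (y := (z', w')) ?_).le
    have h1 := square_subset_closedBall hz hl hz'
    have h2 := square_subset_closedBall hw hl hw'
    rw [Metric.mem_closedBall] at h1 h2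
    rw [Prod.dist_eq, max_lt_iff]
    constructor <;> simp only <;> linarith
  have hi (a b : ℝ) : Integrable ((square a b l).indicator fun _ : ℝ × ℝ => (1 : ℂ)) :=
    (integrable_indicator_iff (measurableSet_square _ _ _)).2
      (integrableOn_const (by rw [volume_square _ _ hl.le]; exact ENNReal.ofReal_ne_top))
  have hmain := hD _ _ l _ _ l hl hl (square_subset_unitSquare hz hl1)
    (square_subset_unitSquare hw hl1) htrans _ _ (hi _ _) (hi _ _)
    Set.support_indicator_subset Set.support_indicator_subset 0
  set v₂ := ENNReal.ofReal (l ^ 2) with hv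
  have hv0 : v₂ ≠ 0 := by
    rw [hv, ne_eq, ENNReal.ofReal_eq_zero, not_le]
    positivity
  have htop : v₂ ≠ ∞ := ENNReal.ofReal_ne_top
  have hP1 := pieceSum_indicator_square_le A hp n 0 hR (z.1 * (1 - l)) (z.2 * (1 - l)) hl.le
  have hP2 := pieceSum_indicator_square_le A hp n 0 hR (w.1 * (1 - l)) (w.2 * (1 - l)) hl.le
  have hupp : (D * (pieceSum A p n 0 (4 ^ n) (S.indicator fun _ => 1) *
      pieceSum A p n 0 (4 ^ n) (T.indicator fun _ => 1)) ^ (1 / (2 * p))) ^ p ≤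
      D ^ p * (v₂ ^ p * W) := by
    rw [ENNReal.mul_rpow_of_nonneg _ _ hp0.le, ← ENNReal.rpow_mul]
    refine mul_le_mul_right ?_ _
    refine (ENNReal.rpow_le_rpow (mul_le_mul' hP1 hP2) (by positivity)).trans_eq ?_
    rw [← sq, ← ENNReal.rpow_two, ← ENNReal.rpow_mul,
      show (2 : ℝ) * (1 / (2 * p) * p) = 1 by field_simp, ENNReal.rpow_one]
  have hlow : (v₂ / 2) ^ p * (W / 2) ≤ wNorm p 0 (4 ^ n) (fun x =>
      ‖extension A S (S.indicator fun _ => 1) x * extension A T (T.indicator fun _ => 1) x‖ ^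
        (1 / 2 : ℝ)) ^ p := by
    rw [wNorm_rpow_eq_lintegral hp0]
    calc _ ≤ (v₂ / 2) ^ p * μ (Metric.closedBall 0 ρ) := mul_le_mul_right hρ.le _
      _ = ∫⁻ x in Metric.closedBall 0 ρ, (v₂ / 2) ^ p ∂μ := (setLIntegral_const _ _).symm
      _ ≤ ∫⁻ x in Metric.closedBall 0 ρ, ‖‖extension A S (S.indicator fun _ => 1) x *
          extension A T (T.indicator fun _ => 1) x‖ ^ (1 / 2 : ℝ)‖ₑ ^ p ∂μ := by
          refine setLIntegral_mono' measurableSet_closedBall fun x hx => ?_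
          refine ENNReal.rpow_le_rpow ?_ hp0.le
          rw [← ofReal_norm, Real.norm_of_nonneg (by positivity), hv,
            show (2 : ℝ≥0∞) = ENNReal.ofReal 2 by simp, ← ENNReal.ofReal_div_of_pos (by norm_num)]
          refine ENNReal.ofReal_le_ofReal ?_
          rw [← Real.sqrt_eq_rpow, norm_mul]
          refine Real.le_sqrt_of_sq_le ?_
          rw [sq]
          exact mul_le_mul (hlow₁ l hl hll₁ x hx) (hlow₂ l hl hll₂ x hx) (by positivity)
            (norm_nonneg _)
      _ ≤ _ := setLIntegral_le_lintegral _ _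
  have hfin : (4⁻¹ : ℝ≥0∞) ^ p * (v₂ ^ p * W) ≤ D ^ p * (v₂ ^ p * W) := by
    refine le_trans ?_ (hlow.trans ((ENNReal.rpow_le_rpow hmain hp0.le).trans hupp))
    have h4 : (4⁻¹ : ℝ≥0∞) = 2⁻¹ * 2⁻¹ := by
      rw [← ENNReal.mul_inv (by norm_num) (by norm_num)]
      norm_num
    -- The test gives D^p ≥ 2^{-p}/2, and p ≥ 1 lets the lost half of the mass be absorbed into
    -- 4^{-p}.
    have h2 : (2⁻¹ : ℝ≥0∞) ^ p ≤ 2⁻¹ := by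
      simpa using ENNReal.rpow_le_rpow_of_exponent_ge (x := (2⁻¹ : ℝ≥0∞)) (by simp) hp
    rw [h4, ENNReal.mul_rpow_of_nonneg _ _ hp0.le, div_eq_mul_inv, div_eq_mul_inv,
      ENNReal.mul_rpow_of_nonneg _ _ hp0.le]
    calc _ ≤ (2⁻¹ : ℝ≥0∞) ^ p * 2⁻¹ * (v₂ ^ p * W) := by gcongr
      _ = _ := by ring
  rw [ENNReal.mul_le_mul_iff_left (mul_ne_zero (by simp [hv0, htop]) hW0)
    (ENNReal.mul_ne_top (ENNReal.rpow_ne_top_of_nonneg hp0.le htop) hWtop)] at hfin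
  exact (ENNReal.rpow_le_rpow_iff hp0).1 hfin

/-- The broad-narrow inequality at all scales. -/
theorem exists_multilinear_bound {p : ℝ} (hp : 2 ≤ p) {L : ℝ} (hL : 0 < L) : ∃ C : ℝ≥0,
    ∀ A : Coeffs, A.Nondegenerate L → ∀ (m n : ℕ) (g : ℝ × ℝ → ℂ),
      IntegrableOn g unitSquare → ∀ c : EuclideanSpace ℝ (Fin 4),
      wNorm p c (4 ^ n) (extension A unitSquare g) ^ p ≤ (C : ℝ≥0∞) *
        ((2 ^ m : ℝ≥0∞) ^ (p - 2) * pieceSum A p m c (4 ^ n) g +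
          (2 ^ m : ℝ≥0∞) ^ (4 * p) * Dmulti A n p (1 / ((2 : ℝ) ^ m) ^ 2) ^ p *
            pieceSum A p n c (4 ^ n) g) := by
  obtain ⟨C, hC⟩ := exists_multilinear_bound_of_le hp hL
  have hp0 : 0 < p := by linarith
  have hp1 : 1 ≤ p := by linarith
  -- One summand for each regime: m ≤ n, m > n with K² > L, and m > n with K² ≤ L.
  refine ⟨C + 4 ^ p + L.toNNReal ^ (p - 1), fun A hA m n g hg c => ?_⟩
  have hR : (0 : ℝ) < 4 ^ n := by positivity
  have hK1 : (1 : ℝ≥0∞) ≤ 2 ^ m := one_le_pow₀ (by norm_num)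
  rw [ENNReal.coe_add, ENNReal.coe_add, ENNReal.coe_rpow_of_nonneg _ hp0.le,
    ENNReal.coe_rpow_of_nonneg _ (by linarith : 0 ≤ p - 1)]
  rcases le_or_gt m n with hmn | hmn
  · refine (hC A hA m n hmn g hg c).trans (mul_le_mul_left ?_ _)
    rw [add_assoc]
    exact le_self_add
  rcases le_or_gt (((2 : ℝ) ^ m) ^ 2) L with hKL | hKL
  -- With K² ≤ L there are at most L squares of side 1/K, and the trivial decoupling into them is
  -- enough.
  · refine (wNorm_extension_rpow_le_pieceSum hp1 hg m c hR).trans ?_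
    have h1 : ((4 ^ m : ℕ) : ℝ≥0∞) ≤ (L.toNNReal : ℝ≥0∞) := by
      change _ ≤ ENNReal.ofReal L
      rw [← ENNReal.ofReal_natCast]
      refine ENNReal.ofReal_le_ofReal (le_trans (le_of_eq ?_) hKL)
      push_cast
      rw [← pow_mul, mul_comm, pow_mul]
      norm_num
    have h2 : (1 : ℝ≥0∞) ≤ (2 ^ m) ^ (p - 2) := by
      simpa using ENNReal.rpow_le_rpow_of_exponent_le hK1 (by linarith : (0 : ℝ) ≤ p - 2)
    refine mul_le_mul' ((ENNReal.rpow_le_rpow h1 (by linarith)).trans le_add_self) ?_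
    exact (le_mul_of_one_le_left zero_le h2).trans le_self_add
  · obtain ⟨z, hz, w, hw, hform⟩ := hA.exists_form_ge
    have hν : 1 / ((2 : ℝ) ^ m) ^ 2 < |A.c1 * (z.1 - w.1) ^ 2 +
        A.c2 * (z.1 - w.1) * (z.2 - w.2) + A.c3 * (z.2 - w.2) ^ 2| := by
      refine lt_of_lt_of_le ?_ hform
      rw [← one_div]
      exact one_div_lt_one_div_of_lt hL hKL
    have hD := le_Dmulti hp1 n hz hw hν
    set D := Dmulti A n p (1 / ((2 : ℝ) ^ m) ^ 2)
    have hD1 : 1 ≤ (4 : ℝ≥0∞) ^ p * D ^ p := by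
      rw [← ENNReal.mul_rpow_of_nonneg _ _ hp0.le]
      have : (1 : ℝ≥0∞) ≤ 4 * D := by
        calc (1 : ℝ≥0∞) = 4 * 4⁻¹ := (ENNReal.mul_inv_cancel (by norm_num) (by norm_num)).symm
          _ ≤ _ := mul_le_mul_right hD _
      simpa using ENNReal.rpow_le_rpow this hp0.le
    -- Since n < m, the trivial loss 4^{n(p-1)} is at most K^{2(p-1)}, below K^{4p}.
    have h1 : ((4 ^ n : ℕ) : ℝ≥0∞) ^ (p - 1) ≤ (2 ^ m : ℝ≥0∞) ^ (4 * p) := by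
      have h2 : ((4 ^ n : ℕ) : ℝ≥0∞) ≤ (2 ^ m : ℝ≥0∞) ^ (2 : ℝ) := by
        rw [ENNReal.rpow_two, ← pow_mul, mul_comm, pow_mul]
        norm_num
        exact pow_le_pow_right₀ (by norm_num) hmn.le
      refine (ENNReal.rpow_le_rpow h2 (by linarith)).trans ?_
      rw [← ENNReal.rpow_mul]
      exact ENNReal.rpow_le_rpow_of_exponent_le hK1 (by linarith)
    calc _ ≤ ((4 ^ n : ℕ) : ℝ≥0∞) ^ (p - 1) * pieceSum A p n c (4 ^ n) g :=
          wNorm_extension_rpow_le_pieceSum hp1 hg n c hR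
      _ ≤ (2 ^ m : ℝ≥0∞) ^ (4 * p) * pieceSum A p n c (4 ^ n) g := mul_le_mul_left h1 _
      _ ≤ ((4 : ℝ≥0∞) ^ p * D ^ p) * ((2 ^ m : ℝ≥0∞) ^ (4 * p) * pieceSum A p n c (4 ^ n) g) :=
          le_mul_of_one_le_left zero_le hD1
      _ = (4 : ℝ≥0∞) ^ p * ((2 ^ m : ℝ≥0∞) ^ (4 * p) * D ^ p * pieceSum A p n c (4 ^ n) g) := by
          ring
      _ ≤ _ := by
          refine mul_le_mul' ?_ le_add_self
          rw [add_right_comm]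
          exact le_add_self

/-! ### Sharpness for the surface (t, s, t², ts). -/

theorem norm_integral_e_mul_abs_le (a b u : ℝ) : ‖∫ s in a..b, e (u * s)‖ * |u| ≤ 1 := by
  rcases eq_or_ne u 0 with rfl | hu
  · simp
  have hc : 2 * Real.pi * Complex.I * u ≠ 0 := by
    simp [Real.pi_ne_zero, hu]
  have h : ∫ s in a..b, e (u * s) = (e (u * b) - e (u * a)) / (2 * Real.pi * Complex.I * u) := by
    have := integral_exp_mul_complex (a := a) (b := b) hc
    simp only [e, Complex.ofReal_mul, ← mul_assoc]
    exact this
  have hn : ‖2 * Real.pi * Complex.I * u‖ = 2 * Real.pi * |u| := by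
    simp [abs_of_pos Real.pi_pos]
  have hle : ‖e (u * b) - e (u * a)‖ ≤ 2 := by
    refine (norm_sub_le _ _).trans ?_
    rw [norm_e, norm_e]
    norm_num
  have hu0 : 0 < |u| := abs_pos.2 hu
  rw [h, norm_div, hn, div_mul_eq_mul_div, div_le_one (by positivity)]
  nlinarith [Real.pi_gt_three]

/-- The integral is bounded both by l and by 1/|u|. Two of the p powers use both bounds and yield
decay integrable in u; the others use l. -/
theorem norm_integral_e_rpow_le {p : ℝ} (hp : 2 ≤ p) (b u : ℝ) {l : ℝ} (hl : 0 < l) :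
    ‖∫ s in Set.Icc b (b + l), e (u * s)‖ ^ p ≤ 2 * l ^ p * (1 + (l * u) ^ 2)⁻¹ := by
  have h1 : ‖∫ s in Set.Icc b (b + l), e (u * s)‖ ≤ l := by
    have := norm_setIntegral_le_of_norm_le_const (s := Set.Icc b (b + l)) (μ := volume)
      (f := fun s => e (u * s)) (C := 1) (by simp) fun s _ => (norm_e _).le
    simpa [hl.le] using this
  have h2 : ‖∫ s in Set.Icc b (b + l), e (u * s)‖ * |u| ≤ 1 := by
    rw [integral_Icc_eq_integral_Ioc, ← intervalIntegral.integral_of_le (by linarith)]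
    exact norm_integral_e_mul_abs_le _ _ _
  set I := ‖∫ s in Set.Icc b (b + l), e (u * s)‖
  have hI : 0 ≤ I := norm_nonneg _
  have h3 : I ^ 2 * (1 + (l * u) ^ 2) ≤ 2 * l ^ 2 := by
    have h4 : (I * |u|) ^ 2 ≤ 1 := pow_le_one₀ (by positivity) h2
    rw [mul_pow, sq_abs] at h4
    nlinarith [pow_le_pow_left₀ hI h1 2, mul_le_mul_of_nonneg_left h4 (sq_nonneg l)]
  have hsplit (v : ℝ) (hv : 0 ≤ v) : v ^ p = v ^ (p - 2) * v ^ 2 := by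
    rw [← Real.rpow_two, ← Real.rpow_add_of_nonneg hv (by linarith) (by norm_num)]
    congr 1
    ring
  rw [← div_eq_mul_inv, le_div_iff₀ (by positivity), hsplit I hI, hsplit l hl.le]
  calc I ^ (p - 2) * I ^ 2 * (1 + (l * u) ^ 2) = I ^ (p - 2) * (I ^ 2 * (1 + (l * u) ^ 2)) := by
        ring
    _ ≤ l ^ (p - 2) * (2 * l ^ 2) :=
        mul_le_mul (Real.rpow_le_rpow hI h1 (by linarith)) h3 (by positivity) (by positivity)
    _ = _ := by ring

theorem integrable_inv_one_add_mul_sq {l : ℝ} (hl : l ≠ 0) :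
    Integrable fun u : ℝ => (1 + (l * u) ^ 2)⁻¹ :=
  integrable_inv_one_add_sq.comp_mul_left' hl

theorem integral_inv_one_add_mul_sq {l : ℝ} (hl : 0 < l) :
    ∫ u : ℝ, (1 + (l * u) ^ 2)⁻¹ = Real.pi / l := by
  rw [Measure.integral_comp_mul_left (fun u : ℝ => (1 + u ^ 2)⁻¹), integral_univ_inv_one_add_sq,
    abs_of_pos (by positivity), smul_eq_mul]
  ring

/-- Integration along one coordinate first, in coordinates sheared along it. -/
theorem lintegral_shear_mul_prod {Φ : ℝ → ℝ≥0∞} (hΦ : Measurable Φ) {G : ℝ → ℝ}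
    (hG : Continuous G) (hG0 : ∀ y, 0 ≤ G y) (hGi : Integrable G) (t : ℝ) :
    ∫⁻ x : EuclideanSpace ℝ (Fin 4), Φ (x 1 + x 3 * t) *
        ENNReal.ofReal (G (x 0) * G (x 2) * G (x 3))
      = (∫⁻ u, Φ u) * ENNReal.ofReal ((∫ y, G y) ^ 3) := by
  have hpi : ∫⁻ y : Fin 3 → ℝ, ENNReal.ofReal (∏ j, G (y j)) =
      ENNReal.ofReal ((∫ y, G y) ^ 3) := by
    rw [volume_pi, ← ofReal_integral_eq_lintegral_ofReal (Integrable.fintype_prod fun _ => hGi)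
      (Filter.Eventually.of_forall fun y => Finset.prod_nonneg fun j _ => hG0 _),
      integral_fintype_prod_eq_prod (fun _ : Fin 3 => G)]
    simp
  have hm : Measurable fun y : Fin 3 → ℝ => ENNReal.ofReal (∏ j, G (y j)) := by fun_prop
  rw [← (PiLp.volume_preserving_toLp (Fin 4)).lintegral_comp_emb
    -- The coordinate x₁ is split off and integrated first; for fixed x₃ the shear is a translation
    -- in x₁.
    (MeasurableEquiv.toLp 2 (Fin 4 → ℝ)).measurableEmbedding,
    ← ((volume_preserving_piFinSuccAbove (fun _ : Fin 4 => ℝ) 1).symm).lintegral_comp_emb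
    (MeasurableEquiv.measurableEmbedding _)]
  have h (y : ℝ × (Fin 3 → ℝ)) :
      Φ ((WithLp.toLp 2 ((MeasurableEquiv.piFinSuccAbove (fun _ : Fin 4 => ℝ) 1).symm y)) 1 +
        (WithLp.toLp 2 ((MeasurableEquiv.piFinSuccAbove (fun _ : Fin 4 => ℝ) 1).symm y)) 3 * t) *
      ENNReal.ofReal (G ((WithLp.toLp 2
          ((MeasurableEquiv.piFinSuccAbove (fun _ : Fin 4 => ℝ) 1).symm y)) 0) *
        G ((WithLp.toLp 2 ((MeasurableEquiv.piFinSuccAbove (fun _ : Fin 4 => ℝ) 1).symm y)) 2) *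
        G ((WithLp.toLp 2 ((MeasurableEquiv.piFinSuccAbove (fun _ : Fin 4 => ℝ) 1).symm y)) 3)) =
      Φ (y.1 + y.2 2 * t) * ENNReal.ofReal (∏ j, G (y.2 j)) := by
    rw [Fin.prod_univ_three]
    rfl
  simp_rw [h]
  rw [Measure.volume_eq_prod, lintegral_prod_symm _ (by fun_prop)]
  have h2 (y : Fin 3 → ℝ) : ∫⁻ u, Φ (u + y 2 * t) * ENNReal.ofReal (∏ j, G (y j)) =
      (∫⁻ u, Φ u) * ENNReal.ofReal (∏ j, G (y j)) := by
    rw [lintegral_mul_const _ (by fun_prop), lintegral_add_right_eq_self]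
  simp_rw [h2]
  rw [lintegral_const_mul _ hm, hpi]

theorem inner_surface_twisted (x : EuclideanSpace ℝ (Fin 4)) (z : ℝ × ℝ) :
    inner ℝ x (surface twisted z) = (x 0 * z.1 + x 2 * z.1 ^ 2) + (x 1 + x 3 * z.1) * z.2 := by
  simp only [surface, twisted, PiLp.inner_apply, Fin.sum_univ_four]
  simp
  ring

/-- The coordinate x₁ is left out on purpose: the decay of the extension itself makes the integral
over it converge, with a bound independent of R. -/
theorem ballWeight_zero_le {R : ℝ} (hR : 0 < R) (x : EuclideanSpace ℝ (Fin 4)) :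
    ballWeight 0 R x ≤ (1 + (R⁻¹ * x 0) ^ 2)⁻¹ * (1 + (R⁻¹ * x 2) ^ 2)⁻¹ *
      (1 + (R⁻¹ * x 3) ^ 2)⁻¹ := by
  have h (i : Fin 4) : 1 + (R⁻¹ * x i) ^ 2 ≤ (1 + ‖x - 0‖ / R) ^ 2 := by
    have h1 : |R⁻¹ * x i| ≤ ‖x - 0‖ / R := by
      rw [abs_mul, abs_of_pos (by positivity), sub_zero, inv_mul_eq_div]
      gcongr
      exact PiLp.norm_apply_le x i
    have h2 := pow_le_pow_left₀ (abs_nonneg _) h1 2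
    rw [sq_abs] at h2
    nlinarith [(abs_nonneg _).trans h1]
  rw [ballWeight, ← mul_inv, ← mul_inv, ← one_div]
  refine one_div_le_one_div_of_le (by positivity) ?_
  have h1 : 1 ≤ 1 + ‖x - 0‖ / R := by
    have : 0 ≤ ‖x - 0‖ / R := by positivity
    linarith
  calc _ ≤ (1 + ‖x - 0‖ / R) ^ 2 * (1 + ‖x - 0‖ / R) ^ 2 * (1 + ‖x - 0‖ / R) ^ 2 := by
        gcongr <;> exact h _
    _ = (1 + ‖x - 0‖ / R) ^ 6 := by ring
    _ ≤ _ := pow_le_pow_right₀ h1 (by norm_num)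

/-- Modulating the function translates its extension. -/
theorem wNorm_extension_modulate (A : Coeffs) {p : ℝ} (hp : 0 < p) (S : Set (ℝ × ℝ))
    (g : ℝ × ℝ → ℂ) (c : EuclideanSpace ℝ (Fin 4)) {R : ℝ} (hR : 0 < R) :
    wNorm p c R (extension A S fun z => g z * e (-inner ℝ c (surface A z))) ^ p =
      wNorm p 0 R (extension A S g) ^ p := by
  rw [wNorm_rpow hp c hR, wNorm_rpow hp 0 hR, ← lintegral_sub_right_eq_self
    (fun x => ‖extension A S g x‖ₑ ^ p * ENNReal.ofReal (ballWeight 0 R x)) c]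
  refine lintegral_congr fun x => ?_
  have h1 : extension A S (fun z => g z * e (-inner ℝ c (surface A z))) x =
      extension A S g (x - c) := by
    rw [extension, extension]
    refine integral_congr_ae (Filter.Eventually.of_forall fun z => ?_)
    simp only
    rw [mul_assoc, ← e_add, inner_sub_left, neg_add_eq_sub]
  have h2 : ballWeight c R x = ballWeight 0 R (x - c) := by
    rw [ballWeight, ballWeight, sub_zero]
  rw [h1, h2]

/-- The upper bound for one piece of a thin vertical strip. -/
theorem wNorm_extension_twisted_rpow_le {p : ℝ} (hp : 2 ≤ p) {R : ℝ} (hR : 0 < R) {δ : ℝ}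
    (hδ : 0 ≤ δ) (b : ℝ) {l : ℝ} (hl : 0 < l) :
    wNorm p 0 R (extension twisted (Set.Icc 0 δ ×ˢ Set.Icc b (b + l)) 1) ^ p ≤
      ENNReal.ofReal (2 * Real.pi ^ 4 * R ^ 3 * (δ ^ p * l ^ (p - 1))) := by
  have hp0 : 0 < p := by linarith
  set G : ℝ → ℝ := fun y => (1 + (R⁻¹ * y) ^ 2)⁻¹ with hG
  have hGc : Continuous G := by
    rw [hG]
    exact Continuous.inv₀ (by fun_prop) fun y => by positivity
  have hGi : Integrable G := integrable_inv_one_add_mul_sq (by positivity)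
  set φ : ℝ → ℝ := fun u => 2 * l ^ p * (1 + (l * u) ^ 2)⁻¹ with hφ
  have hφ0 (u) : 0 ≤ φ u := by positivity
  have hφc : Continuous φ := by
    rw [hφ]
    exact continuous_const.mul (Continuous.inv₀ (by fun_prop) fun y => by positivity)
  have hφint : ∫⁻ u, ENNReal.ofReal (φ u) = ENNReal.ofReal (2 * Real.pi * l ^ (p - 1)) := by
    rw [← ofReal_integral_eq_lintegral_ofReal
      ((integrable_inv_one_add_mul_sq hl.ne').const_mul _) (Filter.Eventually.of_forall hφ0),
      integral_const_mul, integral_inv_one_add_mul_sq hl, Real.rpow_sub_one hl.ne']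
    congr 1
    ring
  -- The bound is kept as a p-th root so that Jensen's inequality in t restores φ itself.
  have hF (u : ℝ) : ‖∫ s in Set.Icc b (b + l), e (u * s)‖ₑ ≤ ENNReal.ofReal (φ u) ^ p⁻¹ := by
    rw [ENNReal.le_rpow_inv_iff hp0, ← ofReal_norm,
      ENNReal.ofReal_rpow_of_nonneg (norm_nonneg _) hp0.le]
    exact ENNReal.ofReal_le_ofReal (norm_integral_e_rpow_le hp b u hl)
  have hpt (x : EuclideanSpace ℝ (Fin 4)) :
      ‖extension twisted (Set.Icc 0 δ ×ˢ Set.Icc b (b + l)) 1 x‖ₑ ^ p ≤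
        ENNReal.ofReal δ ^ (p - 1) *
          ∫⁻ t in Set.Icc 0 δ, ENNReal.ofReal (φ (x 1 + x 3 * t)) := by
    have h1 : extension twisted (Set.Icc 0 δ ×ˢ Set.Icc b (b + l)) 1 x =
        ∫ t in Set.Icc 0 δ, e (x 0 * t + x 2 * t ^ 2) *
          ∫ s in Set.Icc b (b + l), e ((x 1 + x 3 * t) * s) := by
      rw [extension, Measure.volume_eq_prod, setIntegral_prod]
      · simp only [Pi.one_apply, one_mul, inner_surface_twisted, e_add, integral_const_mul]
      · exact (Continuous.continuousOn (by unfold surface; fun_prop)).integrableOn_compact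
          (isCompact_Icc.prod isCompact_Icc)
    have h2 : ‖extension twisted (Set.Icc 0 δ ×ˢ Set.Icc b (b + l)) 1 x‖ₑ ≤
        ∫⁻ t in Set.Icc 0 δ, ENNReal.ofReal (φ (x 1 + x 3 * t)) ^ p⁻¹ * 1 := by
      rw [h1]
      refine (enorm_integral_le_lintegral_enorm _).trans (lintegral_mono fun t => ?_)
      rw [enorm_mul, ← ofReal_norm, norm_e, ENNReal.ofReal_one, one_mul, mul_one]
      exact hF _
    refine (ENNReal.rpow_le_rpow h2 hp0.le).trans ?_
    refine (rpow_lintegral_mul_le _ (by fun_prop) measurable_const (by linarith)).trans_eq ?_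
    simp only [mul_one, lintegral_const, one_mul, Measure.restrict_apply_univ, Real.volume_Icc,
      sub_zero, ← ENNReal.rpow_mul, inv_mul_cancel₀ hp0.ne', ENNReal.rpow_one]
  rw [wNorm_rpow hp0 0 hR]
  calc _ ≤ ∫⁻ x : EuclideanSpace ℝ (Fin 4), ENNReal.ofReal δ ^ (p - 1) *
        ((∫⁻ t in Set.Icc 0 δ, ENNReal.ofReal (φ (x 1 + x 3 * t))) *
          ENNReal.ofReal (G (x 0) * G (x 2) * G (x 3))) := by
        refine lintegral_mono fun x => ?_
        rw [← mul_assoc]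
        exact mul_le_mul' (hpt x) (ENNReal.ofReal_le_ofReal (ballWeight_zero_le hR x))
    _ = ENNReal.ofReal δ ^ (p - 1) * ∫⁻ x : EuclideanSpace ℝ (Fin 4), ∫⁻ t in Set.Icc 0 δ,
        ENNReal.ofReal (φ (x 1 + x 3 * t)) * ENNReal.ofReal (G (x 0) * G (x 2) * G (x 3)) := by
        rw [lintegral_const_mul']
        · congr 1
          refine lintegral_congr fun x => ?_
          rw [lintegral_mul_const _ (by fun_prop)]
        · exact ENNReal.rpow_ne_top_of_nonneg (by linarith) ENNReal.ofReal_ne_top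
    _ = ENNReal.ofReal δ ^ (p - 1) * ∫⁻ t in Set.Icc 0 δ, ∫⁻ x : EuclideanSpace ℝ (Fin 4),
        ENNReal.ofReal (φ (x 1 + x 3 * t)) * ENNReal.ofReal (G (x 0) * G (x 2) * G (x 3)) := by
        rw [lintegral_lintegral_swap]
        exact Measurable.aemeasurable (by fun_prop)
    _ = ENNReal.ofReal δ ^ (p - 1) * (ENNReal.ofReal (2 * Real.pi * l ^ (p - 1)) *
        ENNReal.ofReal ((Real.pi * R) ^ 3) * ENNReal.ofReal δ) := by
        have hGint : ∫ y, G y = Real.pi * R := by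
          rw [hG, integral_inv_one_add_mul_sq (by positivity), div_inv_eq_mul]
        have h (t) := lintegral_shear_mul_prod (Φ := fun u => ENNReal.ofReal (φ u)) (by fun_prop)
          hGc (fun y => by positivity) hGi t
        simp_rw [h, hφint, hGint]
        rw [setLIntegral_const, Real.volume_Icc, sub_zero]
    _ = _ := by
        have hd : ENNReal.ofReal δ ^ (p - 1) * ENNReal.ofReal δ = ENNReal.ofReal (δ ^ p) := by
          rw [← ENNReal.ofReal_rpow_of_nonneg hδ hp0.le]
          conv_rhs => rw [show p = (p - 1) + 1 by ring,
            ENNReal.rpow_add_of_nonneg _ _ (by linarith) zero_le_one, ENNReal.rpow_one]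
        calc _ = ENNReal.ofReal δ ^ (p - 1) * ENNReal.ofReal δ *
              (ENNReal.ofReal (2 * Real.pi * l ^ (p - 1)) *
                ENNReal.ofReal ((Real.pi * R) ^ 3)) := by
              ring
          _ = _ := by
              rw [hd, ← ENNReal.ofReal_mul (by positivity), ← ENNReal.ofReal_mul (by positivity)]
              congr 1
              ring

theorem norm_e_sub_one_le (u : ℝ) : ‖e u - 1‖ ≤ 2 * Real.pi * |u| := by
  have h := Real.norm_exp_I_mul_ofReal_sub_one_le (x := 2 * Real.pi * u)
  rw [Real.norm_eq_abs, abs_mul, abs_of_pos (by positivity)] at h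
  refine le_trans (le_of_eq ?_) h
  rw [e]
  congr 3
  push_cast
  ring

/-- The extension of a thin vertical strip has no cancellation near a hyperplane. -/
theorem le_wNorm_extension_twisted_rpow {p : ℝ} (hp : 0 < p) {R : ℝ} (hR : 1 ≤ R) :
    ENNReal.ofReal (R ^ 3 * (((1000 * R)⁻¹ / 2) ^ p * (3 ^ 100)⁻¹)) ≤
      wNorm p 0 R (extension twisted (Set.Icc 0 (1000 * R)⁻¹ ×ˢ Set.Icc 0 1) 1) ^ p := by
  have hR0 : 0 < R := by linarith
  set δ := (1000 * R)⁻¹ with hδ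
  have hδ0 : 0 < δ := by positivity
  have hδR : δ * R = 1 / 1000 := by rw [hδ]; field_simp
  have hδ1 : δ ≤ 1 := by nlinarith
  set D : Set (ℝ × ℝ) := Set.Icc 0 δ ×ˢ Set.Icc 0 1 with hD
  have hvol : volume D = ENNReal.ofReal δ := by
    rw [hD, Measure.volume_eq_prod, Measure.prod_prod]
    simp
  have hvolr : volume.real D = δ := by
    rw [Measure.real, hvol, ENNReal.toReal_ofReal hδ0.le]
  -- On this box, of volume R³, the phase is at most 3/1000 + 1/16 in modulus, so e differs from one
  -- by less than 1/2.
  let v : Fin 4 → ℝ := ![R, 1 / 16, R, R]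
  set B : Set (Fin 4 → ℝ) := Set.Icc (-v) v with hB
  have hBvol : volume B = ENNReal.ofReal (R ^ 3) := by
    rw [hB, Real.volume_Icc_pi, ← ENNReal.ofReal_prod_of_nonneg]
    · simp [Fin.prod_univ_four, v]
      congr 1
      ring
    · intro i _
      fin_cases i <;> simp [v] <;> linarith
  have hvB (y : Fin 4 → ℝ) (hy : y ∈ B) (i : Fin 4) : |y i| ≤ v i := abs_le.2 ⟨hy.1 i, hy.2 i⟩
  have hBm : MeasurableSet B := measurableSet_Icc
  have hlow (y : Fin 4 → ℝ) (hy : y ∈ B) :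
      δ / 2 ≤ ‖extension twisted D 1 (WithLp.toLp 2 y)‖ := by
    have h1 : ‖∫ z in D, (e (inner ℝ (WithLp.toLp 2 y) (surface twisted z)) - 1)‖ ≤
        1 / 2 * volume.real D := by
      refine norm_setIntegral_le_of_norm_le_const (by rw [hvol]; exact ENNReal.ofReal_lt_top)
        fun z hz => (norm_e_sub_one_le _).trans ?_
      obtain ⟨⟨t0, t1⟩, s0, s1⟩ := hz
      have hcoord := hvB y hy
      have hy0 : |y 0| ≤ R := hcoord 0
      have hy1 : |y 1| ≤ 1 / 16 := hcoord 1
      have hy2 : |y 2| ≤ R := hcoord 2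
      have hy3 : |y 3| ≤ R := hcoord 3
      have ht : |z.1| ≤ δ := by rwa [abs_of_nonneg t0]
      have ht' : |z.1| ≤ 1 := ht.trans hδ1
      have hs : |z.2| ≤ 1 := by rwa [abs_of_nonneg s0]
      have k0 : |y 0 * z.1| ≤ 1 / 1000 := by
        rw [abs_mul, ← hδR, mul_comm]
        gcongr
      have k2 : |y 2 * z.1 ^ 2| ≤ 1 / 1000 := by
        rw [abs_mul, abs_pow, sq, ← hδR, mul_comm]
        refine mul_le_mul ?_ hy2 (abs_nonneg _) hδ0.le
        exact (mul_le_of_le_one_right (abs_nonneg _) ht').trans ht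
      have k3 : |y 3 * z.1| ≤ 1 / 1000 := by
        rw [abs_mul, ← hδR, mul_comm]
        gcongr
      have k1 : |(y 1 + y 3 * z.1) * z.2| ≤ 1 / 16 + 1 / 1000 := by
        rw [abs_mul]
        refine (mul_le_of_le_one_right (abs_nonneg _) hs).trans ?_
        exact (abs_add_le _ _).trans (add_le_add hy1 k3)
      have k : |inner ℝ (WithLp.toLp 2 y) (surface twisted z)| ≤ 1 / 1000 + 1 / 1000 +
          (1 / 16 + 1 / 1000) := by
        rw [inner_surface_twisted]
        exact (abs_add_le _ _).trans (add_le_add ((abs_add_le _ _).trans (add_le_add k0 k2)) k1)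
      calc _ ≤ 2 * Real.pi * (1 / 1000 + 1 / 1000 + (1 / 16 + 1 / 1000)) := by gcongr
        _ ≤ 1 / 2 := by linarith [Real.pi_lt_d2]
    have hc : IntegrableOn (fun _ : ℝ × ℝ => (1 : ℂ)) D :=
      integrableOn_const (by rw [hvol]; exact ENNReal.ofReal_ne_top)
    have hi : IntegrableOn (fun z => e (inner ℝ (WithLp.toLp 2 y) (surface twisted z))) D := by
      simpa using integrableOn_mul_phase (A := twisted) hc (WithLp.toLp 2 y)
    have hext : extension twisted D 1 (WithLp.toLp 2 y) =
        ∫ z in D, e (inner ℝ (WithLp.toLp 2 y) (surface twisted z)) := by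
      simp [extension]
    rw [integral_sub hi hc, setIntegral_const, hvolr, ← hext] at h1
    have h3 := norm_sub_norm_le (δ • (1 : ℂ)) (extension twisted D 1 (WithLp.toLp 2 y))
    rw [norm_smul, norm_one, mul_one, Real.norm_of_nonneg hδ0.le, norm_sub_rev] at h3
    linarith
  have hweight (y : Fin 4 → ℝ) (hy : y ∈ B) :
      (3 ^ 100)⁻¹ ≤ ballWeight 0 R (WithLp.toLp 2 y) := by
    have hn : ‖WithLp.toLp 2 y‖ ≤ 2 * R := by
      have hcoord := hvB y hy
      have hy0 : |y 0| ≤ R := hcoord 0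
      have hy1 : |y 1| ≤ R := (hcoord 1).trans (show (1 / 16 : ℝ) ≤ R by linarith)
      have hy2 : |y 2| ≤ R := hcoord 2
      have hy3 : |y 3| ≤ R := hcoord 3
      rw [EuclideanSpace.norm_eq, Fin.sum_univ_four]
      refine Real.sqrt_le_iff.2 ⟨by positivity, ?_⟩
      simp only [Real.norm_eq_abs]
      nlinarith [pow_le_pow_left₀ (abs_nonneg _) hy0 2, pow_le_pow_left₀ (abs_nonneg _) hy1 2,
        pow_le_pow_left₀ (abs_nonneg _) hy2 2, pow_le_pow_left₀ (abs_nonneg _) hy3 2]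
    rw [ballWeight, sub_zero, ← one_div]
    refine one_div_le_one_div_of_le (by positivity) (pow_le_pow_left₀ (by positivity) ?_ _)
    have : ‖WithLp.toLp 2 y‖ / R ≤ 2 := (div_le_iff₀ hR0).2 hn
    linarith
  rw [wNorm_rpow hp 0 hR0, ← (PiLp.volume_preserving_toLp (Fin 4)).lintegral_comp_emb
    (MeasurableEquiv.toLp 2 (Fin 4 → ℝ)).measurableEmbedding]
  refine le_trans ?_ (setLIntegral_le_lintegral B _)
  calc _ = ∫⁻ y in B, ENNReal.ofReal ((δ / 2) ^ p * (3 ^ 100)⁻¹) := by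
        rw [setLIntegral_const, hBvol, ← ENNReal.ofReal_mul (by positivity), mul_comm]
    _ ≤ _ := by
        refine setLIntegral_mono' hBm fun y hy => ?_
        rw [ENNReal.ofReal_mul (by positivity)]
        refine mul_le_mul' ?_ (ENNReal.ofReal_le_ofReal (hweight y hy))
        rw [← ENNReal.ofReal_rpow_of_nonneg (by positivity) hp.le, ← ofReal_norm]
        exact ENNReal.rpow_le_rpow (ENNReal.ofReal_le_ofReal (hlow y hy)) hp.le

theorem extension_indicator (A : Coeffs) (S : Set (ℝ × ℝ)) {T : Set (ℝ × ℝ)} (g : ℝ × ℝ → ℂ)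
    (hT : MeasurableSet T) : extension A S (T.indicator g) = extension A (S ∩ T) g := by
  ext x
  rw [extension, extension, ← setIntegral_indicator hT]
  simp only [Set.indicator_mul_left]

/-- Pairwise non-transverse squares in one column saturate the trivial decoupling inequality. -/
theorem exists_nontransverse_lower_bound {p : ℝ} (hp : 2 ≤ p) : ∃ κ : ℝ≥0, 0 < κ ∧
    ∀ (m : ℕ) (N : ℝ), (2 : ℝ) ^ m ≤ N → ∀ c : EuclideanSpace ℝ (Fin 4),
      ∃ (S : Finset (Fin (2 ^ m) × Fin (2 ^ m))) (g : ℝ × ℝ → ℂ),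
        (∀ q ∈ S, ∀ r ∈ S, ¬ Transverse twisted (1 / ((2 : ℝ) ^ m) ^ 2)
          (dyadicSquare m q) (dyadicSquare m r)) ∧
        IntegrableOn g unitSquare ∧
        Function.support g ⊆ (⋃ q ∈ S, dyadicSquare m q) ∧
        0 < pieceSum twisted p m c N g ∧
        (κ : ℝ≥0∞) * ((2 ^ m : ℝ≥0∞) ^ (p - 2) * pieceSum twisted p m c N g) ≤
          wNorm p c N (extension twisted unitSquare g) ^ p := by
  have hp0 : 0 < p := by linarith
  -- κ is the ratio of the constants in the lower bound for the strip and the upper bound for one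
  -- piece.
  refine ⟨((1 / 2) ^ p * (3 ^ 100)⁻¹ / (2 * Real.pi ^ 4)).toNNReal,
    Real.toNNReal_pos.2 (by positivity), fun m N hN c => ?_⟩
  set K : ℝ := 2 ^ m with hK
  have hK1 : 1 ≤ K := one_le_pow₀ (by norm_num)
  have hK0 : 0 < K := by linarith
  have hN1 : 1 ≤ N := hK1.trans hN
  have hN0 : 0 < N := by linarith
  set δ := (1000 * N)⁻¹ with hδ
  have hδ0 : 0 < δ := by positivity
  have hδK : K * δ < 1 := by
    rw [hδ, ← div_eq_mul_inv, div_lt_one (by positivity)]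
    linarith
  have hδ1 : δ ≤ 1 := by nlinarith
  set D : Set (ℝ × ℝ) := Set.Icc 0 δ ×ˢ Set.Icc 0 1 with hD
  have hDm : MeasurableSet D := measurableSet_Icc.prod measurableSet_Icc
  have hDU : D ⊆ unitSquare := by
    rw [unitSquare, square, zero_add]
    exact Set.prod_mono (Set.Icc_subset_Icc_right hδ1) subset_rfl
  have hfst (q : Fin (2 ^ m) × Fin (2 ^ m)) (z : ℝ × ℝ) (hz : z ∈ dyadicSquare m q)
      (hzD : z ∈ D) : (q.1 : ℕ) = 0 := by
    have h1 := (mem_dyadicSquare_iff.1 hz).1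
    have h2 : ((q.1 : ℕ) : ℝ) < 1 :=
      h1.trans_lt ((mul_le_mul_of_nonneg_left hzD.1.2 hK0.le).trans_lt hδK)
    have h3 : (q.1 : ℕ) < 1 := by exact_mod_cast h2
    omega
  set h : ℝ × ℝ → ℂ := D.indicator 1 with hh
  set g : ℝ × ℝ → ℂ := fun z => h z * e (-inner ℝ c (surface twisted z)) with hg
  have hgi : IntegrableOn g unitSquare := by
    have h1 : IntegrableOn h unitSquare := by
      refine IntegrableOn.mono_set (t := Set.univ) ?_ (Set.subset_univ _)
      rw [integrableOn_univ, hh, integrable_indicator_iff hDm]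
      exact (continuous_const (y := (1 : ℂ))).continuousOn.integrableOn_compact
        (isCompact_Icc.prod isCompact_Icc)
    simpa only [hg, inner_neg_left] using integrableOn_mul_phase (A := twisted) h1 (-c)
  have hlow : ENNReal.ofReal (N ^ 3 * ((δ / 2) ^ p * (3 ^ 100)⁻¹)) ≤
      wNorm p c N (extension twisted unitSquare g) ^ p := by
    rw [hg, wNorm_extension_modulate twisted hp0 _ _ _ hN0]
    have h1 : extension twisted unitSquare h = extension twisted D 1 := by
      rw [hh, extension_indicator _ _ _ hDm, Set.inter_eq_self_of_subset_right hDU]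
    rw [h1]
    exact le_wNorm_extension_twisted_rpow hp0 hN1
  have hpiece (q : Fin (2 ^ m) × Fin (2 ^ m)) :
      wNorm p c N (extension twisted (dyadicSquare m q) g) ^ p ≤
        if (q.1 : ℕ) = 0 then
          ENNReal.ofReal (2 * Real.pi ^ 4 * N ^ 3 * (δ ^ p * (1 / K) ^ (p - 1))) else 0 := by
    rw [hg, wNorm_extension_modulate twisted hp0 _ _ _ hN0]
    split_ifs with hq
    · have h1 : extension twisted (dyadicSquare m q) h =
          extension twisted (Set.Icc 0 δ ×ˢ Set.Icc ((q.2 : ℕ) / K) ((q.2 : ℕ) / K + 1 / K)) 1 := by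
        rw [hh, extension_indicator _ _ _ hDm]
        congr 1
        ext z
        have hz1 (hz : z ∈ dyadicSquare m q) := dyadicSquare_subset_unitSquare m q hz
        simp only [unitSquare, dyadicSquare, square, hD, hq, ← hK, Set.mem_inter_iff, Set.mem_prod,
          Set.mem_Icc, Nat.cast_zero, zero_div, zero_add] at hz1 ⊢
        have hle : δ ≤ 1 / K := by
          rw [le_div_iff₀ hK0, mul_comm]
          exact hδK.le
        constructor
        · rintro ⟨⟨-, h2⟩, h3, -⟩
          exact ⟨h3, h2⟩
        · rintro ⟨h3, h2⟩
          have h4 := And.intro (And.intro h3.1 (h3.2.trans hle)) h2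
          exact ⟨h4, h3, (hz1 h4).2⟩
      rw [h1]
      exact wNorm_extension_twisted_rpow_le hp hN0 hδ0.le _ (by positivity)
    · have h1 : extension twisted (dyadicSquare m q) h = 0 := by
        ext x
        refine setIntegral_eq_zero_of_forall_eq_zero fun z hz => ?_
        rw [hh, Set.indicator_of_notMem fun hzD => hq (hfst q z hz hzD), zero_mul]
      rw [h1, wNorm_zero, ENNReal.zero_rpow_of_pos hp0]
  have hsum : pieceSum twisted p m c N g ≤
      ENNReal.ofReal (K * (2 * Real.pi ^ 4 * N ^ 3 * (δ ^ p * (1 / K) ^ (p - 1)))) := by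
    refine (Finset.sum_le_sum fun q _ => hpiece q).trans_eq ?_
    rw [Fintype.sum_prod_type_right]
    have h1 (j : Fin (2 ^ m)) : (∑ i : Fin (2 ^ m), if (i : ℕ) = 0 then
        ENNReal.ofReal (2 * Real.pi ^ 4 * N ^ 3 * (δ ^ p * (1 / K) ^ (p - 1))) else 0) =
        ENNReal.ofReal (2 * Real.pi ^ 4 * N ^ 3 * (δ ^ p * (1 / K) ^ (p - 1))) := by
      have h2 (i : Fin (2 ^ m)) : (i : ℕ) = 0 ↔ i = ⟨0, by positivity⟩ := by rw [Fin.ext_iff]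
      simp only [h2, Finset.sum_ite_eq', Finset.mem_univ, if_true]
    refine (Finset.sum_congr rfl fun j _ => h1 j).trans ?_
    rw [Finset.sum_const, Finset.card_univ, Fintype.card_fin,
      ENNReal.ofReal_mul hK0.le, nsmul_eq_mul, hK, ← ENNReal.ofReal_natCast]
    push_cast
    rfl
  refine ⟨Finset.univ.filter fun q => (q.1 : ℕ) = 0, g, fun q hq r hr htr => ?_, hgi,
    fun z hz => ?_, ?_, ?_⟩
  -- Squares of the column have points with equal first coordinate, and c₃ = 0 makes the form vanish
  -- on such pairs.
  · have hmem (q : Fin (2 ^ m) × Fin (2 ^ m)) (hq : (q.1 : ℕ) = 0) :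
        ((0 : ℝ), ((q.2 : ℕ) : ℝ) / K) ∈ dyadicSquare m q := by
      have hcancel : K * (((q.2 : ℕ) : ℝ) / K) = (q.2 : ℕ) := by field_simp
      rw [mem_dyadicSquare_iff, hq, ← hK, hcancel]
      simp
    have := htr _ (hmem q (Finset.mem_filter.1 hq).2) _ (hmem r (Finset.mem_filter.1 hr).2)
    have hc3 : twisted.c3 = 0 := by simp [Coeffs.c3, twisted]
    rw [hc3] at this
    have hpos : 0 < 1 / K ^ 2 := by positivity
    simp only [sub_self, zero_pow two_ne_zero, mul_zero, zero_mul, add_zero, abs_zero] at this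
    exact absurd this (not_le.2 hpos)
  · have hzD : z ∈ D := by
      by_contra hcon
      exact hz (by rw [hg]; simp only; rw [hh, Set.indicator_of_notMem hcon, zero_mul])
    have hzU := hDU hzD
    rw [← iUnion_dyadicSquare m] at hzU
    obtain ⟨q, hq⟩ := Set.mem_iUnion.1 hzU
    exact Set.mem_biUnion (Finset.mem_coe.2 (Finset.mem_filter.2
      ⟨Finset.mem_univ q, hfst q z hq hzD⟩)) hq
  · rw [pos_iff_ne_zero]
    intro h0
    -- A zero sum would force the extension to vanish by the trivial decoupling, against the lower
    -- bound.
    have h1 := hlow.trans (wNorm_extension_rpow_le_pieceSum (by linarith) hgi m c hN0)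
    rw [h0, mul_zero, nonpos_iff_eq_zero, ENNReal.ofReal_eq_zero] at h1
    exact absurd h1 (not_le.2 (by positivity))
  · refine le_trans ?_ hlow
    have hK2 : (2 ^ m : ℝ≥0∞) ^ (p - 2) = ENNReal.ofReal (K ^ (p - 2)) := by
      rw [← ENNReal.ofReal_rpow_of_pos hK0, hK, ENNReal.ofReal_pow (by norm_num)]
      norm_num
    rw [hK2]
    refine (mul_le_mul_right (mul_le_mul_right hsum _) _).trans_eq ?_
    change ENNReal.ofReal _ * _ = _
    rw [← ENNReal.ofReal_mul (by positivity),
      ← ENNReal.ofReal_mul (by positivity)]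
    congr 1
    -- The K pieces, each of order K^{-(p-1)}, cancel the factor K^{p-2} exactly.
    have e1 : K ^ (p - 2) * (K * (1 / K) ^ (p - 1)) = 1 := by
      rw [one_div, Real.inv_rpow hK0.le, show p - 1 = (p - 2) + 1 by ring,
        Real.rpow_add_one hK0.ne']
      have : K ^ (p - 2) ≠ 0 := by positivity
      field_simp
    have e2 : (δ / 2) ^ p = (1 / 2) ^ p * δ ^ p := by
      rw [← Real.mul_rpow (by norm_num) hδ0.le]
      congr 1
      ring
    rw [e2]
    have hpi : Real.pi ≠ 0 := Real.pi_ne_zero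
    calc _ = (1 / 2) ^ p * (3 ^ 100)⁻¹ * N ^ 3 * δ ^ p *
          (K ^ (p - 2) * (K * (1 / K) ^ (p - 1))) := by
          field_simp
      _ = _ := by
          rw [e1]
          ring

end Decoupling

end

/-- The scales are `K = 2ᵐ` and `N = 4ⁿ`, so that dyadic squares of side lengths `1/K` and
`N^{-1/2}` exist. First part: the inequality, with a constant that depends only on `p` and on
the nondegeneracy bound `L` of the surface. Second part: the factor `K^{p-2}` is sharp, already
for the surface `(t, s, t², ts)` and for functions that live on pairwise non-transverse squares. -/
theorem proposition5p3 (p : ℝ) (hp : 2 ≤ p) :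
    (∀ L : ℝ, 0 < L → ∃ C : ℝ≥0, ∀ A : Decoupling.Coeffs, A.Nondegenerate L →
      ∀ (m n : ℕ) (g : ℝ × ℝ → ℂ), IntegrableOn g Decoupling.unitSquare →
      ∀ c : EuclideanSpace ℝ (Fin 4),
        Decoupling.wNorm p c (4 ^ n) (Decoupling.extension A Decoupling.unitSquare g) ^ p ≤
          (C : ℝ≥0∞) *
            ((2 ^ m : ℝ≥0∞) ^ (p - 2) * Decoupling.pieceSum A p m c (4 ^ n) g +
              (2 ^ m : ℝ≥0∞) ^ (4 * p) *
                Decoupling.Dmulti A n p (1 / ((2 : ℝ) ^ m) ^ 2) ^ p *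
                Decoupling.pieceSum A p n c (4 ^ n) g)) ∧
    (∃ κ : ℝ≥0, 0 < κ ∧ ∀ (m : ℕ) (N : ℝ), (2 : ℝ) ^ m ≤ N →
      ∀ c : EuclideanSpace ℝ (Fin 4),
      ∃ (S : Finset (Fin (2 ^ m) × Fin (2 ^ m))) (g : ℝ × ℝ → ℂ),
        (∀ q ∈ S, ∀ r ∈ S, ¬ Decoupling.Transverse Decoupling.twisted (1 / ((2 : ℝ) ^ m) ^ 2)
          (Decoupling.dyadicSquare m q) (Decoupling.dyadicSquare m r)) ∧
        IntegrableOn g Decoupling.unitSquare ∧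
        Function.support g ⊆ (⋃ q ∈ S, Decoupling.dyadicSquare m q) ∧
        0 < Decoupling.pieceSum Decoupling.twisted p m c N g ∧
        (κ : ℝ≥0∞) * ((2 ^ m : ℝ≥0∞) ^ (p - 2) *
            Decoupling.pieceSum Decoupling.twisted p m c N g) ≤
          Decoupling.wNorm p c N
            (Decoupling.extension Decoupling.twisted Decoupling.unitSquare g) ^ p) := by
  exact ⟨fun _ hL => Decoupling.exists_multilinear_bound hp hL,
    Decoupling.exists_nontransverse_lower_bound hp⟩
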